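/- Let $\mathbb F$ be a field or skew field. Fix $t\ge 1$ and $1\le k\le t$. A \emph{bangle} over $\mathbb F$ is a matrix $A=[A_1|\dots|\boxed{A_k}|\dots|A_t]$ partitioned into vertical strips, with $n_k\ge 0$ rows, $n_i\ge0$ columns in the strip $A_i$, so that the boxed strip $A_k$ is square. If an involution $a\mapsto\bar a$ on $\mathbb F$ (additive, $\overline{ab}=\bar b\,\bar a$, $\bar{\bar a}=a$; possibly the identity if $\mathbb F$ is a field) is given, two bangles $A,B$ with the same strip sizes are \emph{*congruent} if $B=S_{kk}^*AS$, where $S^*=\bar S^T$, and (without any involution) \emph{similar} if $B=S_{kk}^{-1}AS$, for some nonsingular upper block-triangular matrix $S=[S_{ij}]$ whose diagonal blocks $S_{ii}$ are $n_i\times n_i$. The *congruence with respect to the identity involution of a field is called \emph{congruence}. The block-direct sum is $A\uplus B=[A_1\oplus B_1|\dots|\boxed{A_k\oplus B_k}|\dots|A_t\oplus B_t]$. For a square matrix $K$ denote by $\langle K\rangle$ the bangle with boxed strip $K$ whose other strips have no columns. Let $J_q(\lambda)$ be the $q\times q$ upper triangular Jordan block, $E_q=(0,\dots,0,1)^T$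 of height $q\ge1$, and let $E_0$ be the $0\times 1$ matrix. A \emph{regularizing decomposition} of $A$ for *congruence (for similarity) is a bangle *congruent (similar) to $A$ that is the block-direct sum of a \emph{regular part} $\langle K\rangle$ with $K$ nonsingular and a \emph{singular part}, which is a block-direct sum of bangles $\langle J_q(0)\rangle$, $q\ge 1$, and bangles with boxed strip $J_q(0)$, $q\ge0$, one other strip (to the left or to the right of the boxed one) equal to $E_q$, and all remaining strips without columns. Both parts may be empty. (a) Every bangle $A$ over $\mathbb F$ has a regularizing decomposition for *congruence (with respect to any given involution) and one for similarity. The regular part is determined by $A$ uniquely up to *congruence, respectively similarity, and the singular part is determined by $A$ uniquely up to permutation of summands. (b) Let $\mathbb F=\mathbb C$, with the identity involution (congruence) or with complex conjugation (*congruence). Let $\Gamma_n$ be the $n\times n$ matrix whose $(i,j)$ entry is $(-1)^{n-i}$ if $i+j\in\{n+1,n+2\}$ and $0$ otherwise; let $\Delta_n$ be the $n\times n$ matrix whose $(i,j)$ entry is $1$ if $i+j=n+1$, the imaginary unit if $i+j=n+2$, and $0$ otherwise; and let $H_{2n}(\lambda)=\begin{bmatrix}0&I_n\\J_n(\lambda)&0\end{bmatrix}$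 ($n\ge 1$). If $\Sigma_A$ is a regularizing decomposition of $A$ for congruence (*congruence) with regular part $\langle K\rangle$, then $\langle K\rangle$ is congruent (*congruent) to a block-direct sum $\biguplus_i\langle K_i\rangle$ in which every $K_i$ is: for congruence, $\Gamma_n$, or $H_{2n}(\lambda)$ with $\lambda\ne0,(-1)^{n+1}$; for *congruence, $\lambda\Gamma_n$ with $|\lambda|=1$, or $H_{2n}(\mu)$ with $|\mu|>1$ (alternatively, $\Delta_n$ may be used instead of $\Gamma_n$ throughout for *congruence). Replacing the regular part of $\Sigma_A$ by this sum, one obtains a canonical form of $A$: a bangle congruent (*congruent) to $A$ and determined by $A$ uniquely up to permutation of summands (and, for congruence, up to replacement of $\lambda$ by $\lambda^{-1}$ in summands $H_{2n}(\lambda)$). (c) Let $\mathbb F=\mathbb C$. If $\Sigma_A$ is a regularizing decomposition of $A$ for similarity, then its regular part is similar to a block-direct sum of bangles $\langle J_q(\lambda)\rangle$ with $q\ge 1$, $\lambda\ne0$. Replacing the regular part of $\Sigma_A$ by this sum, one obtains a canonical form of $A$ for similarity: a bangle similar to $A$ and determined by $A$ uniquely up to permutation of summands. -/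

import Mathlib

/-- An involution on a ring `F`: an additive, anti-multiplicative map which is its own inverse
(hence a bijection). -/
structure IsRingInvolution {F : Type*} [Ring F] (σ : F → F) : Prop where
  map_add : ∀ a b, σ (a + b) = σ a + σ b
  map_mul : ∀ a b, σ (a * b) = σ b * σ a
  involutive : ∀ a, σ (σ a) = a

/-- A bangle over `F` with `t` vertical strips, the `k`-th one being boxed. The `i`-th strip has
`size i` columns, the number of rows is `size k`, so that the boxed strip is square. -/
structure Bangle (F : Type*) {t : ℕ} (k : Fin t) where
  size : Fin t → ℕ
  strip : ∀ i, Matrix (Fin (size k)) (Fin (size i)) F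

namespace Bangle

variable {F : Type*} {t : ℕ} {k : Fin t}

/-- The whole matrix `[A_1 | ... | A_t]`; its columns are the pairs (strip, column in it). -/
def toMatrix (A : Bangle F k) : Matrix (Fin (A.size k)) (Σ i, Fin (A.size i)) F :=
  Matrix.of fun a p => A.strip p.1 a p.2

/-- The matrix of `B`, for `B` with the same strip sizes as `A`. -/
def toMatrixOfSize (A B : Bangle F k) (h : ∀ i, A.size i = B.size i) :
    Matrix (Fin (A.size k)) (Σ i, Fin (A.size i)) F :=
  B.toMatrix.submatrix (Fin.cast (h k)) (fun p => ⟨p.1, Fin.cast (h p.1) p.2⟩)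

/-- The `k`-th diagonal block `S_kk` of a matrix partitioned conformally to the strips of `A`. -/
def diagBlock (A : Bangle F k) (S : Matrix (Σ i, Fin (A.size i)) (Σ i, Fin (A.size i)) F) :
    Matrix (Fin (A.size k)) (Fin (A.size k)) F :=
  S.submatrix (fun a => ⟨k, a⟩) (fun a => ⟨k, a⟩)

/-- `*`congruence of bangles with respect to the involution `σ`: same sizes, and
`B = S_kk^* A S` for a nonsingular upper block-triangular `S`. -/
def IsCongruent [DivisionRing F] (σ : F → F) (A B : Bangle F k) : Prop :=
  ∃ (h : ∀ i, A.size i = B.size i) (S : Matrix (Σ i, Fin (A.size i)) (Σ i, Fin (A.size i)) F),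
    IsUnit S ∧ S.BlockTriangular Sigma.fst ∧
      A.toMatrixOfSize B h = ((A.diagBlock S).transpose.map σ) * A.toMatrix * S

/-- Similarity of bangles: same sizes, and `B = S_kk⁻¹ A S` for a nonsingular upper
block-triangular `S` (here `T` is the inverse of `S_kk`). -/
def IsSimilar [DivisionRing F] (A B : Bangle F k) : Prop :=
  ∃ (h : ∀ i, A.size i = B.size i) (S : Matrix (Σ i, Fin (A.size i)) (Σ i, Fin (A.size i)) F)
    (T : Matrix (Fin (A.size k)) (Fin (A.size k)) F),
    IsUnit S ∧ S.BlockTriangular Sigma.fst ∧ T * A.diagBlock S = 1 ∧ A.diagBlock S * T = 1 ∧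
      A.toMatrixOfSize B h = T * A.toMatrix * S

/-- The block-direct sum `A ⊎ B` of two bangles. -/
def dsum [Zero F] (A B : Bangle F k) : Bangle F k where
  size i := A.size i + B.size i
  strip i := Matrix.reindex finSumFinEquiv finSumFinEquiv
    (Matrix.fromBlocks (A.strip i) 0 0 (B.strip i))

/-- The empty bangle: all sizes are zero. -/
def empty [Zero F] : Bangle F k where
  size _ := 0
  strip _ := 0

/-- The block-direct sum of a list of bangles. -/
def dsumList [Zero F] (L : List (Bangle F k)) : Bangle F k :=
  L.foldr dsum empty

/-- The bangle whose boxed strip is `K` and whose other strips have no columns. -/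
def ofBox [Zero F] (k : Fin t) {p : ℕ} (K : Matrix (Fin p) (Fin p) F) : Bangle F k where
  size i := if i = k then p else 0
  strip i :=
    if h : i = k then K.submatrix (Fin.cast (if_pos rfl)) (Fin.cast (if_pos h)) else 0

/-- The bangle whose boxed strip is `K`, whose `j`-th strip is `E` (used for `j ≠ k`), and whose
other strips have no columns. -/
def ofBoxStrip [Zero F] (k : Fin t) {p m : ℕ} (K : Matrix (Fin p) (Fin p) F) (j : Fin t)
    (E : Matrix (Fin p) (Fin m) F) : Bangle F k where
  size i := if i = k then p else if i = j then m else 0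
  strip i :=
    if h : i = k then K.submatrix (Fin.cast (if_pos rfl)) (Fin.cast (if_pos h))
    else if h' : i = j then
      E.submatrix (Fin.cast (if_pos rfl))
        (Fin.cast ((if_neg h).trans (if_pos h')))
    else 0

end Bangle

/-- The `n × n` upper triangular Jordan block `J_n(a)`. -/
def jordanJ {F : Type*} [Zero F] [One F] (n : ℕ) (a : F) : Matrix (Fin n) (Fin n) F :=
  Matrix.of fun i j => if i = j then a else if i.val + 1 = j.val then 1 else 0

/-- The column `E_q = (0, ..., 0, 1)ᵀ` of height `q`; `E_0` is the `0 × 1` matrix. -/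
def colE {F : Type*} [Zero F] [One F] (q : ℕ) : Matrix (Fin q) (Fin 1) F :=
  Matrix.of fun i _ => if i.val + 1 = q then 1 else 0

/-- The singular summands: `box q` is `[0_{q0} | ... | [J_q(0)] | ... | 0_{q0}]` with `q ≥ 1`, and
`strip j q` (with `j ≠ k`, `q ≥ 0`) has `J_q(0)` as its boxed strip, `E_q` as its `j`-th strip, and
`0_{q0}` as its other strips. -/
inductive SingularSummand {t : ℕ} (k : Fin t) where
  | box (q : ℕ) (hq : 1 ≤ q)
  | strip (j : Fin t) (hj : j ≠ k) (q : ℕ)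

/-- The bangle described by a singular summand. -/
def SingularSummand.toBangle (F : Type*) [Zero F] [One F] {t : ℕ} {k : Fin t} :
    SingularSummand k → Bangle F k
  | .box q _ => Bangle.ofBox k (jordanJ q (0 : F))
  | .strip j _ q => Bangle.ofBoxStrip k (jordanJ q (0 : F)) j (colE q)

/-- The singular part with a given list of summands. -/
def singularPart (F : Type*) [Zero F] [One F] {t : ℕ} {k : Fin t}
    (L : List (SingularSummand k)) : Bangle F k :=
  Bangle.dsumList (L.map (SingularSummand.toBangle F))

/-- The data of a block-direct sum of a regular part (with nonsingular boxed block `K`) and a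
singular part. -/
structure RegularizedForm (F : Type*) [DivisionRing F] {t : ℕ} (k : Fin t) where
  p : ℕ
  K : Matrix (Fin p) (Fin p) F
  nonsingular : IsUnit K
  sing : List (SingularSummand k)

namespace RegularizedForm

variable {F : Type*} [DivisionRing F] {t : ℕ} {k : Fin t}

/-- The regular part. -/
def regPart (R : RegularizedForm F k) : Bangle F k := Bangle.ofBox k R.K

/-- The bangle itself. -/
def toBangle (R : RegularizedForm F k) : Bangle F k :=
  R.regPart.dsum (singularPart F R.sing)

/-- `R` is a regularizing decomposition of `A` with respect to `*`congruence. -/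
def IsDecompForCongruence (σ : F → F) (R : RegularizedForm F k) (A : Bangle F k) : Prop :=
  A.IsCongruent σ R.toBangle

/-- `R` is a regularizing decomposition of `A` with respect to similarity. -/
def IsDecompForSimilarity (R : RegularizedForm F k) (A : Bangle F k) : Prop :=
  A.IsSimilar R.toBangle

end RegularizedForm

/-- The matrix `Γ_n`: in each row the nonzero entries are equal to `1` or `-1`, with sign
alternating from row to row and `1` in the last row; they stand on the antidiagonal and just
below it. -/
def Gam (n : ℕ) : Matrix (Fin n) (Fin n) ℂ :=
  Matrix.of fun i j =>
    if i.val + j.val + 1 = n ∨ i.val + j.val = n then (-1) ^ (n - 1 - i.val) else 0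

/-- The symmetric matrix `Δ_n`: `1` on the antidiagonal and the imaginary unit just below it. -/
def Del (n : ℕ) : Matrix (Fin n) (Fin n) ℂ :=
  Matrix.of fun i j =>
    if i.val + j.val + 1 = n then 1 else if i.val + j.val = n then Complex.I else 0

/-- The `2n × 2n` matrix `[0, I_n; J_n(a), 0]`. -/
def hyperbolicH (n : ℕ) (a : ℂ) : Matrix (Fin (n + n)) (Fin (n + n)) ℂ :=
  Matrix.reindex finSumFinEquiv finSumFinEquiv (Matrix.fromBlocks 0 1 (jordanJ n a) 0)

/-- Nonsingular canonical blocks for congruence over `ℂ`: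
`Γ_n`, and `[0, I_n; J_n(c), 0]` with `c ≠ 0`, `c ≠ (-1)^(n+1)`. -/
inductive CongBlock where
  | gam (n : ℕ) (hn : 1 ≤ n)
  | hyp (n : ℕ) (hn : 1 ≤ n) (c : ℂ) (h0 : c ≠ 0) (h1 : c ≠ (-1) ^ (n + 1))

/-- Two blocks are identified if they coincide up to replacing `c` by `c⁻¹`. -/
def CongBlock.Same : CongBlock → CongBlock → Prop
  | .gam n _, .gam n' _ => n = n'
  | .hyp n _ c _ _, .hyp n' _ c' _ _ => n = n' ∧ (c' = c ∨ c' = c⁻¹)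
  | _, _ => False

/-- The bangle with only the boxed strip nonempty, equal to the given block. -/
def CongBlock.toBangle {t : ℕ} (k : Fin t) : CongBlock → Bangle ℂ k
  | .gam n _ => Bangle.ofBox k (Gam n)
  | .hyp n _ c _ _ => Bangle.ofBox k (hyperbolicH n c)

/-- Nonsingular canonical blocks for `*`congruence over `ℂ` with complex conjugation:
`c Γ_n` (or `c Δ_n`) with `|c| = 1`, and `[0, I_n; J_n(c), 0]` with `|c| > 1`. -/
inductive StarBlock where
  | unim (n : ℕ) (hn : 1 ≤ n) (c : ℂ) (hc : ‖c‖ = 1)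
  | hyp (n : ℕ) (hn : 1 ≤ n) (c : ℂ) (hc : 1 < ‖c‖)

/-- The bangle with only the boxed strip nonempty, equal to the given block; `G` is the chosen
family `Γ` or `Δ`. -/
def StarBlock.toBangle (G : ∀ n : ℕ, Matrix (Fin n) (Fin n) ℂ) {t : ℕ} (k : Fin t) :
    StarBlock → Bangle ℂ k
  | .unim n _ c _ => Bangle.ofBox k (c • G n)
  | .hyp n _ c _ => Bangle.ofBox k (hyperbolicH n c)

/-- Nonsingular Jordan blocks `J_q(c)`, `q ≥ 1`, `c ≠ 0`. -/
structure JordanBlock where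
  q : ℕ
  hq : 1 ≤ q
  c : ℂ
  hc : c ≠ 0

/-- The bangle with only the boxed strip nonempty, equal to the given Jordan block. -/
def JordanBlock.toBangle {t : ℕ} (k : Fin t) (J : JordanBlock) : Bangle ℂ k :=
  Bangle.ofBox k (jordanJ J.q J.c)

/-!
Similarity and `*`congruence are treated together: a mode `μ : Option (F → F)` is `none` for the
former and `some σ` for the latter, and `tw μ S` is the matrix by which the rows are transformed
when the columns of the boxed strip are transformed by `S`. Bangles are matrices with rows in `ρ`
and columns in `ρ ⊕ C`, with labels on `C` for the strips, and `BIso μ r` is isomorphism of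
bangles whose strips are ordered by `r`.

**Regularizing decompositions.** Row operations turn the pivot columns of a bangle `M`, found from
left to right, into unit vectors. The number of pivots in each strip is an invariant, and column
operations clear the rest of the matrix, except in the boxed strip, whose columns are bound to the
rows. What is left is the form `Red Z X`, in which `X` has as rows the pivots of the boxed strip
and is itself a bangle: its columns correspond to the rows of `M`, which are partitioned into the
pivot rows of the various strips and, as one new strip, the rows without pivot. The row
transformations that preserve the reduced form are block triangular for the corresponding order of
strips (its opposite for `*`congruence, `nextR`), so that isomorphisms of `Red Z X` and `Red Z Y`
amount to isomorphisms of `X` and `Y` (`BIso.of_red` and `BIso.red`). The rows of `X` are linearly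
independent. On the summands of a decomposition the reduction shortens every `J_q(0)` by one, turns
the boxed summands `J_{q+1}(0)` into summands with a column `E_q` in the new strip, and leaves the
regular part alone (`BIso.mod_red`). Existence follows by induction on the number of rows
(`exists_nf`), uniqueness by induction on the lengths of the summands (`nf_unique`). If all rows of
`M` are pivot rows of the boxed strip, then `M` is its own reduction and is isomorphic to a
nonsingular boxed strip beside zero columns. The canonical forms of bangles thereby reduce to
canonical forms of nonsingular matrices (`exists_canonical_form`).

**Similarity over `ℂ`.** A square matrix is a bangle with one strip, and its regularizing
decomposition is the Fitting decomposition together with the Jordan form of the nilpotent part.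
Applied to `A - λ` for the eigenvalues `λ`, this gives the Jordan form and its uniqueness
(`HasJordan`).

**Congruence over `ℂ`.** The similarity class of the cosquare `(A^*)⁻¹ A` is an invariant of `A`.
If `A` and `B` have the same cosquare, then `H = B⁻¹ A` satisfies `B H = H^* B`, and so do all real
polynomials in `H`. Modulo the minimal polynomial of `H` the indeterminate has the form `e r²` with
`e² = 1` (`exists_sq_root_mod`), whence `A` is congruent to `B e` (`exists_selfadjoint_root`).
For the identity involution the scalars may be complex, `e` is a square too, and the cosquare is a
complete invariant (`mEq_id_of_cosqJordan`). Its Jordan form is stable under `λ ↦ λ⁻¹`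
(`CosqJordan.map_eq`), and the blocks `J_n((-1)^n)` occur an even number of times, since
skew-symmetric matrices have even rank (`CosqJordan.even_count`). Such a Jordan form is a sum of
Jordan forms of the cosquares of matrices `Γ_n` and `H_{2n}(λ)`.

**`*`congruence over `ℂ`.** Here the eigenspaces of `e` split `B` as `B₁ ⊕ B₂` in such a way that
`A` is `*`congruent to `-B₁ ⊕ B₂` (`exists_mEq_signed`). Taking for `B` a sum of canonical blocks
with the cosquare of `A`, one obtains the existence of canonical forms by induction on the size. The
multiplicity of `H_{2n}(μ)` can be read off from the cosquare, and that of a multiple of `Γ_n` or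
`Δ_n` is the positive index of a form on a generalized eigenspace of the cosquare (`SignIndex`).
The two choices `Γ` and `Δ` differ in a few constants only (`IsStarFamily`).
-/

set_option linter.unusedSectionVars false
set_option linter.unusedSimpArgs false
set_option linter.unusedVariables false

open Matrix

/-! ### Twisted inverses and block triangular matrices -/

section Twist

variable {F : Type*} {m n l : Type*}

/-- The matrix by which the rows of a bangle are transformed, as a function of an invertible matrix
`S` and its inverse `S'`. The mode `none` stands for similarity and yields `S`; the mode `some σ`
stands for `*`congruence with respect to `σ` and yields `S'^*`. -/
def tw (μ : Option (F → F)) (S : Matrix m n F) (S' : Matrix n m F) : Matrix m n F :=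
  match μ with
  | none => S
  | some σ => S'.transpose.map σ

/-- A mode is admissible if its map, if there is one, is an involution. -/
def ModeOK [Ring F] (μ : Option (F → F)) : Prop := ∀ σ, μ = some σ → IsRingInvolution σ

namespace IsRingInvolution

variable [Ring F] {σ : F → F} (h : IsRingInvolution σ)
include h

theorem map_zero : σ 0 = 0 := by
  have := h.map_add 0 0
  simpa using this

theorem map_one : σ 1 = 1 := by
  have := h.map_mul (σ 1) 1
  rw [mul_one, h.involutive] at this
  simpa using this.symm

theorem map_sum {α : Type*} (s : Finset α) (f : α → F) : σ (∑ i ∈ s, f i) = ∑ i ∈ s, σ (f i) := by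
  classical
  induction s using Finset.induction_on with
  | empty => simp [h.map_zero]
  | insert a s ha ih => rw [Finset.sum_insert ha, Finset.sum_insert ha, h.map_add, ih]

theorem adj_mul [Fintype n] (A : Matrix m n F) (B : Matrix n l F) :
    (A * B).transpose.map σ = B.transpose.map σ * A.transpose.map σ := by
  ext i j
  simp [Matrix.mul_apply, h.map_sum, h.map_mul]

theorem adj_one [DecidableEq m] : ((1 : Matrix m m F).transpose.map σ) = 1 := by
  ext i j
  by_cases hij : i = j <;> simp [Matrix.one_apply, hij, h.map_one, h.map_zero]

theorem adj_adj (A : Matrix m n F) : (A.transpose.map σ).transpose.map σ = A := by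
  ext i j
  simp [h.involutive]

end IsRingInvolution

variable [Ring F] {μ : Option (F → F)} (hμ : ModeOK μ)

include hμ in
theorem tw_mul [Fintype n] (S : Matrix m n F) (S' : Matrix n m F) (T : Matrix n l F)
    (T' : Matrix l n F) : tw μ (S * T) (T' * S') = tw μ S S' * tw μ T T' := by
  match μ with
  | none => rfl
  | some σ => exact (hμ σ rfl).adj_mul _ _

include hμ in
theorem tw_one [DecidableEq m] : tw μ (1 : Matrix m m F) 1 = 1 := by
  match μ with
  | none => rfl
  | some σ => exact (hμ σ rfl).adj_one

include hμ in
theorem tw_tw (S : Matrix m n F) (S' : Matrix n m F) : tw μ (tw μ S S') (tw μ S' S) = S := by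
  match μ with
  | none => rfl
  | some σ => exact (hμ σ rfl).adj_adj _

omit [Ring F] in
theorem tw_submatrix {m' n' : Type*} (S : Matrix m n F) (S' : Matrix n m F) (f : m' → m)
    (g : n' → n) : tw μ (S.submatrix f g) (S'.submatrix g f) = (tw μ S S').submatrix f g := by
  match μ with
  | none => rfl
  | some σ => rfl

omit [Ring F] in
theorem tw_toBlocks₁₁ {m₁ m₂ n₁ n₂ : Type*} (S : Matrix (m₁ ⊕ m₂) (n₁ ⊕ n₂) F)
    (S' : Matrix (n₁ ⊕ n₂) (m₁ ⊕ m₂) F) :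
    tw μ S.toBlocks₁₁ S'.toBlocks₁₁ = (tw μ S S').toBlocks₁₁ :=
  tw_submatrix S S' Sum.inl Sum.inl

include hμ in
theorem tw_inv [Fintype n] [DecidableEq m] {S : Matrix m n F} {S' : Matrix n m F}
    (h : S * S' = 1) : tw μ S S' * tw μ S' S = 1 := by
  rw [← tw_mul hμ, h, tw_one hμ]

include hμ in
theorem tw_fromBlocks_diag {m₁ m₂ n₁ n₂ : Type*} (A : Matrix m₁ n₁ F) (A' : Matrix n₁ m₁ F)
    (B : Matrix m₂ n₂ F) (B' : Matrix n₂ m₂ F) :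
    tw μ (fromBlocks A 0 0 B) (fromBlocks A' 0 0 B') =
      fromBlocks (tw μ A A') 0 0 (tw μ B B') := by
  match μ with
  | none => rfl
  | some σ =>
    have := (hμ σ rfl).map_zero
    ext (i | i) (j | j) <;> simp [tw, this]

end Twist

section BT

variable {F : Type*} [DivisionRing F] {m n l : Type*} {L : Type*}

/-- A rectangular matrix whose rows and columns carry labels is block triangular with respect to
the strict order `r` on labels. -/
def BT (r : L → L → Prop) (lb : m → L) (lb' : n → L) (S : Matrix m n F) : Prop :=
  ∀ x y, r (lb' y) (lb x) → S x y = 0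

variable {r : L → L → Prop} {lb : m → L} {lb' : n → L} {lb'' : l → L}

theorem BT.one [DecidableEq m] (hr : ∀ a, ¬ r a a) : BT r lb lb (1 : Matrix m m F) := by
  intro x y h
  rw [Matrix.one_apply_ne]
  rintro rfl
  exact hr _ h

theorem BT.mul [Fintype n] [IsStrictTotalOrder L r] {S : Matrix m n F} {T : Matrix n l F}
    (hS : BT r lb lb' S) (hT : BT r lb' lb'' T) : BT r lb lb'' (S * T) := by
  intro x y h
  rw [Matrix.mul_apply]
  refine Finset.sum_eq_zero fun z _ => ?_
  rcases trichotomous_of r (lb' z) (lb x) with h1 | h1 | h1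
  · rw [hS _ _ h1, zero_mul]
  · rw [hT _ _ (h1 ▸ h), mul_zero]
  · rw [hT _ _ (trans_of r h h1), mul_zero]

/-- The diagonal block with label `a`. -/
def dblk (lb : m → L) (lb' : n → L) (a : L) (S : Matrix m n F) :
    Matrix {x // lb x = a} {y // lb' y = a} F :=
  S.submatrix Subtype.val Subtype.val

/-- Diagonal blocks of block triangular matrices multiply, entry by entry. -/
theorem BT.mul_apply_diag [Fintype n] [IsStrictTotalOrder L r] [DecidableEq L] {S : Matrix m n F}
    {T : Matrix n l F} (hS : BT r lb lb' S) (hT : BT r lb' lb'' T) {x : m} {y : l}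
    (h : lb x = lb'' y) :
    (S * T) x y = ∑ z : {z // lb' z = lb x}, S x z.1 * T z.1 y := by
  rw [Matrix.mul_apply, ← Finset.sum_subtype_eq_sum_filter
    (s := Finset.univ) (p := fun z => lb' z = lb x) (f := fun z => S x z * T z y) |>.trans
      (Finset.sum_filter_of_ne ?_)]
  · simp [Finset.subtype_univ]
  · intro z _ hz
    rcases trichotomous_of r (lb' z) (lb x) with h1 | h1 | h1
    · exact absurd (by rw [hS _ _ h1, zero_mul]) hz
    · exact h1
    · exact absurd (by rw [hT _ _ (h ▸ h1), mul_zero]) hz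

theorem BT.dblk_mul [Fintype n] [IsStrictTotalOrder L r] [DecidableEq L] {S : Matrix m n F}
    {T : Matrix n l F} (hS : BT r lb lb' S) (hT : BT r lb' lb'' T) (a : L) :
    dblk lb lb'' a (S * T) = dblk lb lb' a S * dblk lb' lb'' a T := by
  ext ⟨x, rfl⟩ ⟨y, hy⟩
  simp only [dblk, submatrix_apply, Matrix.mul_apply (M := S.submatrix _ _)]
  rw [hS.mul_apply_diag hT hy.symm]

theorem dblk_one [DecidableEq m] (a : L) : dblk lb lb a (1 : Matrix m m F) = 1 := by
  ext ⟨x, hx⟩ ⟨y, hy⟩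
  simp [dblk, Matrix.one_apply]

theorem card_eq_of_mul_eq_one [Fintype m] [Fintype n] [DecidableEq m] [DecidableEq n]
    {S : Matrix m n F} {S' : Matrix n m F} (h : S * S' = 1) (h' : S' * S = 1) :
    Fintype.card m = Fintype.card n := by
  have e : (n → F) ≃ₗ[F] (m → F) := Matrix.toLinearEquivRight'OfInv h h'
  have := e.finrank_eq
  simpa using this.symm

/-- A block triangular matrix does not lower the label of a vector, provided that its diagonal
blocks are injective on row vectors. -/
theorem BT.eq_zero_of_vecMul [Fintype m] [DecidableEq m] [Fintype n] [IsStrictTotalOrder L r]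
    [DecidableEq L]
    {S : Matrix m n F} (hS : BT r lb lb' S)
    (hd : ∀ a, ∃ D : Matrix {y // lb' y = a} {x // lb x = a} F,
      dblk lb lb' a S * D = (1 : Matrix {x // lb x = a} {x // lb x = a} F))
    (P : L → Prop) (hP : ∀ a b, r a b → P b → P a) (x : m → F)
    (hx : ∀ y, P (lb' y) → (x ᵥ* S) y = 0) (p : m) (hp : P (lb p)) : x p = 0 := by
  have wf : WellFounded (fun p q : m => r (lb p) (lb q)) := by
    have : IsTrans m (fun p q : m => r (lb p) (lb q)) := ⟨fun _ _ _ h h' => trans_of r h h'⟩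
    have : Std.Irrefl (fun p q : m => r (lb p) (lb q)) := ⟨fun _ h => irrefl_of r _ h⟩
    exact Finite.wellFounded_of_trans_of_irrefl _
  induction p using wf.induction with
  | h p ih =>
  obtain ⟨D, hD⟩ := hd (lb p)
  let v : {x // lb x = lb p} → F := fun q => x q.1
  have hv : v ᵥ* dblk lb lb' (lb p) S = 0 := by
    ext ⟨y, hy⟩
    have h0 := hx y (hy ▸ hp)
    simp only [vecMul, dotProduct, Pi.zero_apply] at h0 ⊢
    rw [← Finset.sum_filter_of_ne (p := fun q => lb q = lb p)] at h0
    · rw [← h0, ← Finset.sum_subtype_eq_sum_filter]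
      simp [Finset.subtype_univ, dblk, v]
    · intro q _ hq
      rcases trichotomous_of r (lb q) (lb p) with h1 | h1 | h1
      · exact absurd (by rw [ih q h1 (hP _ _ h1 hp), zero_mul]) hq
      · exact h1
      · exact absurd (by rw [hS _ _ (by rw [hy]; exact h1), mul_zero]) hq
  have : v = 0 := by
    rw [← vecMul_one v, ← hD, ← vecMul_vecMul, hv, zero_vecMul]
  exact congrFun this ⟨p, rfl⟩

/-- A block triangular matrix with invertible diagonal blocks has a block triangular inverse. -/
theorem BT.exists_inv [Fintype m] [Fintype n] [DecidableEq m] [DecidableEq n]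
    [IsStrictTotalOrder L r] [DecidableEq L] {S : Matrix m n F} (hS : BT r lb lb' S)
    (hd : ∀ a, ∃ D : Matrix {y // lb' y = a} {x // lb x = a} F,
      dblk lb lb' a S * D = 1 ∧ D * dblk lb lb' a S = 1) :
    ∃ S' : Matrix n m F, S * S' = 1 ∧ S' * S = 1 ∧ BT r lb' lb S' := by
  have hd1 : ∀ a, ∃ D : Matrix {y // lb' y = a} {x // lb x = a} F,
      dblk lb lb' a S * D = (1 : Matrix {x // lb x = a} {x // lb x = a} F) :=
    fun a => (hd a).imp fun D h => h.1
  have hcard : Fintype.card m = Fintype.card n := by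
    have e : ∀ a, Nonempty ({x // lb x = a} ≃ {y // lb' y = a}) := fun a => by
      obtain ⟨D, h, h'⟩ := hd a
      exact ⟨Fintype.equivOfCardEq (card_eq_of_mul_eq_one h h')⟩
    exact Fintype.card_congr (((Equiv.sigmaFiberEquiv lb).symm.trans
      (Equiv.sigmaCongrRight fun a => (e a).some)).trans (Equiv.sigmaFiberEquiv lb'))
  let f : (m → F) →ₗ[F] (n → F) := S.vecMulLinear
  have hinj : Function.Injective f := by
    rw [← LinearMap.ker_eq_bot, LinearMap.ker_eq_bot']
    intro x hx
    ext p
    exact hS.eq_zero_of_vecMul hd1 (fun _ => True) (fun _ _ _ h => h) x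
      (fun y _ => congrFun hx y) p trivial
  obtain ⟨g, hg⟩ := f.exists_leftInverse_of_injective (LinearMap.ker_eq_bot.2 hinj)
  let S' : Matrix n m F := LinearMap.toMatrixRight' g
  have h1 : S * S' = 1 := by
    apply Matrix.toLinearMapRight'.injective
    have e1 : Matrix.toLinearMapRight' S' = g := by simp [S']
    have e2 : Matrix.toLinearMapRight' S = f := LinearMap.ext fun v => rfl
    rw [Matrix.toLinearMapRight'_mul, e1, e2, hg, Matrix.toLinearMapRight'_one]
  have h2 : S' * S = 1 := (Matrix.mul_eq_one_comm_of_card_eq _ _ _ hcard).1 h1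
  refine ⟨S', h1, h2, fun y p h => ?_⟩
  refine hS.eq_zero_of_vecMul hd1 (fun a => r a (lb' y)) (fun _ _ h h' => trans_of r h h') (S' y)
    (fun y' hy' => ?_) p h
  have : (S' * S) y y' = 0 := by
    rw [h2, Matrix.one_apply_ne]
    rintro rfl
    exact irrefl_of r _ hy'
  exact this

/-- The inverse of a block triangular square matrix is block triangular. -/
theorem BT.inv [Fintype m] [DecidableEq m] [IsStrictTotalOrder L r] {S S' : Matrix m m F}
    (hS : BT r lb lb S) (h : S * S' = 1) : BT r lb lb S' := by
  intro y p hp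
  -- vectors supported on labels that are not below that of `y` form an invariant subspace
  let W : Submodule F (m → F) :=
    { carrier := {x | ∀ p, r (lb p) (lb y) → x p = 0}
      add_mem' := fun {a b} ha hb p hp => by simp [ha p hp, hb p hp]
      zero_mem' := fun _ _ => rfl
      smul_mem' := fun c x hx p hp => by simp [hx p hp] }
  have hW : ∀ x ∈ W, S.vecMulLinear x ∈ W := by
    intro x hx q hq
    change ∑ z, x z * S z q = 0
    refine Finset.sum_eq_zero fun z _ => ?_
    rcases trichotomous_of r (lb q) (lb z) with h1 | h1 | h1
    · rw [hS _ _ h1, mul_zero]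
    · rw [hx z (h1 ▸ hq), zero_mul]
    · rw [hx z (trans_of r h1 hq), zero_mul]
  have hsurj := (LinearMap.injOn_iff_surjOn hW).1 (by
    intro a _ b _ hab
    have h2 : (a ᵥ* S) ᵥ* S' = (b ᵥ* S) ᵥ* S' := congrArg (· ᵥ* S') hab
    simpa [vecMul_vecMul, h] using h2)
  have hy : (1 : Matrix m m F) y ∈ W := by
    intro q hq
    rw [Matrix.one_apply_ne]
    rintro rfl
    exact irrefl_of r _ hq
  obtain ⟨x, hx, hxy⟩ := hsurj hy
  have h3 : (1 : Matrix m m F) y ᵥ* S' = x := by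
    rw [← hxy]
    change (x ᵥ* S) ᵥ* S' = x
    rw [vecMul_vecMul, h, vecMul_one]
  have h4 : (1 : Matrix m m F) y ᵥ* S' = S' y := by
    have : ((1 : Matrix m m F) * S') y = S' y := by rw [Matrix.one_mul]
    exact this
  rw [← h4, h3]
  exact hx p hp

end BT

/-! ### Isomorphisms of bangles -/

section Iso

variable {F : Type*} [DivisionRing F] {ι : Type*}

/-- The label of a column of a bangle: `none` for the columns of the boxed strip. -/
def lbl {C : Type*} (ρ : Type*) (lab : C → ι) : ρ ⊕ C → Option ι :=
  Sum.elim (fun _ => none) (fun c => some (lab c))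

@[simp] theorem lbl_inl {C ρ : Type*} (lab : C → ι) (a : ρ) : lbl ρ lab (.inl a) = none := rfl
@[simp] theorem lbl_inr {C ρ : Type*} (lab : C → ι) (c : C) :
    lbl ρ lab (.inr c) = some (lab c) := rfl

variable {ρ ρ' ρ'' C C' C'' : Type*} [Fintype ρ] [Fintype ρ'] [Fintype ρ''] [Fintype C]
  [Fintype C'] [Fintype C''] [DecidableEq ρ] [DecidableEq ρ'] [DecidableEq ρ'']
  [DecidableEq C] [DecidableEq C'] [DecidableEq C'']

/-- Similarity (mode `none`) or `*`congruence (mode `some σ`) of bangles with boxed strip indexed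
by `ρ`, other columns indexed by `C` and distributed among the strips by `lab`. The strips are
ordered by `r`, in which `none` is the boxed strip. The two bangles may have different index types,
so that this is isomorphism rather than equality up to a base change. -/
def BIso (μ : Option (F → F)) (r : Option ι → Option ι → Prop) (lab : C → ι) (lab' : C' → ι)
    (M : Matrix ρ (ρ ⊕ C) F) (M' : Matrix ρ' (ρ' ⊕ C') F) : Prop :=
  ∃ (S : Matrix (ρ ⊕ C) (ρ' ⊕ C') F) (S' : Matrix (ρ' ⊕ C') (ρ ⊕ C) F),
    S * S' = 1 ∧ S' * S = 1 ∧ BT r (lbl ρ lab) (lbl ρ' lab') S ∧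
      BT r (lbl ρ' lab') (lbl ρ lab) S' ∧ M * S = tw μ S.toBlocks₁₁ S'.toBlocks₁₁ * M'

/-- Similarity or `*`congruence of square matrices. -/
def MEq (μ : Option (F → F)) (K : Matrix ρ ρ F) (K' : Matrix ρ' ρ' F) : Prop :=
  ∃ (S : Matrix ρ ρ' F) (S' : Matrix ρ' ρ F), S * S' = 1 ∧ S' * S = 1 ∧ K * S = tw μ S S' * K'

variable {μ : Option (F → F)} (hμ : ModeOK μ) {r : Option ι → Option ι → Prop}
  [IsStrictTotalOrder (Option ι) r]
  {lab : C → ι} {lab' : C' → ι} {lab'' : C'' → ι}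
  {M : Matrix ρ (ρ ⊕ C) F} {M' : Matrix ρ' (ρ' ⊕ C') F} {M'' : Matrix ρ'' (ρ'' ⊕ C'') F}

omit [Fintype ρ] [Fintype ρ''] [Fintype C] [Fintype C''] [DecidableEq ρ] [DecidableEq ρ']
  [DecidableEq ρ''] [DecidableEq C] [DecidableEq C'] [DecidableEq C''] in
theorem BT.toBlocks₁₁_mul {S : Matrix (ρ ⊕ C) (ρ' ⊕ C') F} {T : Matrix (ρ' ⊕ C') (ρ'' ⊕ C'') F}
    (hS : BT r (lbl ρ lab) (lbl ρ' lab') S) (hT : BT r (lbl ρ' lab') (lbl ρ'' lab'') T) :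
    (S * T).toBlocks₁₁ = S.toBlocks₁₁ * T.toBlocks₁₁ := by
  ext i j
  simp only [toBlocks₁₁, of_apply, Matrix.mul_apply, Fintype.sum_sum_type, add_eq_left]
  refine Finset.sum_eq_zero fun c _ => ?_
  rcases trichotomous_of r (none : Option ι) (some (lab' c)) with h | h | h
  · rw [hT (.inr c) (.inl j) h, mul_zero]
  · cases h
  · rw [hS (.inl i) (.inr c) h, zero_mul]

theorem toBlocks₁₁_one {m n α : Type*} [DecidableEq m] [DecidableEq n] [Zero α] [One α] :
    (1 : Matrix (m ⊕ n) (m ⊕ n) α).toBlocks₁₁ = 1 := by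
  ext i j
  simp [toBlocks₁₁, Matrix.one_apply]

omit [Fintype ρ'] [Fintype C'] [DecidableEq ρ] [DecidableEq C] in
theorem BT.toBlocks₁₁_inv {S : Matrix (ρ ⊕ C) (ρ' ⊕ C') F} {S' : Matrix (ρ' ⊕ C') (ρ ⊕ C) F}
    (hS : BT r (lbl ρ lab) (lbl ρ' lab') S) (hS' : BT r (lbl ρ' lab') (lbl ρ lab) S')
    (h : S' * S = 1) : S'.toBlocks₁₁ * S.toBlocks₁₁ = 1 := by
  rw [← hS'.toBlocks₁₁_mul hS, h, toBlocks₁₁_one]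

include hμ in
theorem BIso.symm (h : BIso μ r lab lab' M M') : BIso μ r lab' lab M' M := by
  obtain ⟨S, S', h1, h2, hS, hS', e⟩ := h
  refine ⟨S', S, h2, h1, hS', hS, ?_⟩
  have h3 := tw_inv hμ (hS.toBlocks₁₁_inv hS' h2)
  calc M' * S' = (tw μ S'.toBlocks₁₁ S.toBlocks₁₁ * tw μ S.toBlocks₁₁ S'.toBlocks₁₁) * M' * S' := by
        rw [h3, Matrix.one_mul]
    _ = tw μ S'.toBlocks₁₁ S.toBlocks₁₁ * (M * S) * S' := by
        rw [e]; simp only [Matrix.mul_assoc]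
    _ = _ := by rw [Matrix.mul_assoc, Matrix.mul_assoc M, h1, Matrix.mul_one]

include hμ in
theorem BIso.trans (h : BIso μ r lab lab' M M') (h' : BIso μ r lab' lab'' M' M'') :
    BIso μ r lab lab'' M M'' := by
  obtain ⟨S, S', h1, h2, hS, hS', e⟩ := h
  obtain ⟨T, T', h3, h4, hT, hT', e'⟩ := h'
  refine ⟨S * T, T' * S', ?_, ?_, hS.mul hT, hT'.mul hS', ?_⟩
  · rw [Matrix.mul_assoc, ← Matrix.mul_assoc T, h3, Matrix.one_mul, h1]
  · rw [Matrix.mul_assoc, ← Matrix.mul_assoc S', h2, Matrix.one_mul, h4]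
  · rw [hS.toBlocks₁₁_mul hT, hT'.toBlocks₁₁_mul hS', tw_mul hμ, ← Matrix.mul_assoc, e,
      Matrix.mul_assoc, e', Matrix.mul_assoc]

include hμ in
theorem BIso.of_equiv (e : ρ ≃ ρ') (f : C ≃ C') (hl : ∀ c, lab' (f c) = lab c)
    (hM : ∀ a x, M' (e a) (Sum.map e f x) = M a x) : BIso μ r lab lab' M M' := by
  have hlb : ∀ x, lbl ρ' lab' (Equiv.sumCongr e f x) = lbl ρ lab x := by
    rintro (x | x) <;> simp [hl]
  refine ⟨(1 : Matrix (ρ' ⊕ C') (ρ' ⊕ C') F).submatrix (Equiv.sumCongr e f) id,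
    (1 : Matrix (ρ' ⊕ C') (ρ' ⊕ C') F).submatrix id (Equiv.sumCongr e f), ?_, ?_, ?_, ?_, ?_⟩
  · have := Matrix.submatrix_mul_equiv (1 : Matrix (ρ' ⊕ C') (ρ' ⊕ C') F) 1 (Equiv.sumCongr e f)
      (Equiv.refl _) (Equiv.sumCongr e f)
    rw [Matrix.mul_one, Matrix.submatrix_one_equiv] at this
    exact this
  · have := Matrix.submatrix_mul_equiv (1 : Matrix (ρ' ⊕ C') (ρ' ⊕ C') F)
      (1 : Matrix (ρ' ⊕ C') (ρ' ⊕ C') F) id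
      (Equiv.sumCongr e f) id
    exact this.trans (by rw [Matrix.mul_one, Matrix.submatrix_id_id])
  · intro x y h
    rw [← hlb] at h
    exact BT.one (irrefl_of r) (lb := lbl ρ' lab') _ _ h
  · intro x y h
    rw [← hlb] at h
    exact BT.one (irrefl_of r) (lb := lbl ρ' lab') _ _ h
  · have h1 : tw μ ((1 : Matrix (ρ' ⊕ C') (ρ' ⊕ C') F).submatrix (Equiv.sumCongr e f) id).toBlocks₁₁
        ((1 : Matrix (ρ' ⊕ C') (ρ' ⊕ C') F).submatrix id (Equiv.sumCongr e f)).toBlocks₁₁ =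
        (1 : Matrix ρ' ρ' F).submatrix e id := by
      rw [tw_toBlocks₁₁, tw_submatrix, tw_one hμ]
      ext i j
      simp [toBlocks₁₁, Matrix.one_apply]
    rw [h1]
    ext i y
    obtain ⟨x, rfl⟩ := (Equiv.sumCongr e f).surjective y
    have h2 : ∀ a : ρ ⊕ C, Sum.map e f a = Sum.map e f x ↔ a = x := fun a =>
      (Equiv.sumCongr e f).injective.eq_iff
    simp [Matrix.mul_apply, Matrix.one_apply, hM, h2]

include hμ in
theorem BIso.refl : BIso μ r lab lab M M :=
  BIso.of_equiv hμ (Equiv.refl _) (Equiv.refl _) (fun _ => rfl) (by rintro a (x | x) <;> rfl)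

theorem lbl_fiber_bijective {ρ C : Type*} (lab : C → ι) (i : ι) :
    Function.Bijective (fun c : {c // lab c = i} =>
      (⟨.inr c.1, congrArg some c.2⟩ : {x // lbl ρ lab x = some i})) := by
  refine ⟨fun a b hab => ?_, ?_⟩
  · simpa [Subtype.ext_iff] using hab
  · rintro ⟨x | x, hx⟩
    · cases hx
    · exact ⟨⟨x, Option.some.inj hx⟩, rfl⟩

/-- Isomorphic bangles have strips of the same sizes. -/
theorem BIso.card_fiber [DecidableEq ι] (h : BIso μ r lab lab' M M') (i : ι) :
    Fintype.card {c // lab c = i} = Fintype.card {c // lab' c = i} := by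
  obtain ⟨S, S', h1, h2, hS, hS', -⟩ := h
  have e1 : dblk (lbl ρ lab) (lbl ρ' lab') (some i) S * dblk (lbl ρ' lab') (lbl ρ lab) (some i) S'
      = 1 := by rw [← hS.dblk_mul hS', h1, dblk_one]
  have e2 : dblk (lbl ρ' lab') (lbl ρ lab) (some i) S' * dblk (lbl ρ lab) (lbl ρ' lab') (some i) S
      = 1 := by rw [← hS'.dblk_mul hS, h2, dblk_one]
  rw [Fintype.card_of_bijective (lbl_fiber_bijective (ρ := ρ) lab i),
    Fintype.card_of_bijective (lbl_fiber_bijective (ρ := ρ') lab' i)]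
  exact card_eq_of_mul_eq_one e1 e2

theorem map_univ_eq_iff {α β κ : Type*} [Fintype α] [Fintype β] [DecidableEq κ] (f : α → κ)
    (g : β → κ) : (Finset.univ.val.map f = Finset.univ.val.map g) ↔
      ∀ i, Fintype.card {a // f a = i} = Fintype.card {b // g b = i} := by
  rw [Multiset.ext]
  refine forall_congr' fun i => ?_
  simp only [Multiset.count_map, Fintype.card_subtype, Finset.card_def, Finset.filter_val, eq_comm]

theorem BIso.map_lab (h : BIso μ r lab lab' M M') :
    Finset.univ.val.map lab = Finset.univ.val.map lab' := by
  classical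
  exact (map_univ_eq_iff _ _).2 h.card_fiber

/-- Two families with the same multiset of values differ by a bijection of the index types. -/
theorem exists_equiv_of_map_univ_eq {α β κ : Type*} [Fintype α] [Fintype β] {f : α → κ}
    {g : β → κ} (h : Finset.univ.val.map f = Finset.univ.val.map g) :
    ∃ e : α ≃ β, ∀ a, g (e a) = f a := by
  classical
  have e : ∀ i, Nonempty ({a // f a = i} ≃ {b // g b = i}) := fun i =>
    ⟨Fintype.equivOfCardEq ((map_univ_eq_iff f g).1 h i)⟩
  refine ⟨((Equiv.sigmaFiberEquiv f).symm.trans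
      (Equiv.sigmaCongrRight fun a => (e a).some)).trans (Equiv.sigmaFiberEquiv g), fun a => ?_⟩
  exact ((e (f a)).some ⟨a, rfl⟩).2

/-- Linear independence of the rows of a matrix. -/
def RowInj {m n : Type*} [Fintype m] (M : Matrix m n F) : Prop := ∀ v : m → F, v ᵥ* M = 0 → v = 0

theorem RowInj.exists_inv {m n : Type*} [Fintype m] [Fintype n] [DecidableEq m] [DecidableEq n]
    {M : Matrix m n F} (h : RowInj M) : ∃ M' : Matrix n m F, M * M' = 1 := by
  have hinj : Function.Injective M.vecMulLinear := by
    rw [← LinearMap.ker_eq_bot, LinearMap.ker_eq_bot']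
    exact h
  obtain ⟨g, hg⟩ := M.vecMulLinear.exists_leftInverse_of_injective (LinearMap.ker_eq_bot.2 hinj)
  refine ⟨LinearMap.toMatrixRight' g, ?_⟩
  apply Matrix.toLinearMapRight'.injective
  have e1 : Matrix.toLinearMapRight' (LinearMap.toMatrixRight' g) = g := by simp
  have e2 : Matrix.toLinearMapRight' M = M.vecMulLinear := LinearMap.ext fun v => rfl
  rw [Matrix.toLinearMapRight'_mul, e1, e2, hg, Matrix.toLinearMapRight'_one]

omit [Fintype ρ] in
theorem RowInj.of_mul_eq_one {m n : Type*} [Fintype m] [Fintype n] [DecidableEq m]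
    {M : Matrix m n F} {M' : Matrix n m F} (h : M * M' = 1) : RowInj M := fun v hv => by
  rw [← vecMul_one v, ← h, ← vecMul_vecMul, hv, zero_vecMul]

include hμ in
theorem BIso.rowInj (h : BIso μ r lab lab' M M') (hM : RowInj M) : RowInj M' := by
  obtain ⟨S, S', h1, h2, hS, hS', e⟩ := h
  have h3 := tw_inv hμ (hS.toBlocks₁₁_inv hS' h2)
  intro v hv
  have h4 : (v ᵥ* tw μ S'.toBlocks₁₁ S.toBlocks₁₁) ᵥ* M = 0 := by
    have : (v ᵥ* tw μ S'.toBlocks₁₁ S.toBlocks₁₁) ᵥ* (M * S) = 0 := by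
      rw [e, vecMul_vecMul, ← Matrix.mul_assoc, h3, Matrix.one_mul, hv]
    rw [← vecMul_vecMul] at this
    rw [← vecMul_one (_ ᵥ* M), ← h1, ← vecMul_vecMul, this, zero_vecMul]
  have h5 := hM _ h4
  have h6 := tw_inv hμ (hS'.toBlocks₁₁_inv hS h1)
  have h7 := tw_inv hμ (hS.toBlocks₁₁_inv hS' h2)
  rw [← vecMul_one v, ← h7, ← vecMul_vecMul, h5, zero_vecMul]

/-- A bangle all of whose columns are in the boxed strip. -/
def boxM {ρ : Type*} (C : Type*) (K : Matrix ρ ρ F) : Matrix ρ (ρ ⊕ C) F := fromCols K 0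

theorem BIso.box_iff [IsEmpty C] [IsEmpty C'] {K : Matrix ρ ρ F} {K' : Matrix ρ' ρ' F} :
    BIso μ r lab lab' (boxM C K) (boxM C' K') ↔ MEq μ K K' := by
  constructor
  · rintro ⟨S, S', h1, h2, hS, hS', e⟩
    refine ⟨S.toBlocks₁₁, S'.toBlocks₁₁, hS'.toBlocks₁₁_inv hS h1, hS.toBlocks₁₁_inv hS' h2, ?_⟩
    ext i j
    have := congrFun (congrFun e i) (.inl j)
    simp only [Matrix.mul_apply, boxM, Fintype.sum_sum_type, fromCols_apply_inl,
      Finset.univ_eq_empty, Finset.sum_empty, add_zero] at this ⊢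
    exact this
  · rintro ⟨S, S', h1, h2, e⟩
    refine ⟨fromBlocks S 0 0 0, fromBlocks S' 0 0 0, ?_, ?_, ?_, ?_, ?_⟩
    · rw [fromBlocks_multiply]
      simp only [Matrix.mul_zero, Matrix.zero_mul, add_zero, h1]
      ext (i | i) (j | j)
      · simp [Matrix.one_apply]
      all_goals first | exact isEmptyElim i | exact isEmptyElim j
    · rw [fromBlocks_multiply]
      simp only [Matrix.mul_zero, Matrix.zero_mul, add_zero, h2]
      ext (i | i) (j | j)
      · simp [Matrix.one_apply]
      all_goals first | exact isEmptyElim i | exact isEmptyElim j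
    · rintro (x | x) (y | y) h
      · exact absurd h (irrefl_of r _)
      all_goals first | exact isEmptyElim x | exact isEmptyElim y
    · rintro (x | x) (y | y) h
      · exact absurd h (irrefl_of r _)
      all_goals first | exact isEmptyElim x | exact isEmptyElim y
    · ext i (j | j)
      · have := congrFun (congrFun e i) j
        rw [toBlocks_fromBlocks₁₁, toBlocks_fromBlocks₁₁]
        simpa [Matrix.mul_apply, boxM] using this
      · exact isEmptyElim j

end Iso

/-! ### Direct sums and reduction -/

section Sum

variable {F : Type*} [DivisionRing F] {ι : Type*}
variable {ρ₁ ρ₂ ρ₁' ρ₂' C₁ C₂ C₁' C₂' : Type*}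

/-- The block-direct sum of two bangles. -/
def bsum (M₁ : Matrix ρ₁ (ρ₁ ⊕ C₁) F) (M₂ : Matrix ρ₂ (ρ₂ ⊕ C₂) F) :
    Matrix (ρ₁ ⊕ ρ₂) ((ρ₁ ⊕ ρ₂) ⊕ (C₁ ⊕ C₂)) F :=
  (fromBlocks M₁ 0 0 M₂).submatrix id (Equiv.sumSumSumComm ρ₁ ρ₂ C₁ C₂)

variable [Fintype ρ₁] [Fintype ρ₂] [Fintype ρ₁'] [Fintype ρ₂'] [Fintype C₁] [Fintype C₂]
  [Fintype C₁'] [Fintype C₂'] [DecidableEq ρ₁] [DecidableEq ρ₂] [DecidableEq ρ₁'] [DecidableEq ρ₂']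
  [DecidableEq C₁] [DecidableEq C₂] [DecidableEq C₁'] [DecidableEq C₂']
  {μ : Option (F → F)} (hμ : ModeOK μ) {r : Option ι → Option ι → Prop}
  {lab₁ : C₁ → ι} {lab₂ : C₂ → ι} {lab₁' : C₁' → ι} {lab₂' : C₂' → ι}
  {M₁ : Matrix ρ₁ (ρ₁ ⊕ C₁) F} {M₂ : Matrix ρ₂ (ρ₂ ⊕ C₂) F}
  {M₁' : Matrix ρ₁' (ρ₁' ⊕ C₁') F} {M₂' : Matrix ρ₂' (ρ₂' ⊕ C₂') F}

omit [Fintype ρ₁] [Fintype ρ₂] [Fintype ρ₁'] [Fintype ρ₂'] [Fintype C₁] [Fintype C₂]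
  [Fintype C₁'] [Fintype C₂'] [DecidableEq ρ₁] [DecidableEq ρ₂] [DecidableEq ρ₁'] [DecidableEq ρ₂']
  [DecidableEq C₁] [DecidableEq C₂] [DecidableEq C₁'] [DecidableEq C₂'] in
theorem BT.sum {S : Matrix (ρ₁ ⊕ C₁) (ρ₁' ⊕ C₁') F} {T : Matrix (ρ₂ ⊕ C₂) (ρ₂' ⊕ C₂') F}
    (hS : BT r (lbl ρ₁ lab₁) (lbl ρ₁' lab₁') S) (hT : BT r (lbl ρ₂ lab₂) (lbl ρ₂' lab₂') T) :
    BT r (lbl (ρ₁ ⊕ ρ₂) (Sum.elim lab₁ lab₂)) (lbl (ρ₁' ⊕ ρ₂') (Sum.elim lab₁' lab₂'))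
      ((fromBlocks S 0 0 T).submatrix (Equiv.sumSumSumComm ρ₁ ρ₂ C₁ C₂)
        (Equiv.sumSumSumComm ρ₁' ρ₂' C₁' C₂')) := by
  rintro ((x | x) | (x | x)) ((y | y) | (y | y)) h <;> first | rfl | exact hS _ _ h | exact hT _ _ h

include hμ in
/-- Isomorphisms add up under block-direct sums. -/
theorem BIso.sum (h₁ : BIso μ r lab₁ lab₁' M₁ M₁') (h₂ : BIso μ r lab₂ lab₂' M₂ M₂') :
    BIso μ r (Sum.elim lab₁ lab₂) (Sum.elim lab₁' lab₂') (bsum M₁ M₂) (bsum M₁' M₂') := by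
  obtain ⟨S, S', h1, h2, hS, hS', e⟩ := h₁
  obtain ⟨T, T', h3, h4, hT, hT', e'⟩ := h₂
  refine ⟨(fromBlocks S 0 0 T).submatrix (Equiv.sumSumSumComm ρ₁ ρ₂ C₁ C₂)
      (Equiv.sumSumSumComm ρ₁' ρ₂' C₁' C₂'),
    (fromBlocks S' 0 0 T').submatrix (Equiv.sumSumSumComm ρ₁' ρ₂' C₁' C₂')
      (Equiv.sumSumSumComm ρ₁ ρ₂ C₁ C₂), ?_, ?_, hS.sum hT, hS'.sum hT', ?_⟩
  · rw [submatrix_mul_equiv, fromBlocks_multiply]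
    simp [h1, h3]
  · rw [submatrix_mul_equiv, fromBlocks_multiply]
    simp [h2, h4]
  · have e1 : tw μ (((fromBlocks S 0 0 T).submatrix (Equiv.sumSumSumComm ρ₁ ρ₂ C₁ C₂)
        (Equiv.sumSumSumComm ρ₁' ρ₂' C₁' C₂')).toBlocks₁₁)
        (((fromBlocks S' 0 0 T').submatrix (Equiv.sumSumSumComm ρ₁' ρ₂' C₁' C₂')
        (Equiv.sumSumSumComm ρ₁ ρ₂ C₁ C₂)).toBlocks₁₁) =
        fromBlocks (tw μ S.toBlocks₁₁ S'.toBlocks₁₁) 0 0 (tw μ T.toBlocks₁₁ T'.toBlocks₁₁) := by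
      rw [← tw_fromBlocks_diag hμ]
      congr 1
      · ext (i | i) (j | j) <;> rfl
      · ext (i | i) (j | j) <;> rfl
    rw [e1, bsum, bsum, submatrix_mul_equiv, fromBlocks_multiply]
    have := Matrix.submatrix_mul_equiv (fromBlocks (tw μ S.toBlocks₁₁ S'.toBlocks₁₁) 0 0
      (tw μ T.toBlocks₁₁ T'.toBlocks₁₁)) (fromBlocks M₁' 0 0 M₂') id (Equiv.refl _)
      (Equiv.sumSumSumComm ρ₁' ρ₂' C₁' C₂')
    refine Eq.trans ?_ this.symm
    rw [fromBlocks_multiply]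
    simp [e, e']

end Sum

section Order

variable {ι : Type*} {F : Type*}

/-- The order on the strips of the reduced bangle, before a possible reversal: its boxed strip is
`none`, the old other strips are `some (some i)`, and a new last strip is `some none`. -/
def upR (r : Option ι → Option ι → Prop) : Option (Option ι) → Option (Option ι) → Prop
  | some none, _ => False
  | none, some none => True
  | some (some _), some none => True
  | none, none => r none none
  | none, some (some j) => r none (some j)
  | some (some i), none => r (some i) none
  | some (some i), some (some j) => r (some i) (some j)

/-- The order on the strips of the reduced bangle; in the case of `*`congruence, passing to the
adjoint reverses it. -/
def nextR (μ : Option (F → F)) (r : Option ι → Option ι → Prop) :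
    Option (Option ι) → Option (Option ι) → Prop :=
  match μ with
  | none => upR r
  | some _ => fun a b => upR r b a

instance upR_isSTO (r : Option ι → Option ι → Prop) [IsStrictTotalOrder (Option ι) r] :
    IsStrictTotalOrder (Option (Option ι)) (upR r) where
  trichotomous a b := by
    rcases a with _ | _ | a <;> rcases b with _ | _ | b <;> simp only [upR] <;>
      first
      | (simp; done)
      | (intro h h'; have := Std.Trichotomous.trichotomous (r := r) _ _ h h'; simp_all)
  irrefl a := by
    rcases a with _ | _ | a <;> simp only [upR, not_false_eq_true] <;> exact irrefl_of r _
  trans a b c := by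
    rcases a with _ | _ | a <;> rcases b with _ | _ | b <;> rcases c with _ | _ | c <;>
      simp only [upR, implies_true, false_imp_iff, imp_false] <;>
      exact trans_of r

instance nextR_isSTO (μ : Option (F → F)) (r : Option ι → Option ι → Prop)
    [IsStrictTotalOrder (Option ι) r] : IsStrictTotalOrder (Option (Option ι)) (nextR μ r) := by
  match μ with
  | none => exact upR_isSTO r
  | some _ =>
    exact
    { trichotomous := fun a b h h' =>
        (Std.Trichotomous.trichotomous (r := upR r) _ _ h h').symm
      irrefl := fun a => irrefl_of (upR r) a
      trans := fun a b c h h' => trans_of (upR r) h' h }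

end Order

/-- A base change that is block triangular for `upR r` transforms the rows by a matrix that is block
triangular for `nextR μ r`: the adjoint of the inverse reverses the order. -/
theorem BT.tw_nextR {F : Type*} [DivisionRing F] {ι m n : Type*} {μ : Option (F → F)}
    (hμ : ModeOK μ) {r : Option ι → Option ι → Prop}
    {lb : m → Option (Option ι)} {lb' : n → Option (Option ι)} {S : Matrix m n F}
    {S' : Matrix n m F} (hS : BT (upR r) lb lb' S) (hS' : BT (upR r) lb' lb S') :
    BT (nextR μ r) lb lb' (tw μ S S') := by
  match μ with
  | none => exact hS
  | some σ =>
    intro x y h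
    have : S' y x = 0 := hS' _ _ h
    simp [tw, this, (hμ σ rfl).map_zero]

theorem BT.tw_upR {F : Type*} [DivisionRing F] {ι m n : Type*} {μ : Option (F → F)}
    (hμ : ModeOK μ) {r : Option ι → Option ι → Prop}
    {lb : m → Option (Option ι)} {lb' : n → Option (Option ι)} {S : Matrix m n F}
    {S' : Matrix n m F} (hS : BT (nextR μ r) lb lb' S) (hS' : BT (nextR μ r) lb' lb S') :
    BT (upR r) lb lb' (tw μ S S') := by
  match μ with
  | none => exact hS
  | some σ =>
    intro x y h
    have : S' y x = 0 := hS' _ _ h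
    simp [tw, this, (hμ σ rfl).map_zero]

section Red

variable {F : Type*} [DivisionRing F] {ι : Type*}
variable {κ G G₀ Z κ' G' G₀' Z' : Type*}

/-- The bangle obtained from a bangle `X` one of whose strips (indexed by `G₀`) is distinguished:
its rows are indexed by all columns of `X`; its boxed strip has the rows of `X` followed by zero
rows; its other strips are identity columns for `G` and zero columns for `Z`. Every bangle is
isomorphic to such a bangle with an `X` whose rows are linearly independent. -/
def Red (Z : Type*) [DecidableEq G] (X : Matrix κ (κ ⊕ (G ⊕ G₀)) F) :
    Matrix (κ ⊕ (G ⊕ G₀)) ((κ ⊕ (G ⊕ G₀)) ⊕ (G ⊕ Z)) F :=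
  fromBlocks X 0 0 (fromBlocks 1 0 0 0)

/-- The labels of the columns of the reduced bangle `X`. -/
def nxtLab (labG : G → ι) : G ⊕ G₀ → Option ι := Sum.elim (fun g => some (labG g)) (fun _ => none)

theorem map_univ_sum {α β γ : Type*} [Fintype α] [Fintype β] (f : α ⊕ β → γ) :
    Finset.univ.val.map f =
      Finset.univ.val.map (f ∘ Sum.inl) + Finset.univ.val.map (f ∘ Sum.inr) := by
  have h : (Finset.univ : Finset (α ⊕ β)).val =
    Finset.univ.val.map Sum.inl + Finset.univ.val.map Sum.inr := rfl
  rw [h, Multiset.map_add, Multiset.map_map, Multiset.map_map]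

theorem filterMap_nxtLab [Fintype G] [Fintype G₀] (labG : G → ι) :
    (Finset.univ.val.map (nxtLab (G₀ := G₀) labG)).filterMap id = Finset.univ.val.map labG := by
  rw [map_univ_sum, Multiset.filterMap_add]
  have h1 : (Finset.univ.val.map (nxtLab (G₀ := G₀) labG ∘ Sum.inl)) =
      (Finset.univ.val.map labG).map some := by
    rw [Multiset.map_map]; rfl
  have h2 : ∀ s : Multiset G₀, (s.map (nxtLab labG ∘ Sum.inr)).filterMap id = 0 := fun s => by
    induction s using Multiset.induction_on with
    | empty => rfl
    | cons a s ih => rw [Multiset.map_cons, Multiset.filterMap_cons_none _ _ rfl, ih]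
  rw [h1, h2, Multiset.filterMap_map, add_zero]
  exact Multiset.filterMap_some _

variable [Fintype κ] [Fintype G] [Fintype G₀] [Fintype Z]
  [Fintype κ'] [Fintype G'] [Fintype G₀'] [Fintype Z']
  [DecidableEq κ] [DecidableEq G] [DecidableEq G₀] [DecidableEq Z]
  [DecidableEq κ'] [DecidableEq G'] [DecidableEq G₀'] [DecidableEq Z']
  {μ : Option (F → F)} (hμ : ModeOK μ) {r : Option ι → Option ι → Prop}
  [IsStrictTotalOrder (Option ι) r]
  {labG : G → ι} {labG' : G' → ι} {labZ : Z → ι} {labZ' : Z' → ι}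
  {X : Matrix κ (κ ⊕ (G ⊕ G₀)) F} {Y : Matrix κ' (κ' ⊕ (G' ⊕ G₀')) F}

/-- The row transformation in an isomorphism of reduced bangles is block triangular. -/
theorem BT.of_red
    {S : Matrix ((κ ⊕ (G ⊕ G₀)) ⊕ (G ⊕ Z)) ((κ' ⊕ (G' ⊕ G₀')) ⊕ (G' ⊕ Z')) F}
    {R : Matrix (κ ⊕ (G ⊕ G₀)) (κ' ⊕ (G' ⊕ G₀')) F}
    (hS : BT r (lbl (κ ⊕ (G ⊕ G₀)) (Sum.elim labG labZ))
      (lbl (κ' ⊕ (G' ⊕ G₀')) (Sum.elim labG' labZ')) S) (hr : ¬ r none none)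
    (e : Red Z X * S = R * Red Z' Y) {YY : Matrix (κ' ⊕ (G' ⊕ G₀')) κ' F}
    (hY : Y * YY = 1) :
    BT (upR r) (lbl κ (nxtLab labG)) (lbl κ' (nxtLab labG')) R := by
  classical
  have e12 : ∀ (i : κ) (j : G'), R (.inl i) (.inr (.inl j)) =
      ∑ d, X i d * S (.inl d) (.inr (.inl j)) := fun i j => by
    have := congrFun (congrFun e (.inl i)) (.inr (.inl j))
    simpa [Matrix.mul_apply, Red, Matrix.one_apply] using this.symm
  have e22 : ∀ (i : G) (j : G'), R (.inr (.inl i)) (.inr (.inl j)) =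
      S (.inr (.inl i)) (.inr (.inl j)) := fun i j => by
    have := congrFun (congrFun e (.inr (.inl i))) (.inr (.inl j))
    simpa [Matrix.mul_apply, Red, Matrix.one_apply] using this.symm
  have e22' : ∀ (i : G₀) (j : G'), R (.inr (.inr i)) (.inr (.inl j)) = 0 := fun i j => by
    have := congrFun (congrFun e (.inr (.inr i))) (.inr (.inl j))
    simpa [Matrix.mul_apply, Red, Matrix.one_apply] using this.symm
  have e21 : ∀ (i : G) (d : κ' ⊕ (G' ⊕ G₀')), ∑ b, R (.inr (.inl i)) (.inl b) * Y b d =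
      S (.inr (.inl i)) (.inl d) := fun i j => by
    have := congrFun (congrFun e (.inr (.inl i))) (.inl j)
    simpa [Matrix.mul_apply, Red, Matrix.one_apply] using this.symm
  have e21' : ∀ (i : G₀) (d : κ' ⊕ (G' ⊕ G₀')), ∑ b, R (.inr (.inr i)) (.inl b) * Y b d = 0 :=
    fun i j => by
      have := congrFun (congrFun e (.inr (.inr i))) (.inl j)
      simpa [Matrix.mul_apply, Red, Matrix.one_apply] using this.symm
  have hinv : ∀ (v : κ' → F) (b : κ'), v b = ∑ d, (∑ b, v b * Y b d) * YY d b := fun v b => by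
    have : v = (v ᵥ* Y) ᵥ* YY := by rw [vecMul_vecMul, hY, vecMul_one]
    exact congrFun this b
  rintro (x | x | x) (y | y | y) h
  · exact absurd h hr
  · rw [e12]
    exact Finset.sum_eq_zero fun d _ => by rw [hS (.inl d) (.inr (.inl y)) h, mul_zero]
  · exact absurd h id
  · rw [hinv (fun b => R (.inr (.inl x)) (.inl b)) y]
    exact Finset.sum_eq_zero fun d _ => by rw [e21, hS (.inr (.inl x)) (.inl d) h, zero_mul]
  · rw [e22]
    exact hS (.inr (.inl x)) (.inr (.inl y)) h
  · exact absurd h id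
  · rw [hinv (fun b => R (.inr (.inr x)) (.inl b)) y]
    exact Finset.sum_eq_zero fun d _ => by rw [e21', zero_mul]
  · exact e22' x y
  · exact absurd h id

include hμ in
/-- Isomorphic bangles have isomorphic reductions. -/
theorem BIso.of_red (hX : RowInj X) (hY : RowInj Y)
    (h : BIso μ r (Sum.elim labG labZ) (Sum.elim labG' labZ') (Red Z X) (Red Z' Y)) :
    BIso μ (nextR μ r) (nxtLab labG) (nxtLab labG') X Y ∧
      Finset.univ.val.map labZ = Finset.univ.val.map labZ' := by
  classical
  obtain ⟨XX, hXX⟩ := hX.exists_inv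
  obtain ⟨YY, hYY⟩ := hY.exists_inv
  have h' : BIso μ (nextR μ r) (nxtLab labG) (nxtLab labG') X Y := by
    have hsymm := h.symm hμ
    obtain ⟨S, S', h1, h2, hS, hS', e⟩ := h
    have hr := irrefl_of r none
    have e' : Red Z' Y * S' = tw μ S'.toBlocks₁₁ S.toBlocks₁₁ * Red Z X := by
      have h3 := tw_inv hμ (hS.toBlocks₁₁_inv hS' h2)
      calc Red Z' Y * S' = (tw μ S'.toBlocks₁₁ S.toBlocks₁₁ * tw μ S.toBlocks₁₁ S'.toBlocks₁₁) *
              Red Z' Y * S' := by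
            rw [h3, Matrix.one_mul]
        _ = tw μ S'.toBlocks₁₁ S.toBlocks₁₁ * (Red Z X * S) * S' := by
            rw [e]; simp only [Matrix.mul_assoc]
        _ = _ := by rw [Matrix.mul_assoc, Matrix.mul_assoc (Red Z X), h1, Matrix.mul_one]
    have hR := BT.of_red hS hr e hYY
    have hR' := BT.of_red hS' hr e' hXX
    refine ⟨S.toBlocks₁₁, S'.toBlocks₁₁, hS'.toBlocks₁₁_inv hS h1, hS.toBlocks₁₁_inv hS' h2,
      ?_, ?_, ?_⟩
    · have := BT.tw_nextR hμ hR hR'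
      rwa [tw_tw hμ] at this
    · have := BT.tw_nextR hμ hR' hR
      rwa [tw_tw hμ] at this
    · rw [tw_toBlocks₁₁]
      ext i j
      have := congrFun (congrFun e (.inl i)) (.inl j)
      simp only [Matrix.mul_apply, Red, Fintype.sum_sum_type, fromBlocks_apply₁₁,
        fromBlocks_apply₁₂, fromBlocks_apply₂₁, Matrix.zero_apply, zero_mul, mul_zero,
        Finset.sum_const_zero, add_zero] at this ⊢
      exact this
  refine ⟨h', ?_⟩
  have h1 := h.map_lab
  have h2 := h'.map_lab
  have h3 : (Finset.univ.val.map (nxtLab (G₀ := G₀) labG)).filterMap id =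
      (Finset.univ.val.map (nxtLab (G₀ := G₀') labG')).filterMap id := by rw [h2]
  rw [filterMap_nxtLab, filterMap_nxtLab] at h3
  rw [map_univ_sum, map_univ_sum] at h1
  simp only [Function.comp_def, Sum.elim_inl, Sum.elim_inr] at h1
  rw [h3] at h1
  exact add_left_cancel h1

/-- The blocks of invertible block triangular matrices on the strips `G` are mutually inverse. -/
theorem BT.sum_red_diag {R : Matrix (κ ⊕ (G ⊕ G₀)) (κ' ⊕ (G' ⊕ G₀')) F}
    {R' : Matrix (κ' ⊕ (G' ⊕ G₀')) (κ ⊕ (G ⊕ G₀)) F}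
    (hR : BT (upR r) (lbl κ (nxtLab labG)) (lbl κ' (nxtLab labG')) R)
    (hR' : BT (upR r) (lbl κ' (nxtLab labG')) (lbl κ (nxtLab labG)) R') (h : R * R' = 1)
    {g g₁ : G} (hg : labG g = labG g₁) :
    ∑ g', R (.inr (.inl g)) (.inr (.inl g')) * R' (.inr (.inl g')) (.inr (.inl g₁)) =
      (1 : Matrix G G F) g g₁ := by
  have h1 := congrFun (congrFun h (.inr (.inl g))) (.inr (.inl g₁))
  rw [Matrix.mul_apply, Fintype.sum_sum_type, Fintype.sum_sum_type] at h1
  rw [Finset.sum_eq_zero (s := (Finset.univ : Finset κ')), zero_add,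
    Finset.sum_eq_zero (s := (Finset.univ : Finset G₀')), add_zero] at h1
  · rw [h1]
    simp [Matrix.one_apply]
  · intro g' _
    rw [hR' (.inr (.inr g')) (.inr (.inl g₁)) trivial, mul_zero]
  · intro b _
    rcases trichotomous_of r (none : Option ι) (some (labG g)) with h2 | h2 | h2
    · rw [hR (.inr (.inl g)) (.inl b) h2, zero_mul]
    · cases h2
    · rw [hR' (.inl b) (.inr (.inl g₁)) (by rw [hg] at h2; exact h2), mul_zero]

include hμ in
/-- An isomorphism of reduced bangles lifts to the bangles that they come from. -/
theorem BIso.red (hX : RowInj X) (h : BIso μ (nextR μ r) (nxtLab labG) (nxtLab labG') X Y) :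
    BIso μ r (Sum.elim labG labZ) (Sum.elim labG' labZ) (Red Z X) (Red Z Y) := by
  classical
  obtain ⟨XX, hXX⟩ := hX.exists_inv
  obtain ⟨T, T', h1, h2, hT, hT', e⟩ := h
  have hR := BT.tw_upR hμ hT hT'
  have hR' := BT.tw_upR hμ hT' hT
  have hRR' := tw_inv hμ h1
  have hR'R := tw_inv hμ h2
  rw [tw_toBlocks₁₁] at e
  set R := tw μ T T' with hRdef
  set R' := tw μ T' T with hR'def
  let S : Matrix ((κ ⊕ (G ⊕ G₀)) ⊕ (G ⊕ Z)) ((κ' ⊕ (G' ⊕ G₀')) ⊕ (G' ⊕ Z)) F :=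
    fromBlocks T (XX * (R.toBlocks₁₂ * (fromBlocks 1 0 0 0 : Matrix (G' ⊕ G₀') (G' ⊕ Z) F)))
      (fromRows ((R.toBlocks₂₁ * Y).submatrix Sum.inl id) 0)
      (fromBlocks R.toBlocks₂₂.toBlocks₁₁ 0 0 1)
  let B : Matrix ((κ ⊕ (G ⊕ G₀)) ⊕ (G ⊕ Z)) ((κ' ⊕ (G' ⊕ G₀')) ⊕ (G' ⊕ Z)) F :=
    fromBlocks T 0 0 (fromBlocks R.toBlocks₂₂.toBlocks₁₁ 0 0 1)
  let B' : Matrix ((κ' ⊕ (G' ⊕ G₀')) ⊕ (G' ⊕ Z)) ((κ ⊕ (G ⊕ G₀)) ⊕ (G ⊕ Z)) F :=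
    fromBlocks T' 0 0 (fromBlocks R'.toBlocks₂₂.toBlocks₁₁ 0 0 1)
  have hr := irrefl_of r
  have hS : BT r (lbl _ (Sum.elim labG labZ)) (lbl _ (Sum.elim labG' labZ)) S := by
    rintro (x | x | x) (y | y | y) h
    · exact absurd h (hr _)
    · simp only [S, fromBlocks_apply₁₂, Matrix.mul_assoc]
      rw [Matrix.mul_apply]
      refine Finset.sum_eq_zero fun a _ => ?_
      have : R (.inl a) (.inr (.inl y)) = 0 := hR (.inl a) (.inr (.inl y)) h
      simp [Matrix.mul_apply, toBlocks₁₂, Matrix.one_apply, this]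
    · simp [S, Matrix.mul_assoc, Matrix.mul_apply]
    · simp only [S, fromBlocks_apply₂₁, fromRows_apply_inl, submatrix_apply, Matrix.mul_apply]
      refine Finset.sum_eq_zero fun a _ => ?_
      have : R (.inr (.inl x)) (.inl a) = 0 := hR (.inr (.inl x)) (.inl a) h
      simp [toBlocks₂₁, this]
    · exact hR (.inr (.inl x)) (.inr (.inl y)) h
    · rfl
    · rfl
    · rfl
    · simp only [S, fromBlocks_apply₂₂]
      rw [Matrix.one_apply_ne]
      rintro rfl
      exact hr _ h
  have hB : BT r (lbl _ (Sum.elim labG labZ)) (lbl _ (Sum.elim labG' labZ)) B := by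
    rintro (x | x | x) (y | y | y) h
    · exact absurd h (hr _)
    · rfl
    · rfl
    · rfl
    · exact hS (.inr (.inl x)) (.inr (.inl y)) h
    · rfl
    · rfl
    · rfl
    · exact hS (.inr (.inr x)) (.inr (.inr y)) h
  have hB' : BT r (lbl _ (Sum.elim labG' labZ)) (lbl _ (Sum.elim labG labZ)) B' := by
    rintro (x | x | x) (y | y | y) h
    · exact absurd h (hr _)
    · rfl
    · rfl
    · rfl
    · exact hR' (.inr (.inl x)) (.inr (.inl y)) h
    · rfl
    · rfl
    · rfl
    · simp only [B', fromBlocks_apply₂₂]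
      rw [Matrix.one_apply_ne]
      rintro rfl
      exact hr _ h
  have hSB : ∀ a, dblk (lbl _ (Sum.elim labG labZ)) (lbl _ (Sum.elim labG' labZ)) a S =
      dblk (lbl _ (Sum.elim labG labZ)) (lbl _ (Sum.elim labG' labZ)) a B := by
    intro a
    ext ⟨x, hx⟩ ⟨y, hy⟩
    rcases x with x | x <;> rcases y with y | y
    · rfl
    · rw [← hx] at hy; cases hy
    · rw [← hx] at hy; cases hy
    · rfl
  have hd : ∀ a, dblk (lbl _ (Sum.elim labG labZ)) (lbl _ (Sum.elim labG' labZ)) a S *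
      dblk (lbl _ (Sum.elim labG' labZ)) (lbl _ (Sum.elim labG labZ)) a B' = 1 := by
    intro a
    rw [hSB, ← hB.dblk_mul hB', ← dblk_one]
    ext ⟨x, hx⟩ ⟨y, hy⟩
    simp only [dblk, submatrix_apply, B, B', fromBlocks_multiply, Matrix.mul_zero, Matrix.zero_mul,
      add_zero, zero_add, h1, Matrix.one_mul]
    rcases x with x | x | x <;> rcases y with y | y | y <;>
      try (simp [Matrix.one_apply]; done)
    have hxy : labG x = labG y := Option.some.inj (hx.trans hy.symm)
    have := BT.sum_red_diag hR hR' hRR' hxy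
    simp only [fromBlocks_apply₂₂, fromBlocks_apply₁₁, Matrix.mul_apply]
    exact this.trans (by simp [Matrix.one_apply])
  have hd' : ∀ a, dblk (lbl _ (Sum.elim labG' labZ)) (lbl _ (Sum.elim labG labZ)) a B' *
      dblk (lbl _ (Sum.elim labG labZ)) (lbl _ (Sum.elim labG' labZ)) a S = 1 := by
    intro a
    rw [hSB, ← hB'.dblk_mul hB, ← dblk_one]
    ext ⟨x, hx⟩ ⟨y, hy⟩
    simp only [dblk, submatrix_apply, B, B', fromBlocks_multiply, Matrix.mul_zero, Matrix.zero_mul,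
      add_zero, zero_add, h2, Matrix.one_mul]
    rcases x with x | x | x <;> rcases y with y | y | y <;>
      try (simp [Matrix.one_apply]; done)
    have hxy : labG' x = labG' y := Option.some.inj (hx.trans hy.symm)
    have := BT.sum_red_diag hR' hR hR'R hxy
    simp only [fromBlocks_apply₂₂, fromBlocks_apply₁₁, Matrix.mul_apply]
    exact this.trans (by simp [Matrix.one_apply])
  obtain ⟨S', h3, h4, hS'⟩ := hS.exists_inv fun a => ⟨_, hd a, hd' a⟩
  refine ⟨S, S', h3, h4, hS, hS', ?_⟩
  have hS11 : S'.toBlocks₁₁ = T' := by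
    have h5 := hS.toBlocks₁₁_inv hS' h4
    have h6 : S.toBlocks₁₁ = T := toBlocks_fromBlocks₁₁ _ _ _ _
    calc S'.toBlocks₁₁ = S'.toBlocks₁₁ * (T * T') := by rw [h1, Matrix.mul_one]
      _ = T' := by rw [← Matrix.mul_assoc, ← h6, h5, Matrix.one_mul]
  have hS11' : S.toBlocks₁₁ = T := toBlocks_fromBlocks₁₁ _ _ _ _
  rw [hS11, hS11', ← hRdef, ← fromBlocks_toBlocks R]
  simp only [Red, S, fromBlocks_multiply, Matrix.mul_zero, Matrix.zero_mul, add_zero, zero_add, e,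
    toBlocks_fromBlocks₁₁, toBlocks_fromBlocks₁₂, toBlocks_fromBlocks₂₁, toBlocks_fromBlocks₂₂]
  congr 1
  · rw [← Matrix.mul_assoc, hXX, Matrix.one_mul]
  · ext (i | i) j
    · simp [Matrix.mul_apply, Matrix.one_apply]
    · rw [Matrix.mul_apply, Matrix.mul_apply]
      have : ∀ b, R.toBlocks₂₁ (.inr i) b = 0 := fun b => hR (.inr (.inr i)) (.inl b) trivial
      simp [this]
  · ext (i | i) (j | j)
    · simp [Matrix.mul_apply, Matrix.one_apply, toBlocks₁₁]
    · simp [Matrix.mul_apply, Matrix.one_apply]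
    · have : ∀ b, R.toBlocks₂₂ (.inr i) (.inl b) = 0 :=
        fun b => hR (.inr (.inr i)) (.inr (.inl b)) trivial
      simp [Matrix.mul_apply, this]
    · simp [Matrix.mul_apply]

end Red

/-! ### Pivot columns -/

section Pivot

open scoped Classical in
/-- In a finite ordered family of vectors, those that are not combinations of earlier ones are
linearly independent, and every vector is a combination of those that do not come after it. -/
theorem linearIndependent_pivots {K V J : Type*} [DivisionRing K] [AddCommGroup V] [Module K V]
    [Finite J] [LinearOrder J] (v : J → V) :
    ∃ P : Set J, LinearIndependent K (fun p : P => v p) ∧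
      ∀ j, v j ∈ Submodule.span K (v '' {p | p ∈ P ∧ p ≤ j}) := by
  refine ⟨{j | v j ∉ Submodule.span K (v '' {i | i < j})}, ?_, ?_⟩
  · rw [linearIndependent_iff']
    intro s g hg i hi
    by_contra hne
    -- look at the last vector with a nonzero coefficient
    have hs : (s.filter fun p => g p ≠ 0).Nonempty := ⟨i, by simp [hi, hne]⟩
    obtain ⟨p, hp, hmax⟩ := Finset.exists_max_image _ id hs
    simp only [Finset.mem_filter, id] at hp hmax
    apply p.2
    rw [← Finset.add_sum_erase s _ hp.1, add_eq_zero_iff_eq_neg] at hg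
    have : v p = (g p)⁻¹ • -∑ x ∈ s.erase p, g x • v x := by
      rw [← hg, smul_smul, inv_mul_cancel₀ hp.2, one_smul]
    rw [this]
    refine Submodule.smul_mem _ _ (Submodule.neg_mem _ (Submodule.sum_mem _ fun x hx => ?_))
    rw [Finset.mem_erase] at hx
    by_cases h0 : g x = 0
    · simp [h0]
    · have hlt : (x : J) < p := lt_of_le_of_ne (hmax x ⟨hx.2, h0⟩) fun h => hx.1 (Subtype.ext h)
      exact Submodule.smul_mem _ _ (Submodule.subset_span ⟨x, hlt, rfl⟩)
  · intro j
    have wf : WellFounded ((· < ·) : J → J → Prop) := Finite.wellFounded_of_trans_of_irrefl _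
    induction j using wf.induction with
    | h j ih =>
    by_cases hj : v j ∈ Submodule.span K (v '' {i | i < j})
    · refine Submodule.span_le.2 ?_ hj
      rintro _ ⟨i, hi, rfl⟩
      refine Submodule.span_mono (Set.image_mono ?_) (ih i hi)
      exact fun p hp => ⟨hp.1, hp.2.trans (le_of_lt hi)⟩
    · exact Submodule.subset_span ⟨j, ⟨hj, le_rfl⟩, rfl⟩

variable {F : Type*} [DivisionRing F]

/-- The row transformation that turns the pivot columns of a matrix, whose columns are partitioned
into ordered strips, into unit vectors. -/
theorem exists_pivot_matrix {L : Type*} {ρ J : Type} [Fintype ρ] [DecidableEq ρ] [Fintype J]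
    (lb : J → L)
    (r : L → L → Prop) [IsStrictTotalOrder L r] (M : Matrix ρ J F) :
    ∃ (P : Set J) (_ : Fintype P) (_ : DecidableEq P) (e : ℕ) (Q : Matrix ρ (P ⊕ Fin e) F)
      (Q' : Matrix (P ⊕ Fin e) ρ F), Q * Q' = 1 ∧ Q' * Q = 1 ∧
      (∀ i (p : P), (Q' * M) i p = if i = .inl p then 1 else 0) ∧
      (∀ i j, (Q' * M) (.inr i) j = 0) ∧
      (∀ p j, r (lb j) (lb p.1) → (Q' * M) (.inl p) j = 0) := by
  classical
  let : LinearOrder L := linearOrderOfSTO r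
  let : LinearOrder J := LinearOrder.lift' (fun j => toLex (lb j, Fintype.equivFin J j))
    fun a b h => (Fintype.equivFin J).injective (Prod.ext_iff.1 (toLex.injective h)).2
  have hle : ∀ a b : J, a ≤ b → ¬ r (lb b) (lb a) := by
    intro a b h
    have h' : toLex (lb a, Fintype.equivFin J a) ≤ toLex (lb b, Fintype.equivFin J b) := h
    rw [Prod.Lex.toLex_le_toLex] at h'
    rcases h' with h' | h'
    · exact fun h2 => asymm_of r h2 h'
    · have h2 : lb a = lb b := h'.1
      rw [h2]
      exact irrefl_of r _
  obtain ⟨P, hP, hspan⟩ := linearIndependent_pivots (K := Fᵐᵒᵖ) (fun j => fun x => M x j)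
  let b₀ := Module.Basis.sumExtend hP
  have hfin1 : Module.Finite Fᵐᵒᵖ F := ⟨⟨{1}, Submodule.eq_top_iff'.2 fun x => by
    rw [Finset.coe_singleton, Submodule.mem_span_singleton]
    exact ⟨MulOpposite.op x, by simp⟩⟩⟩
  have hfin : Fintype (P ⊕ Module.Basis.sumExtendIndex hP) :=
    Module.Basis.fintypeIndexOfRankLtAleph0 b₀ (Module.rank_lt_aleph0 _ _)
  have hfin2 : Fintype (Module.Basis.sumExtendIndex hP) := Fintype.sumRight (α := P)
  let b := b₀.reindex (Equiv.sumCongr (Equiv.refl P) (Fintype.equivFin _))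
  have hb : ∀ p : P, b (.inl p) = fun x => M x p := fun p => by
    simp [b, b₀, Module.Basis.sumExtend]
    rfl
  let Q : Matrix ρ (P ⊕ Fin (Fintype.card (Module.Basis.sumExtendIndex hP))) F :=
    Matrix.of fun x i => b i x
  let Q' : Matrix (P ⊕ Fin (Fintype.card (Module.Basis.sumExtendIndex hP))) ρ F :=
    Matrix.of fun i x => (b.repr (Pi.single x 1) i).unop
  have key : ∀ (w : ρ → F) i, (b.repr w i).unop = ∑ x, Q' i x * w x := by
    intro w i
    have hw : w = ∑ x, MulOpposite.op (w x) • (Pi.single x 1 : ρ → F) := by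
      ext y
      simp [Finset.sum_apply, Pi.single_apply]
    conv_lhs => rw [hw]
    simp [map_sum, Finsupp.finsetSum_apply, Q', Finset.unop_sum]
  have h2 : Q' * Q = 1 := by
    ext i j
    rw [Matrix.mul_apply]
    have := key (b j) i
    rw [b.repr_self] at this
    rw [show ∑ x, Q' i x * Q x j = ∑ x, Q' i x * b j x from rfl, ← this, Matrix.one_apply,
      Finsupp.single_apply]
    by_cases h : i = j
    · simp [h]
    · simp [h, Ne.symm h]
  have h1 : Q * Q' = 1 := by
    ext x y
    have := congrFun (b.sum_repr (Pi.single y 1)) x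
    rw [Matrix.mul_apply, Matrix.one_apply]
    rw [Finset.sum_apply] at this
    simpa [Q, Q', Pi.single_apply] using this
  have hM : ∀ i j, (Q' * M) i j = (b.repr (fun x => M x j) i).unop := fun i j => by
    rw [key, Matrix.mul_apply]
  have hsupp : ∀ j i, (b.repr (fun x => M x j)) i ≠ 0 → ∃ p : P, i = .inl p ∧ p.1 ≤ j := by
    intro j i hi
    have h := hspan j
    have himg : (fun j => fun x => M x j) '' {p | p ∈ P ∧ p ≤ j} =
        b '' (Sum.inl '' {p : P | p.1 ≤ j}) := by
      ext w
      constructor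
      · rintro ⟨p, ⟨hp, hpj⟩, rfl⟩
        exact ⟨_, ⟨⟨p, hp⟩, hpj, rfl⟩, hb _⟩
      · rintro ⟨_, ⟨p, hp, rfl⟩, rfl⟩
        exact ⟨p.1, ⟨p.2, hp⟩, (hb p).symm⟩
    rw [himg, b.mem_span_image] at h
    obtain ⟨p, hp, rfl⟩ := h (Finsupp.mem_support_iff.2 hi)
    exact ⟨p, rfl, hp⟩
  refine ⟨P, inferInstance, inferInstance, _, Q, Q', h1, h2, ?_, ?_, ?_⟩
  · intro i p
    rw [hM, ← hb, b.repr_self, Finsupp.single_apply]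
    by_cases h : i = .inl p
    · simp [h]
    · simp [h, Ne.symm h]
  · intro i j
    rw [hM]
    by_contra h
    obtain ⟨p, hp, -⟩ := hsupp j (.inr i) fun h0 => h (by rw [h0]; rfl)
    cases hp
  · intro p j h
    rw [hM]
    by_contra h'
    obtain ⟨q, hq, hle'⟩ := hsupp j (.inl p) fun h0 => h' (by rw [h0]; rfl)
    cases hq
    exact hle _ _ hle' h

end Pivot

section ExistsRed

variable {F : Type*} [DivisionRing F] {ι : Type*}
  {μ : Option (F → F)} (hμ : ModeOK μ) {r : Option ι → Option ι → Prop}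
  [IsStrictTotalOrder (Option ι) r]

section

variable {ρ ρ' C C' : Type*} [Fintype ρ] [Fintype ρ'] [Fintype C] [Fintype C']
  [DecidableEq ρ] [DecidableEq ρ'] [DecidableEq C] [DecidableEq C']

include hμ in
/-- A change of basis in the row space. -/
theorem BIso.of_rowChange (lab : C → ι) (M : Matrix ρ (ρ ⊕ C) F) {Q : Matrix ρ ρ' F}
    {Q' : Matrix ρ' ρ F} (h : Q * Q' = 1) (h' : Q' * Q = 1) (f : C' ≃ C) :
    BIso μ r lab (lab ∘ f) M
      (fromCols ((Q' * M).submatrix id Sum.inl * tw μ Q Q')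
        ((Q' * M).submatrix id (Sum.inr ∘ f))) := by
  have hr := irrefl_of r
  refine ⟨fromBlocks (tw μ Q Q') 0 0 ((1 : Matrix C C F).submatrix id f),
    fromBlocks (tw μ Q' Q) 0 0 ((1 : Matrix C C F).submatrix f id), ?_, ?_, ?_, ?_, ?_⟩
  · rw [fromBlocks_multiply, submatrix_mul_equiv]
    simp [tw_inv hμ h]
  · have := Matrix.submatrix_mul_equiv (1 : Matrix C C F) (1 : Matrix C C F) f (Equiv.refl C) f
    rw [Matrix.mul_one, Matrix.submatrix_one_equiv] at this
    rw [fromBlocks_multiply, show (1 : Matrix C C F).submatrix f id *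
      (1 : Matrix C C F).submatrix id f = 1 from this]
    simp [tw_inv hμ h']
  · rintro (x | x) (y | y) hxy
    · exact absurd hxy (hr _)
    · rfl
    · rfl
    · simp only [fromBlocks_apply₂₂, submatrix_apply, id]
      rw [Matrix.one_apply_ne]
      rintro rfl
      exact hr _ hxy
  · rintro (x | x) (y | y) hxy
    · exact absurd hxy (hr _)
    · rfl
    · rfl
    · simp only [fromBlocks_apply₂₂, submatrix_apply, id]
      rw [Matrix.one_apply_ne]
      rintro rfl
      exact hr _ hxy
  · rw [toBlocks_fromBlocks₁₁, toBlocks_fromBlocks₁₁, tw_tw hμ]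
    have hM : Q * (Q' * M) = M := by rw [← Matrix.mul_assoc, h, Matrix.one_mul]
    conv_lhs => rw [← hM, Matrix.mul_assoc]
    congr 1
    ext i (j | j)
    · simp [Matrix.mul_apply]
    · simp [Matrix.mul_apply, Matrix.one_apply]

include hμ in
/-- Column operations that do not affect the bases of the row space. -/
theorem BIso.of_col {lab : C → ι} {M M' : Matrix ρ (ρ ⊕ C) F} {S S' : Matrix (ρ ⊕ C) (ρ ⊕ C) F}
    (h : S * S' = 1) (hS : BT r (lbl ρ lab) (lbl ρ lab) S) (h1 : S.toBlocks₁₁ = 1)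
    (e : M * S = M') : BIso μ r lab lab M M' := by
  have h' : S' * S = 1 := mul_eq_one_comm.1 h
  have hS' := hS.inv h
  refine ⟨S, S', h, h', hS, hS', ?_⟩
  have h2 : S'.toBlocks₁₁ = 1 := by
    have := hS.toBlocks₁₁_inv hS' h'
    rwa [h1, Matrix.mul_one] at this
  rw [h1, h2, tw_one hμ, Matrix.one_mul, e]

end

include hμ in
/-- Every bangle is isomorphic to one built from a smaller bangle with linearly independent
rows. -/
theorem exists_red {ρ C : Type} [Fintype ρ] [Fintype C] [DecidableEq ρ] [DecidableEq C]
    (lab : C → ι) (M : Matrix ρ (ρ ⊕ C) F) :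
    ∃ (κ G Z : Type) (e : ℕ) (_ : Fintype κ) (_ : Fintype G) (_ : Fintype Z)
      (_ : DecidableEq κ) (_ : DecidableEq G) (_ : DecidableEq Z)
      (labG : G → ι) (labZ : Z → ι) (X : Matrix κ (κ ⊕ (G ⊕ Fin e)) F), RowInj X ∧
      Fintype.card ρ = Fintype.card κ + (Fintype.card G + e) ∧
      BIso μ r lab (Sum.elim labG labZ) M (Red Z X) := by
  classical
  obtain ⟨P, _, _, e, Q, Q', h1, h2, hp, he, hlt⟩ := exists_pivot_matrix (lbl ρ lab) r M
  let κ := {d : ρ // Sum.inl d ∈ P}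
  let G := {c : C // Sum.inr c ∈ P}
  let Z := {c : C // ¬ Sum.inr c ∈ P}
  let wP : κ ⊕ G ≃ P := (Equiv.subtypeSum (p := fun x => x ∈ P)).symm
  let w : κ ⊕ (G ⊕ Fin e) ≃ P ⊕ Fin e :=
    (Equiv.sumAssoc κ G (Fin e)).symm.trans (Equiv.sumCongr wP (Equiv.refl _))
  let f : G ⊕ Z ≃ C := Equiv.sumCompl _
  have hw1 : ∀ d : κ, w (.inl d) = .inl ⟨.inl d.1, d.2⟩ := fun d => rfl
  have hw2 : ∀ g : G, w (.inr (.inl g)) = .inl ⟨.inr g.1, g.2⟩ := fun d => rfl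
  have hw3 : ∀ i : Fin e, w (.inr (.inr i)) = .inr i := fun d => rfl
  let Q₁ : Matrix ρ (κ ⊕ (G ⊕ Fin e)) F := Q.submatrix id w
  let Q₁' : Matrix (κ ⊕ (G ⊕ Fin e)) ρ F := Q'.submatrix w id
  have h1' : Q₁ * Q₁' = 1 := by
    have := Matrix.submatrix_mul_equiv Q Q' id w id
    rw [h1, Matrix.submatrix_id_id] at this
    exact this
  have h2' : Q₁' * Q₁ = 1 := by
    have := Matrix.submatrix_mul_equiv Q' Q w (Equiv.refl _) w
    rw [h2, Matrix.submatrix_one_equiv] at this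
    exact this
  let A := Q₁' * M
  have hA : ∀ i j, A i j = (Q' * M) (w i) j := fun i j => rfl
  have hAκ : ∀ i (d : κ), A i (.inl d.1) = if i = .inl d then 1 else 0 := fun i d => by
    rw [hA, hp (w i) ⟨.inl d.1, d.2⟩, ← hw1]
    simp only [w.injective.eq_iff]
  have hAG : ∀ i (g : G), A i (.inr g.1) = if i = .inr (.inl g) then 1 else 0 := fun i g => by
    rw [hA, hp (w i) ⟨.inr g.1, g.2⟩, ← hw2]
    simp only [w.injective.eq_iff]
  have hA0 : ∀ (i : Fin e) j, A (.inr (.inr i)) j = 0 := fun i j => he i j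
  have hAlt1 : ∀ (d : κ) j, r (lbl ρ lab j) none → A (.inl d) j = 0 := fun d j h => hlt _ j h
  have hAlt2 : ∀ (g : G) j, r (lbl ρ lab j) (some (lab g.1)) → A (.inr (.inl g)) j = 0 :=
    fun g j h => hlt _ j h
  have iso1 := BIso.of_rowChange hμ (r := r) lab M h1' h2' f
  let A1 : Matrix (κ ⊕ (G ⊕ Fin e)) (κ ⊕ (G ⊕ Fin e)) F := A.submatrix id Sum.inl * tw μ Q₁ Q₁'
  let X : Matrix κ (κ ⊕ (G ⊕ Fin e)) F := A1.submatrix Sum.inl id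
  let VG : Matrix G (κ ⊕ (G ⊕ Fin e)) F := A1.submatrix (fun g => Sum.inr (Sum.inl g)) id
  let UZ : Matrix κ Z F := A.submatrix Sum.inl (fun z => Sum.inr z.1)
  let WZ : Matrix G Z F := A.submatrix (fun g => Sum.inr (Sum.inl g)) (fun z => Sum.inr z.1)
  have hM1 : fromCols (A.submatrix id Sum.inl * tw μ Q₁ Q₁') (A.submatrix id (Sum.inr ∘ f)) =
      fromBlocks X (fromCols 0 UZ) (fromRows VG 0) (fromBlocks 1 WZ 0 0) := by
    have hf1 : ∀ g : G, f (.inl g) = g.1 := fun _ => rfl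
    have hf2 : ∀ g : Z, f (.inr g) = g.1 := fun _ => rfl
    ext (i | i | i) (j | j | j) <;> simp [X, UZ, VG, WZ, A1, hAG, hA0, hf1, hf2, Matrix.mul_apply,
      Matrix.one_apply]
  -- `X` has a right inverse
  have hXX : X * (tw μ Q₁' Q₁).submatrix id (fun d : κ => d.1) = 1 := by
    have h3 : A1 * tw μ Q₁' Q₁ = A.submatrix id Sum.inl := by
      rw [Matrix.mul_assoc, tw_inv hμ h1', Matrix.mul_one]
    ext i j
    have := congrFun (congrFun h3 (.inl i)) j.1
    rw [Matrix.submatrix_apply, id, hAκ] at this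
    rw [Matrix.one_apply]
    exact this.trans (by simp)
  set XX := (tw μ Q₁' Q₁).submatrix id (fun d : κ => d.1) with hXXdef
  let lab' : G ⊕ Z → ι := Sum.elim (fun g => lab g.1) (fun z => lab z.1)
  have hlab : lab ∘ f = lab' := by
    funext x
    rcases x with x | x <;> rfl
  have hr := irrefl_of r
  have iso2 : BIso μ r lab' lab'
      (fromBlocks X (fromCols 0 UZ) (fromRows VG 0) (fromBlocks 1 WZ 0 0))
      (fromBlocks X (fromCols 0 UZ) 0 (fromBlocks 1 WZ (0 : Matrix (Fin e) G F) 0)) := by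
    refine BIso.of_col hμ (S := fromBlocks 1 0 (fromRows (-VG) 0) 1)
      (S' := fromBlocks 1 0 (fromRows VG 0) 1) ?_ ?_ (toBlocks_fromBlocks₁₁ _ _ _ _) ?_
    · rw [fromBlocks_multiply]
      refine Eq.trans ?_ fromBlocks_one
      congr 1
      · simp
      · simp
      · rw [Matrix.mul_one, Matrix.one_mul]
        ext (i | i) j <;> simp
      · simp
    · rintro (x | x | x) (y | y | y) h
      · exact absurd h (hr _)
      · rfl
      · rfl
      · have h3 : VG x y = 0 := by
          simp only [VG, A1, submatrix_apply, Matrix.mul_apply]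
          exact Finset.sum_eq_zero fun d _ => mul_eq_zero_of_left (hAlt2 x (.inl d) h) _
        simp [h3]
      · simp only [fromBlocks_apply₂₂]
        rw [Matrix.one_apply_ne]
        intro h3
        obtain rfl := Sum.inl.inj h3
        exact hr _ h
      · simp
      · rfl
      · simp
      · simp only [fromBlocks_apply₂₂]
        rw [Matrix.one_apply_ne]
        intro h3
        obtain rfl := Sum.inr.inj h3
        exact hr _ h
    · rw [fromBlocks_multiply]
      congr 1
      · simp [fromCols_mul_fromRows]
      · simp
      · rw [fromBlocks_mul_fromRows, Matrix.mul_one]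
        ext (i | i) j <;> simp
      · simp
  have iso3 : BIso μ r lab' lab'
      (fromBlocks X (fromCols 0 UZ) 0 (fromBlocks 1 WZ (0 : Matrix (Fin e) G F) 0))
      (Red Z X) := by
    refine BIso.of_col hμ (S := fromBlocks 1 (fromCols 0 (-(XX * UZ))) 0 (fromBlocks 1 (-WZ) 0 1))
      (S' := fromBlocks 1 (fromCols 0 (XX * UZ)) 0 (fromBlocks 1 WZ 0 1)) ?_ ?_
      (toBlocks_fromBlocks₁₁ _ _ _ _) ?_
    · rw [fromBlocks_multiply]
      refine Eq.trans ?_ fromBlocks_one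
      congr 1
      · simp
      · rw [fromCols_mul_fromBlocks, Matrix.one_mul]
        ext i (j | j) <;> simp
      · simp
      · rw [Matrix.zero_mul, zero_add, fromBlocks_multiply]
        refine Eq.trans ?_ fromBlocks_one
        congr 1 <;> simp
    · rintro (x | x | x) (y | y | y) h
      · exact absurd h (hr _)
      · rfl
      · have h3 : (XX * UZ) x y = 0 := by
          rw [Matrix.mul_apply]
          exact Finset.sum_eq_zero fun d _ => by
            simp only [UZ, submatrix_apply]
            rw [hAlt1 d (.inr y.1) h, mul_zero]
        simp [h3]
      · rfl
      · simp only [fromBlocks_apply₂₂, fromBlocks_apply₁₁]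
        rw [Matrix.one_apply_ne]
        rintro rfl
        exact hr _ h
      · have h3 : WZ x y = 0 := hAlt2 x (.inr y.1) h
        simp [h3]
      · rfl
      · rfl
      · simp only [fromBlocks_apply₂₂]
        rw [Matrix.one_apply_ne]
        rintro rfl
        exact hr _ h
    · have h3 : X * fromCols (0 : Matrix _ G F) (-(XX * UZ)) = fromCols 0 (-UZ) := by
        rw [mul_fromCols, Matrix.mul_neg, ← Matrix.mul_assoc, hXX, Matrix.one_mul, Matrix.mul_zero]
      rw [Red, fromBlocks_multiply, h3, fromCols_mul_fromBlocks, fromBlocks_multiply]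
      simp only [Matrix.mul_zero, Matrix.mul_one, Matrix.one_mul, Matrix.zero_mul, add_zero,
        zero_add]
      congr 1
      · ext i (j | j) <;> simp
      · simp
  rw [hlab] at iso1
  refine ⟨κ, G, Z, e, inferInstance, inferInstance, inferInstance, inferInstance, inferInstance,
    inferInstance, fun g => lab g.1, fun z => lab z.1, X, RowInj.of_mul_eq_one hXX, ?_, ?_⟩
  · rw [card_eq_of_mul_eq_one h1' h2']
    simp only [Fintype.card_sum, Fintype.card_fin]
  · refine iso1.trans hμ ?_
    rw [show fromCols ((Q₁' * M).submatrix id Sum.inl * tw μ Q₁ Q₁')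
      ((Q₁' * M).submatrix id (Sum.inr ∘ f)) = _ from hM1]
    exact iso2.trans hμ iso3

end ExistsRed

/-! ### The normal form: existence and uniqueness -/

section NF

variable {F : Type*} [DivisionRing F] {ι : Type*}

/-- The block-direct sum of a bangle with boxed strip `K` and no other columns, of the summands
with boxed strip `J_q(0)` and one further column `E_q` (indexed by `s`), and of the boxed summands
`J_q(0)` (indexed by `b`), where `q` is given by `len`. -/
def NF {P s b : Type*} [DecidableEq s] [DecidableEq b] (K : Matrix P P F) (len : s ⊕ b → ℕ) :
    Matrix (P ⊕ Σ x, Fin (len x)) ((P ⊕ Σ x, Fin (len x)) ⊕ s) F :=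
  Matrix.of fun i j =>
    match i, j with
    | .inl p, .inl (.inl p') => K p p'
    | .inr a, .inl (.inr a') => if a.1 = a'.1 ∧ a.2.val + 1 = a'.2.val then 1 else 0
    | .inr a, .inr c => if a.1 = .inl c ∧ a.2.val + 1 = len a.1 then 1 else 0
    | _, _ => 0

theorem sigma_fin_ext {α : Type*} {len : α → ℕ} {z z' : Σ x, Fin (len x)} :
    z = z' ↔ z.1 = z'.1 ∧ z.2.val = z'.2.val := by
  refine ⟨fun h => h ▸ ⟨rfl, rfl⟩, ?_⟩
  obtain ⟨x, a⟩ := z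
  obtain ⟨x', a'⟩ := z'
  rintro ⟨h, h'⟩
  cases h
  exact Sigma.ext rfl (heq_of_eq (Fin.ext h'))

variable {P s b : Type*} [Fintype P] [DecidableEq P] [Fintype s] [DecidableEq s] [Fintype b]
  [DecidableEq b] {μ : Option (F → F)} (hμ : ModeOK μ) {r : Option ι → Option ι → Prop}
  [IsStrictTotalOrder (Option ι) r]

include hμ in
theorem BIso.mod_reindex {s' b' : Type*} [Fintype s'] [DecidableEq s'] [Fintype b']
    [DecidableEq b'] (K : Matrix P P F) {len : s ⊕ b → ℕ} {len' : s' ⊕ b' → ℕ} {lab : s → ι}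
    {lab' : s' → ι} (es : s ≃ s') (eb : b ≃ b') (hl : ∀ x, len' (Equiv.sumCongr es eb x) = len x)
    (hlab : ∀ c, lab' (es c) = lab c) : BIso μ r lab lab' (NF K len) (NF K len') := by
  refine BIso.of_equiv hμ (Equiv.sumCongr (Equiv.refl P) (Equiv.sigmaCongr (Equiv.sumCongr es eb)
    fun x => finCongr (hl x).symm)) es hlab ?_
  have hinj : ∀ x y, Sum.map es eb x = Sum.map es eb y ↔ x = y := fun x y =>
    (Equiv.sumCongr es eb).injective.eq_iff
  rintro (p | ⟨x, a⟩) ((p' | ⟨x', a'⟩) | c)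
  · rfl
  · rfl
  · rfl
  · rfl
  · change (if Sum.map es eb x = Sum.map es eb x' ∧ a.val + 1 = a'.val then (1 : F) else 0) =
      if x = x' ∧ a.val + 1 = a'.val then 1 else 0
    simp only [hinj]
  · have h1 : Sum.map es eb x = .inl (es c) ↔ x = .inl c := hinj x (.inl c)
    have h2 : len' (Sum.map es eb x) = len x := hl x
    change (if Sum.map es eb x = .inl (es c) ∧ a.val + 1 = len' (Sum.map es eb x) then (1 : F)
      else 0) = if x = .inl c ∧ a.val + 1 = len x then 1 else 0
    simp only [h1, h2]

include hμ in
theorem BIso.mod_empty [IsEmpty s] [IsEmpty b] {C : Type*} [Fintype C] [DecidableEq C] [IsEmpty C]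
    (K : Matrix P P F) (len : s ⊕ b → ℕ) (lab : s → ι) (lab' : C → ι) :
    BIso μ r lab lab' (NF K len) (boxM C K) := by
  refine BIso.of_equiv hμ (Equiv.sumEmpty P _) (Equiv.equivOfIsEmpty _ _)
    (fun c => isEmptyElim c) ?_
  rintro (p | ⟨x, _⟩) ((p' | ⟨x', _⟩) | c)
  · rfl
  all_goals first | exact (IsEmpty.false x).elim | exact (IsEmpty.false x').elim | exact isEmptyElim c

theorem NF.rowInj [IsEmpty b] {K K' : Matrix P P F} (hK : K * K' = 1) (len : s ⊕ b → ℕ) :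
    RowInj (NF K len) := by
  intro v hv
  have h1 : (fun p => v (.inl p)) ᵥ* K = 0 := by
    ext p
    have := congrFun hv (.inl (.inl p))
    simpa [vecMul, dotProduct, NF] using this
  have h2 : (fun p => v (.inl p)) = 0 := by
    rw [← vecMul_one (fun p => v (.inl p)), ← hK, ← vecMul_vecMul, h1, zero_vecMul]
  -- each remaining row contains the only nonzero entry of some column
  have h3 : ∀ i : Σ x, Fin (len x), ∃ j, ∀ i', NF K len i' j = if i' = .inr i then 1 else 0 := by
    intro i
    by_cases ha : i.2.val + 1 < len i.1
    · refine ⟨.inl (.inr ⟨i.1, ⟨i.2.val + 1, ha⟩⟩), ?_⟩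
      rintro (p | i')
      · simp [NF]
      · simp only [NF, of_apply, Sum.inr.injEq, sigma_fin_ext, Nat.add_right_cancel_iff]
    · obtain ⟨c, hc⟩ : ∃ c, i.1 = .inl c := by
        rcases i.1 with c | y
        · exact ⟨c, rfl⟩
        · exact isEmptyElim y
      refine ⟨.inr c, ?_⟩
      have ha' : i.2.val + 1 = len i.1 := by have := i.2.2; omega
      rintro (p | i')
      · simp [NF]
      · simp only [NF, of_apply, Sum.inr.injEq, sigma_fin_ext]
        refine if_congr ⟨?_, ?_⟩ rfl rfl
        · rintro ⟨h, h'⟩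
          refine ⟨h.trans hc.symm, ?_⟩
          have := congrArg len (h.trans hc.symm)
          omega
        · rintro ⟨h, h'⟩
          refine ⟨h.trans hc, ?_⟩
          have := congrArg len h
          omega
  ext (p | i)
  · exact congrFun h2 p
  · obtain ⟨j, hj⟩ := h3 i
    have := congrFun hv j
    simpa [vecMul, dotProduct, hj] using this

theorem NF.isEmpty_of_rowInj {K : Matrix P P F} {len : s ⊕ b → ℕ} (hl : ∀ y, 1 ≤ len (.inr y))
    (h : RowInj (NF K len)) : IsEmpty b := by
  refine ⟨fun y => ?_⟩
  have h1 : ∀ j, NF K len (.inr ⟨.inr y, ⟨len (.inr y) - 1, by have := hl y; omega⟩⟩) j = 0 := by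
    rintro ((p' | ⟨x', a'⟩) | c)
    · rfl
    · simp only [NF, of_apply]
      rw [if_neg]
      rintro ⟨h, h'⟩
      have h2 := a'.2
      have h3 : x' = .inr y := h.symm
      subst h3
      have := hl y
      change len (.inr y) - 1 + 1 = _ at h'
      omega
    · simp [NF]
  have := h (Pi.single (.inr ⟨.inr y, ⟨len (.inr y) - 1, by have := hl y; omega⟩⟩) 1) (by
    ext j
    simp [h1])
  have h2 := congrFun this (.inr ⟨.inr y, ⟨len (.inr y) - 1, by have := hl y; omega⟩⟩)
  simp at h2

end NF

/-! ### The reduction of a normal form -/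

section ModRed

variable {F : Type*} [DivisionRing F] {ι : Type*}
  {μ : Option (F → F)} (hμ : ModeOK μ) {r : Option ι → Option ι → Prop}
  [IsStrictTotalOrder (Option ι) r]
  {P s₀ s₁ b : Type*} [Fintype P] [DecidableEq P] [Fintype s₀] [DecidableEq s₀]
  [Fintype s₁] [DecidableEq s₁] [Fintype b] [DecidableEq b]

/-- The inclusion of the columns of the reduced normal form into the summands of the original. -/
def nfIdx : s₁ ⊕ b → (s₁ ⊕ s₀) ⊕ b := Sum.map Sum.inl id

omit [Fintype s₀] [DecidableEq s₀] [Fintype s₁] [DecidableEq s₁] [Fintype b] [DecidableEq b] in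
theorem nfIdx_injective : Function.Injective (nfIdx (s₀ := s₀) (s₁ := s₁) (b := b)) :=
  Sum.map_injective.2 ⟨Sum.inl_injective, Function.injective_id⟩

/-- The lengths of the summands, in terms of those of the reduced normal form. -/
def nfLen (q : s₁ ⊕ b → ℕ) : (s₁ ⊕ s₀) ⊕ b → ℕ :=
  Sum.elim (Sum.elim (fun x => q (.inl x) + 1) (fun _ => 0)) (fun y => q (.inr y) + 1)

omit [Fintype s₀] [DecidableEq s₀] [Fintype s₁] [DecidableEq s₁] [Fintype b] [DecidableEq b] in
theorem nfLen_nfIdx (q : s₁ ⊕ b → ℕ) (w : s₁ ⊕ b) :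
    nfLen (s₀ := s₀) q (nfIdx w) = q w + 1 := by
  rcases w with w | w <;> rfl

/-- The rows of a normal form, as the rows and columns of its reduction. -/
def nfRow (q : s₁ ⊕ b → ℕ) :
    (P ⊕ (Σ x : (s₁ ⊕ b) ⊕ Empty, Fin (Sum.elim q Empty.elim x))) ⊕ (s₁ ⊕ b) →
    P ⊕ (Σ x : (s₁ ⊕ s₀) ⊕ b, Fin (nfLen q x))
  | .inl (.inl p) => .inl p
  | .inl (.inr ⟨.inl w, a⟩) =>
    .inr ⟨nfIdx w, ⟨a.val, by rw [nfLen_nfIdx]; exact Nat.lt_succ_of_lt a.2⟩⟩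
  | .inr w => .inr ⟨nfIdx w, ⟨q w, by rw [nfLen_nfIdx]; exact Nat.lt_succ_self _⟩⟩

omit [Fintype P] [DecidableEq P] [Fintype s₀] [DecidableEq s₀]
  [Fintype s₁] [DecidableEq s₁] [Fintype b] [DecidableEq b] in
theorem nfRow_bijective (q : s₁ ⊕ b → ℕ) :
    Function.Bijective (nfRow (P := P) (s₀ := s₀) q) := by
  constructor
  · rintro ((p | ⟨w | z, a⟩) | w) ((p' | ⟨w' | z', a'⟩) | w') h
    all_goals first
      | exact z.elim
      | exact z'.elim
      | simp only [nfRow, Sum.inl.injEq, Sum.inr.injEq, sigma_fin_ext, reduceCtorEq,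
          nfIdx_injective.eq_iff] at h
    · rw [h]
    · obtain ⟨h, h'⟩ := h
      subst h
      cases Fin.ext h'
      rfl
    · obtain ⟨h, h'⟩ := h
      subst h
      exact absurd h' (show a.val < q w from a.2).ne
    · obtain ⟨h, h'⟩ := h
      subst h
      exact absurd h'.symm (show a'.val < q w from a'.2).ne
    · rw [h.1]
  · rintro (p | ⟨x, a⟩)
    · exact ⟨.inl (.inl p), rfl⟩
    · have key : ∀ w (a : Fin (nfLen (s₀ := s₀) q (nfIdx w))),
          ∃ y, nfRow (P := P) q y = .inr ⟨nfIdx w, a⟩ := fun w a => by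
        by_cases ha : a.val < q w
        · exact ⟨.inl (.inr ⟨.inl w, ⟨a.val, ha⟩⟩), rfl⟩
        · refine ⟨.inr w, ?_⟩
          have h1 := lt_of_lt_of_eq a.2 (nfLen_nfIdx q w)
          simp only [nfRow, Sum.inr.injEq, sigma_fin_ext, true_and]
          omega
      rcases x with (x | x) | y
      · exact key (.inl x) a
      · exact a.elim0
      · exact key (.inr y) a

include hμ in
/-- A normal form reduces to the normal form in which all singular summands are shortened by one,
and the boxed ones have become summands that belong to the new strip. -/
theorem BIso.mod_red (K : Matrix P P F) (lab₀ : s₀ → ι) (lab₁ : s₁ → ι) (q : s₁ ⊕ b → ℕ) :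
    BIso μ r (Sum.elim lab₁ lab₀) (Sum.elim lab₁ lab₀)
      (Red s₀ (NF K (Sum.elim q Empty.elim))) (NF K (nfLen q)) := by
  refine BIso.of_equiv hμ (Equiv.ofBijective _ (nfRow_bijective q)) (Equiv.refl _)
    (fun _ => rfl) ?_
  rintro ((p | ⟨w | z, a⟩) | w) (((p' | ⟨w' | z', a'⟩) | w') | c)
  all_goals first
    | exact z.elim
    | exact z'.elim
    | rfl
    | skip
  · change (if nfIdx w = nfIdx w' ∧ a.val + 1 = a'.val then (1 : F) else 0) =
      if Sum.inl w = Sum.inl w' ∧ a.val + 1 = a'.val then 1 else 0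
    simp only [nfIdx_injective.eq_iff, Sum.inl_injective.eq_iff]
  · change (if nfIdx w = nfIdx w' ∧ a.val + 1 = q w' then (1 : F) else 0) =
      if Sum.inl w = Sum.inl w' ∧ a.val + 1 = q w then 1 else 0
    simp only [nfIdx_injective.eq_iff, Sum.inl_injective.eq_iff]
    exact if_congr (and_congr_right fun h => by subst h; rfl) rfl rfl
  · change (if nfIdx w = .inl c ∧ a.val + 1 = nfLen q (nfIdx w) then (1 : F) else 0) = 0
    rw [if_neg]
    rintro ⟨-, h⟩
    rw [nfLen_nfIdx] at h
    exact absurd (Nat.succ_injective h) a.2.ne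
  · change (if nfIdx w = nfIdx w' ∧ q w + 1 = a'.val then (1 : F) else 0) = 0
    rw [if_neg]
    rintro ⟨h, h'⟩
    rw [nfIdx_injective.eq_iff] at h
    subst h
    have : a'.val < q w := a'.2
    omega
  · change (if nfIdx w = nfIdx w' ∧ q w + 1 = q w' then (1 : F) else 0) = 0
    rw [if_neg]
    rintro ⟨h, h'⟩
    rw [nfIdx_injective.eq_iff] at h
    subst h
    omega
  · change (if nfIdx w = .inl c ∧ q w + 1 = nfLen q (nfIdx w) then (1 : F) else 0) =
      (fromBlocks 1 0 0 0 : Matrix _ _ F) w c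
    rw [nfLen_nfIdx]
    rcases w with w | w <;> rcases c with c | c <;> simp [nfIdx, Matrix.one_apply]

end ModRed

section NormalForm

variable {F : Type*} [DivisionRing F] {μ : Option (F → F)} (hμ : ModeOK μ)

theorem map_univ_comp_equiv {α β κ : Type*} [Fintype α] [Fintype β] (e : α ≃ β) (f : β → κ) :
    Finset.univ.val.map (fun a => f (e a)) = Finset.univ.val.map f := by
  rw [← Finset.map_univ_equiv e, Finset.map_val, Multiset.map_map]
  rfl

theorem map_eq_map_of_map_eq_map {α β κ κ' : Type*} {s : Multiset α} {t : Multiset β} {f : α → κ}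
    {g : β → κ} (h : s.map f = t.map g) (φ : κ → κ') :
    s.map (fun a => φ (f a)) = t.map (fun b => φ (g b)) := by
  have := congrArg (Multiset.map φ) h
  rwa [Multiset.map_map, Multiset.map_map] at this

theorem filterMap_none_eq_zero {α κ : Type*} {f : α → Option κ} (h : ∀ a, f a = none)
    (s : Multiset α) : s.filterMap f = 0 :=
  Multiset.eq_zero_of_forall_notMem fun b hb => by
    obtain ⟨a, -, ha⟩ := (Multiset.mem_filterMap _ _).1 hb
    rw [h] at ha
    cases ha

theorem filterMap_univ_sum_inl {α β κ κ' : Type*} [Fintype α] [Fintype β] {f : α ⊕ β → κ}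
    {φ : κ → Option κ'} {g : α → κ'} (h1 : ∀ a, φ (f (.inl a)) = some (g a))
    (h2 : ∀ b, φ (f (.inr b)) = none) :
    (Finset.univ.val.map f).filterMap φ = Finset.univ.val.map g := by
  rw [map_univ_sum, Multiset.filterMap_add, Multiset.filterMap_map, Multiset.filterMap_map,
    filterMap_none_eq_zero (f := φ ∘ f ∘ Sum.inr) h2, add_zero, ← Multiset.filterMap_eq_map]
  exact congrArg (fun ψ => Multiset.filterMap ψ _) (funext h1)

theorem filterMap_univ_sum_inr {α β κ κ' : Type*} [Fintype α] [Fintype β] {f : α ⊕ β → κ}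
    {φ : κ → Option κ'} {g : β → κ'} (h1 : ∀ a, φ (f (.inl a)) = none)
    (h2 : ∀ b, φ (f (.inr b)) = some (g b)) :
    (Finset.univ.val.map f).filterMap φ = Finset.univ.val.map g := by
  rw [map_univ_sum, Multiset.filterMap_add, Multiset.filterMap_map, Multiset.filterMap_map,
    filterMap_none_eq_zero (f := φ ∘ f ∘ Sum.inl) h1, zero_add, ← Multiset.filterMap_eq_map]
  exact congrArg (fun ψ => Multiset.filterMap ψ _) (funext h2)

/-- A finite type splits according to a predicate. -/
theorem exists_sum_equiv {s : Type} [Fintype s] (p : s → Prop) :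
    ∃ (s₁ s₀ : Type) (_ : Fintype s₁) (_ : Fintype s₀) (_ : DecidableEq s₁) (_ : DecidableEq s₀)
      (e : s ≃ s₁ ⊕ s₀), (∀ x, p (e.symm (.inl x))) ∧ ∀ x, ¬ p (e.symm (.inr x)) := by
  classical
  exact ⟨{x // p x}, {x // ¬ p x}, inferInstance, inferInstance, inferInstance, inferInstance,
    (Equiv.sumCompl p).symm, fun x => x.2, fun x => x.2⟩

include hμ in
theorem BIso.red_empty {ι κ G G₀ Z : Type*} {r : Option ι → Option ι → Prop}
    [IsStrictTotalOrder (Option ι) r] [Fintype κ] [Fintype G] [Fintype G₀] [Fintype Z]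
    [DecidableEq κ] [DecidableEq G] [DecidableEq G₀] [DecidableEq Z] [IsEmpty G] [IsEmpty G₀]
    (labG : G → ι) (labZ : Z → ι) (X : Matrix κ (κ ⊕ (G ⊕ G₀)) F) :
    BIso μ r (Sum.elim labG labZ) labZ (Red Z X)
      (NF (X.submatrix id .inl) (Sum.elim (fun _ : Z => 0) (fun y : Empty => y.elim))) := by
  have : IsEmpty (Σ x : Z ⊕ Empty, Fin (Sum.elim (fun _ : Z => 0) (fun y : Empty => y.elim) x)) :=
    ⟨by rintro ⟨x | x, a⟩ <;> [exact a.elim0; exact x.elim]⟩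
  refine BIso.of_equiv hμ ((Equiv.sumEmpty κ _).trans (Equiv.sumEmpty κ _).symm)
    (Equiv.emptySum G Z) ?_ ?_
  · rintro (g | z)
    · exact isEmptyElim g
    · rfl
  · rintro (a | x) ((a' | x') | (g | z))
    all_goals first
      | exact (IsEmpty.false x).elim
      | exact (IsEmpty.false x').elim
      | exact (IsEmpty.false g).elim
      | rfl

include hμ in
/-- Every bangle has a normal form. The induction is on the number of rows, which the reduction
decreases unless all rows have their pivots in the boxed strip. -/
theorem exists_nf (n : ℕ) : ∀ {ι : Type} {r : Option ι → Option ι → Prop}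
    [IsStrictTotalOrder (Option ι) r] {ρ C : Type} [Fintype ρ] [Fintype C] [DecidableEq ρ]
    [DecidableEq C] (lab : C → ι) (M : Matrix ρ (ρ ⊕ C) F), Fintype.card ρ ≤ n →
    ∃ (P s b : Type) (_ : Fintype P) (_ : Fintype s) (_ : Fintype b) (_ : DecidableEq P)
      (_ : DecidableEq s) (_ : DecidableEq b) (K K' : Matrix P P F) (q : s → ℕ) (qb : b → ℕ)
      (labs : s → ι), K * K' = 1 ∧ K' * K = 1 ∧
      BIso μ r lab labs M (NF K (Sum.elim q (fun y => qb y + 1))) := by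
  induction n using Nat.strong_induction_on with
  | _ n ih =>
  intro ι r _ ρ C _ _ _ _ lab M hn
  obtain ⟨κ, G, Z, e, _, _, _, _, _, _, labG, labZ, X, hX, hcard, hiso⟩ := exists_red hμ (r := r) lab M
  by_cases h0 : Fintype.card G + e = 0
  · have he : e = 0 := by omega
    subst he
    have : IsEmpty G := Fintype.card_eq_zero_iff.1 (by omega)
    have h1 : RowInj (X.submatrix id .inl) := fun v hv => hX v (by
      ext (a | (g | z))
      · exact congrFun hv a
      · exact isEmptyElim g
      · exact z.elim0)
    obtain ⟨K', hK'⟩ := h1.exists_inv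
    refine ⟨κ, Z, Empty, inferInstance, inferInstance, inferInstance, inferInstance, inferInstance,
      inferInstance, X.submatrix id .inl, K', fun _ => 0, fun y => y.elim, labZ, hK',
      mul_eq_one_comm.1 hK', hiso.trans hμ ?_⟩
    have e1 : (fun y : Empty => (y.elim : ℕ) + 1) = fun y => y.elim := funext fun y => y.elim
    rw [e1]
    exact BIso.red_empty hμ labG labZ X
  · obtain ⟨P, s, b, _, _, _, _, _, _, K, K', q, qb, labs, hK, hK', h⟩ :=
      ih (Fintype.card κ) (by omega) (r := nextR μ r) (nxtLab (G₀ := Fin e) labG) X le_rfl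
    have : IsEmpty b := NF.isEmpty_of_rowInj (fun y => by simp) (h.rowInj hμ hX)
    obtain ⟨s₁, b', _, _, _, _, es, h1, h2⟩ := exists_sum_equiv (fun x => labs x ≠ none)
    have h1' : ∀ x, ∃ i, labs (es.symm (.inl x)) = some i := fun x => Option.ne_none_iff_exists'.1 (h1 x)
    choose lab₁ hlab₁ using h1'
    have h3 : BIso μ (nextR μ r) labs (nxtLab lab₁) (NF K (Sum.elim q (fun y => qb y + 1)))
        (NF K (Sum.elim (fun x => q (es.symm x)) Empty.elim)) := by
      refine BIso.mod_reindex hμ K es (Equiv.equivOfIsEmpty b Empty) ?_ ?_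
      · rintro (x | y)
        · simp
        · exact isEmptyElim y
      · intro c
        obtain ⟨y, rfl⟩ := es.symm.surjective c
        rw [Equiv.apply_symm_apply]
        rcases y with y | y
        · exact (hlab₁ y).symm
        · exact (not_not.1 (h2 y)).symm
    have h4 := BIso.red hμ (labZ := labZ) hX (h.trans hμ h3)
    have h5 := BIso.mod_red hμ (r := r) K labZ lab₁ (fun x => q (es.symm x))
    exact ⟨P, s₁ ⊕ Z, b', inferInstance, inferInstance, inferInstance, inferInstance, inferInstance,
      inferInstance, K, K', _, _, _, hK, hK', (hiso.trans hμ h4).trans hμ h5⟩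

include hμ in
/-- A normal form is isomorphic to the one built from its reduction, the summands without rows
being split off. -/
theorem BIso.exists_nf_red {ι : Type*} {r : Option ι → Option ι → Prop}
    [IsStrictTotalOrder (Option ι) r] {P s b : Type} [Fintype P] [DecidableEq P] [Fintype s]
    [DecidableEq s] [Fintype b] [DecidableEq b] (K : Matrix P P F) (q : s → ℕ) (qb : b → ℕ)
    (lab : s → ι) :
    ∃ (s₁ s₀ : Type) (_ : Fintype s₁) (_ : Fintype s₀) (_ : DecidableEq s₁) (_ : DecidableEq s₀)
      (lab₁ : s₁ → ι) (lab₀ : s₀ → ι) (q₁ : s₁ → ℕ),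
      (∀ x, ∃ y, q y = q₁ x + 1) ∧
      Finset.univ.val.map (fun x => (lab x, q x)) =
        Finset.univ.val.map (fun x => (lab₁ x, q₁ x + 1)) +
          Finset.univ.val.map (fun x => (lab₀ x, 0)) ∧
      BIso μ r lab (Sum.elim lab₁ lab₀) (NF K (Sum.elim q (fun y => qb y + 1)))
        (Red s₀ (NF K (Sum.elim (Sum.elim q₁ qb) Empty.elim))) := by
  obtain ⟨s₁, s₀, _, _, _, _, e, h1, h2⟩ := exists_sum_equiv (fun x => q x ≠ 0)
  have h1' : ∀ x, ∃ m, q (e.symm (.inl x)) = m + 1 := fun x => Nat.exists_eq_succ_of_ne_zero (h1 x)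
  choose q₁ hq₁ using h1'
  have h2' : ∀ x, q (e.symm (.inr x)) = 0 := fun x => not_not.1 (h2 x)
  refine ⟨s₁, s₀, inferInstance, inferInstance, inferInstance, inferInstance,
    fun x => lab (e.symm (.inl x)), fun x => lab (e.symm (.inr x)), q₁, fun x => ⟨_, hq₁ x⟩, ?_, ?_⟩
  · rw [← map_univ_comp_equiv e.symm, map_univ_sum]
    congr 1
    · exact Multiset.map_congr rfl fun x _ => by simp [hq₁]
    · exact Multiset.map_congr rfl fun x _ => by simp [h2']
  · refine BIso.trans hμ ?_ ((BIso.mod_red hμ (r := r) K _ _ (Sum.elim q₁ qb)).symm hμ)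
    refine BIso.mod_reindex hμ K e (Equiv.refl b) ?_ ?_
    · rintro (x | y)
      · obtain ⟨x, rfl⟩ := e.symm.surjective x
        rcases x with x | x
        · simp [nfLen, hq₁]
        · simp [nfLen, h2']
      · rfl
    · intro x
      obtain ⟨x, rfl⟩ := e.symm.surjective x
      rcases x with x | x <;> simp

include hμ in
/-- The uniqueness of the normal form. -/
theorem nf_unique (n : ℕ) : ∀ {ι : Type} {r : Option ι → Option ι → Prop}
    [IsStrictTotalOrder (Option ι) r] {P s b P' s' b' : Type} [Fintype P] [Fintype s] [Fintype b]
    [Fintype P'] [Fintype s'] [Fintype b'] [DecidableEq P] [DecidableEq s] [DecidableEq b]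
    [DecidableEq P'] [DecidableEq s'] [DecidableEq b'] {K K₁ : Matrix P P F}
    {K' K₁' : Matrix P' P' F} {q : s → ℕ} {qb : b → ℕ} {q' : s' → ℕ} {qb' : b' → ℕ} {lab : s → ι}
    {lab' : s' → ι}, K * K₁ = 1 → K' * K₁' = 1 → (∀ x, q x < n) → (∀ x, q' x < n) →
    (∀ y, qb y + 1 < n) → (∀ y, qb' y + 1 < n) →
    BIso μ r lab lab' (NF K (Sum.elim q (fun y => qb y + 1)))
      (NF K' (Sum.elim q' (fun y => qb' y + 1))) →
    MEq μ K K' ∧ Finset.univ.val.map (fun x => (lab x, q x)) =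
        Finset.univ.val.map (fun x => (lab' x, q' x)) ∧
      Finset.univ.val.map qb = Finset.univ.val.map qb' := by
  induction n with
  | zero =>
    intro ι r _ P s b P' s' b' _ _ _ _ _ _ _ _ _ _ _ _ K K₁ K' K₁' q qb q' qb' lab lab' hK hK'
      h1 h2 h3 h4 h
    have : IsEmpty s := ⟨fun x => absurd (h1 x) (Nat.not_lt_zero _)⟩
    have : IsEmpty s' := ⟨fun x => absurd (h2 x) (Nat.not_lt_zero _)⟩
    have : IsEmpty b := ⟨fun x => absurd (h3 x) (Nat.not_lt_zero _)⟩
    have : IsEmpty b' := ⟨fun x => absurd (h4 x) (Nat.not_lt_zero _)⟩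
    refine ⟨?_, by simp, by simp⟩
    have h5 := BIso.mod_empty hμ (r := r) K (Sum.elim q (fun y => qb y + 1)) lab
      (Empty.elim : Empty → ι)
    have h6 := BIso.mod_empty hμ (r := r) K' (Sum.elim q' (fun y => qb' y + 1)) lab'
      (Empty.elim : Empty → ι)
    exact BIso.box_iff.1 (((h5.symm hμ).trans hμ h).trans hμ h6)
  | succ n ih =>
    intro ι r _ P s b P' s' b' _ _ _ _ _ _ _ _ _ _ _ _ K K₁ K' K₁' q qb q' qb' lab lab' hK hK'
      h1 h2 h3 h4 h
    obtain ⟨s₁, s₀, _, _, _, _, lab₁, lab₀, q₁, hq₁, hm, hi⟩ :=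
      BIso.exists_nf_red hμ (r := r) K q qb lab
    obtain ⟨s₁', s₀', _, _, _, _, lab₁', lab₀', q₁', hq₁', hm', hi'⟩ :=
      BIso.exists_nf_red hμ (r := r) K' q' qb' lab'
    have e1 : (Empty.elim : Empty → ℕ) = fun y : Empty => (Empty.elim y : ℕ) + 1 :=
      funext fun y => y.elim
    obtain ⟨h5, h6⟩ := BIso.of_red hμ (NF.rowInj hK _) (NF.rowInj hK' _)
      (((hi.symm hμ).trans hμ h).trans hμ hi')
    have h7 : ∀ x, Sum.elim q₁ qb x < n := by
      rintro (x | x)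
      · obtain ⟨y, hy⟩ := hq₁ x
        have := h1 y
        simp only [Sum.elim_inl]
        omega
      · have := h3 x
        simp only [Sum.elim_inr]
        omega
    have h8 : ∀ x, Sum.elim q₁' qb' x < n := by
      rintro (x | x)
      · obtain ⟨y, hy⟩ := hq₁' x
        have := h2 y
        simp only [Sum.elim_inl]
        omega
      · have := h4 x
        simp only [Sum.elim_inr]
        omega
    rw [e1] at h5
    obtain ⟨h9, h10, -⟩ := ih hK hK' h7 h8 (fun y => y.elim) (fun y => y.elim) h5
    refine ⟨h9, ?_, ?_⟩
    · rw [hm, hm']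
      congr 1
      · have := congrArg (Multiset.filterMap (fun z : Option ι × ℕ => z.1.map fun i => (i, z.2 + 1)))
          h10
        rwa [filterMap_univ_sum_inl (g := fun x => (lab₁ x, q₁ x + 1)) (fun _ => rfl)
          (fun _ => rfl), filterMap_univ_sum_inl (g := fun x => (lab₁' x, q₁' x + 1))
          (fun _ => rfl) (fun _ => rfl)] at this
      · exact map_eq_map_of_map_eq_map h6 fun i => (i, 0)
    · have := congrArg (Multiset.filterMap
        (fun z : Option ι × ℕ => z.1.elim (some z.2) fun _ => none)) h10
      rwa [filterMap_univ_sum_inr (g := qb) (fun _ => rfl) (fun _ => rfl),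
        filterMap_univ_sum_inr (g := qb') (fun _ => rfl) (fun _ => rfl)] at this

end NormalForm

/-! ### Bangles as matrices with labelled columns -/

section Bridge

variable {F : Type*} [DivisionRing F] {t : ℕ} {k : Fin t}

/-- The position of a strip, where `none` stands for the boxed one. -/
def stripPos (k : Fin t) (a : Option {i : Fin t // i ≠ k}) : Fin t := a.elim k Subtype.val

theorem stripPos_injective (k : Fin t) : Function.Injective (stripPos k) := by
  rintro (_ | a) (_ | b) h
  · rfl
  · exact absurd h.symm b.2
  · exact absurd h a.2
  · exact congrArg some (Subtype.ext h)

/-- The order of the strips from left to right. -/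
def stripLT (k : Fin t) (a b : Option {i : Fin t // i ≠ k}) : Prop := stripPos k a < stripPos k b

instance stripLT_isStrictTotalOrder (k : Fin t) :
    IsStrictTotalOrder (Option {i : Fin t // i ≠ k}) (stripLT k) where
  trichotomous a b h h' := stripPos_injective k (le_antisymm (not_lt.1 h') (not_lt.1 h))
  irrefl _ := lt_irrefl _
  trans _ _ _ := lt_trans

namespace Bangle

/-- The indices of the columns outside the boxed strip. -/
abbrev OuterCol (s : Fin t → ℕ) (k : Fin t) : Type := Σ i : {i : Fin t // i ≠ k}, Fin (s i)

/-- The matrix of a bangle with the boxed strip moved to the front. -/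
def boxFirst (A : Bangle F k) :
    Matrix (Fin (A.size k)) (Fin (A.size k) ⊕ OuterCol A.size k) F :=
  Matrix.of fun a x => x.elim (A.strip k a) fun p => A.strip p.1 a p.2

/-- `BIso` for bangles. -/
def Equivalent (μ : Option (F → F)) (A B : Bangle F k) : Prop :=
  BIso μ (stripLT k) (Sigma.fst : OuterCol A.size k → _) (Sigma.fst : OuterCol B.size k → _)
    A.boxFirst B.boxFirst

/-- The columns with the boxed strip moved to the front. -/
def colFront (s : Fin t → ℕ) (k : Fin t) : Fin (s k) ⊕ OuterCol s k → Σ i, Fin (s i) :=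
  Sum.elim (fun a => ⟨k, a⟩) (fun p => ⟨p.1, p.2⟩)

theorem colFront_bijective (s : Fin t → ℕ) (k : Fin t) : Function.Bijective (colFront s k) := by
  constructor
  · rintro (a | ⟨⟨i, hi⟩, a⟩) (b | ⟨⟨j, hj⟩, b⟩) h
    · simpa [colFront] using h
    · exact absurd (congrArg Sigma.fst h).symm hj
    · exact absurd (congrArg Sigma.fst h) hi
    · simp only [colFront, Sum.elim_inr, Sigma.mk.injEq] at h
      obtain ⟨h, h'⟩ := h
      subst h
      rw [eq_of_heq h']
  · rintro ⟨i, a⟩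
    by_cases h : i = k
    · subst h
      exact ⟨.inl a, rfl⟩
    · exact ⟨.inr ⟨⟨i, h⟩, a⟩, rfl⟩

/-- `colFront` as an equivalence. -/
noncomputable def colEquiv (s : Fin t → ℕ) (k : Fin t) :
    Fin (s k) ⊕ OuterCol s k ≃ Σ i, Fin (s i) := Equiv.ofBijective _ (colFront_bijective s k)

theorem stripPos_lbl (s : Fin t → ℕ) (x : Fin (s k) ⊕ OuterCol s k) :
    stripPos k (lbl (Fin (s k)) (Sigma.fst : OuterCol s k → _) x) = (colEquiv s k x).1 := by
  rcases x with x | x <;> rfl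

theorem blockTriangular_iff (s : Fin t → ℕ) (S : Matrix (Σ i, Fin (s i)) (Σ i, Fin (s i)) F) :
    S.BlockTriangular Sigma.fst ↔ BT (stripLT k) (lbl (Fin (s k)) (Sigma.fst : OuterCol s k → _))
      (lbl (Fin (s k)) (Sigma.fst : OuterCol s k → _))
      (S.submatrix (colEquiv s k) (colEquiv s k)) := by
  constructor
  · intro h x y hxy
    rw [stripLT, stripPos_lbl, stripPos_lbl] at hxy
    exact h hxy
  · intro h x y hxy
    obtain ⟨x, rfl⟩ := (colEquiv s k).surjective x
    obtain ⟨y, rfl⟩ := (colEquiv s k).surjective y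
    rw [← stripPos_lbl, ← stripPos_lbl] at hxy
    exact h x y hxy

variable {μ : Option (F → F)} (hμ : ModeOK μ)

include hμ in
theorem equivalent_mk_iff (s : Fin t → ℕ) (a b : ∀ i, Matrix (Fin (s k)) (Fin (s i)) F) :
    Equivalent μ (k := k) ⟨s, a⟩ ⟨s, b⟩ ↔
      ∃ S S' : Matrix (Σ i, Fin (s i)) (Σ i, Fin (s i)) F, S * S' = 1 ∧
        S.BlockTriangular Sigma.fst ∧ (⟨s, b⟩ : Bangle F k).toMatrix =
          tw μ (diagBlock ⟨s, a⟩ S') (diagBlock (k := k) ⟨s, a⟩ S) *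
            (⟨s, a⟩ : Bangle F k).toMatrix * S := by
  have hg : ∀ a : ∀ i, Matrix (Fin (s k)) (Fin (s i)) F, (⟨s, a⟩ : Bangle F k).boxFirst =
      (⟨s, a⟩ : Bangle F k).toMatrix.submatrix id (colEquiv s k) := fun a => by
    ext i (j | j) <;> rfl
  have hd : ∀ S : Matrix (Σ i, Fin (s i)) (Σ i, Fin (s i)) F, diagBlock (k := k) ⟨s, a⟩ S =
    (S.submatrix (colEquiv s k) (colEquiv s k)).toBlocks₁₁ := fun S => rfl
  constructor
  · rintro ⟨S, S', h1, h2, hS, hS', e⟩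
    refine ⟨S.submatrix (colEquiv s k).symm (colEquiv s k).symm,
      S'.submatrix (colEquiv s k).symm (colEquiv s k).symm, ?_, ?_, ?_⟩
    · rw [submatrix_mul_equiv, h1, submatrix_one_equiv]
    · rw [blockTriangular_iff (k := k)]
      simpa [submatrix_submatrix] using hS
    · rw [hd, hd]
      have h3 := tw_inv hμ (hS.toBlocks₁₁_inv hS' h2)
      simp only [submatrix_submatrix, Equiv.symm_comp_self, submatrix_id_id]
      have e2 : (⟨s, b⟩ : Bangle F k).boxFirst =
          tw μ S'.toBlocks₁₁ S.toBlocks₁₁ * ((⟨s, a⟩ : Bangle F k).boxFirst * S) := by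
        rw [e, ← Matrix.mul_assoc, h3, Matrix.one_mul]
      have e3 : (⟨s, b⟩ : Bangle F k).toMatrix =
          ((⟨s, b⟩ : Bangle F k).boxFirst).submatrix id (colEquiv s k).symm := by
        rw [hg, submatrix_submatrix, Equiv.self_comp_symm]
        rfl
      have e4 : (⟨s, a⟩ : Bangle F k).toMatrix =
          ((⟨s, a⟩ : Bangle F k).boxFirst).submatrix id (colEquiv s k).symm := by
        rw [hg, submatrix_submatrix, Equiv.self_comp_symm]
        rfl
      rw [e3, e4, e2, Matrix.mul_assoc, submatrix_mul_equiv]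
      rfl
  · rintro ⟨S, S', h1, hS, e⟩
    have hS2 := (blockTriangular_iff (k := k) s S).1 hS
    have h2 : S.submatrix (colEquiv s k) (colEquiv s k) *
        S'.submatrix (colEquiv s k) (colEquiv s k) = 1 := by
      rw [submatrix_mul_equiv, h1, submatrix_one_equiv]
    have h3 : S'.submatrix (colEquiv s k) (colEquiv s k) *
        S.submatrix (colEquiv s k) (colEquiv s k) = 1 := by
      rw [submatrix_mul_equiv, mul_eq_one_comm.1 h1, submatrix_one_equiv]
    have hS3 := hS2.inv h2
    refine ⟨_, _, h2, h3, hS2, hS3, ?_⟩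
    have h4 := tw_inv hμ (hS3.toBlocks₁₁_inv hS2 h2)
    have e2 : (⟨s, b⟩ : Bangle F k).boxFirst =
        tw μ (S'.submatrix (colEquiv s k) (colEquiv s k)).toBlocks₁₁
          (S.submatrix (colEquiv s k) (colEquiv s k)).toBlocks₁₁ *
          ((⟨s, a⟩ : Bangle F k).boxFirst * S.submatrix (colEquiv s k) (colEquiv s k)) := by
      rw [hg b, hg a, e, hd, hd, submatrix_mul_equiv, Matrix.mul_assoc]
      rfl
    rw [e2, ← Matrix.mul_assoc, h4, Matrix.one_mul]

theorem diagBlock_inv (A : Bangle F k) {S S' : Matrix (Σ i, Fin (A.size i)) (Σ i, Fin (A.size i)) F}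
    (h1 : S * S' = 1) (hS : S.BlockTriangular Sigma.fst) :
    A.diagBlock S' * A.diagBlock S = 1 ∧ A.diagBlock S * A.diagBlock S' = 1 := by
  have hS2 := (blockTriangular_iff (k := k) A.size S).1 hS
  have h2 : S.submatrix (colEquiv A.size k) (colEquiv A.size k) *
      S'.submatrix (colEquiv A.size k) (colEquiv A.size k) = 1 := by
    rw [submatrix_mul_equiv, h1, submatrix_one_equiv]
  have h3 := hS2.inv h2
  exact ⟨hS2.toBlocks₁₁_inv h3 (mul_eq_one_comm.1 h2), h3.toBlocks₁₁_inv hS2 h2⟩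

theorem Equivalent.size_eq {A B : Bangle F k} (h : Equivalent μ A B) (i : Fin t) :
    A.size i = B.size i := by
  by_cases hi : i = k
  · subst hi
    obtain ⟨S, S', h1, h2, hS, hS', -⟩ := h
    simpa using card_eq_of_mul_eq_one (hS'.toBlocks₁₁_inv hS h1) (hS.toBlocks₁₁_inv hS' h2)
  · have h1 := h.card_fiber ⟨i, hi⟩
    rwa [Fintype.card_congr (Equiv.sigmaSubtype _), Fintype.card_congr (Equiv.sigmaSubtype _),
      Fintype.card_fin, Fintype.card_fin] at h1

theorem isCongruent_iff {σ : F → F} (hσ : IsRingInvolution σ) {A B : Bangle F k} :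
    A.IsCongruent σ B ↔ Equivalent (some σ) A B := by
  have hμ : ModeOK (some σ) := by rintro _ ⟨⟩; exact hσ
  constructor
  · rintro ⟨h, S, hS, hT, e⟩
    obtain ⟨s, a⟩ := A
    obtain ⟨s', b⟩ := B
    obtain rfl : s = s' := funext h
    obtain ⟨S', h1⟩ := hS.exists_right_inv
    exact (equivalent_mk_iff hμ s a b).2 ⟨S, S', h1, hT, e⟩
  · intro h
    have hs := h.size_eq
    obtain ⟨s, a⟩ := A
    obtain ⟨s', b⟩ := B
    obtain rfl : s = s' := funext hs
    obtain ⟨S, S', h1, hT, e⟩ := (equivalent_mk_iff hμ s a b).1 h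
    exact ⟨fun _ => rfl, S, ⟨⟨S, S', h1, mul_eq_one_comm.1 h1⟩, rfl⟩, hT, e⟩

theorem isSimilar_iff {A B : Bangle F k} : A.IsSimilar B ↔ Equivalent none A B := by
  have hμ : ModeOK (none : Option (F → F)) := by rintro _ ⟨⟩
  constructor
  · rintro ⟨h, S, T, hS, hT, h1, h2, e⟩
    obtain ⟨s, a⟩ := A
    obtain ⟨s', b⟩ := B
    obtain rfl : s = s' := funext h
    obtain ⟨S', h3⟩ := hS.exists_right_inv
    obtain ⟨h4, h5⟩ := diagBlock_inv (⟨s, a⟩ : Bangle F k) h3 hT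
    refine (equivalent_mk_iff hμ s a b).2 ⟨S, S', h3, hT, ?_⟩
    rw [show diagBlock (k := k) ⟨s, a⟩ S' = T from left_inv_eq_right_inv h4 h2]
    exact e
  · intro h
    have hs := h.size_eq
    obtain ⟨s, a⟩ := A
    obtain ⟨s', b⟩ := B
    obtain rfl : s = s' := funext hs
    obtain ⟨S, S', h1, hT, e⟩ := (equivalent_mk_iff hμ s a b).1 h
    obtain ⟨h4, h5⟩ := diagBlock_inv (⟨s, a⟩ : Bangle F k) h1 hT
    exact ⟨fun _ => rfl, S, _, ⟨⟨S, S', h1, mul_eq_one_comm.1 h1⟩, rfl⟩, hT, h4, h5, e⟩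

end Bangle

end Bridge

/-! ### Direct sums of normal forms -/

section NFSum

variable {F : Type*} [DivisionRing F] {ι : Type*} {μ : Option (F → F)} (hμ : ModeOK μ)
  {r : Option ι → Option ι → Prop} [IsStrictTotalOrder (Option ι) r]
  {P s b P' s' b' : Type*} [Fintype P] [Fintype s] [Fintype b]
  [Fintype P'] [Fintype s'] [Fintype b'] [DecidableEq P] [DecidableEq s] [DecidableEq b]
  [DecidableEq P'] [DecidableEq s'] [DecidableEq b']

/-- The summands of the first of two normal forms among those of their sum. -/
def idxL {s b s' b' : Type*} : s ⊕ b → (s ⊕ s') ⊕ (b ⊕ b') := Sum.map .inl .inl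

/-- The summands of the second of two normal forms among those of their sum. -/
def idxR {s b s' b' : Type*} : s' ⊕ b' → (s ⊕ s') ⊕ (b ⊕ b') := Sum.map .inr .inr

/-- The lengths of the summands of the sum of two normal forms. -/
def sumLen (len : s ⊕ b → ℕ) (len' : s' ⊕ b' → ℕ) : (s ⊕ s') ⊕ (b ⊕ b') → ℕ :=
  Sum.elim (Sum.elim (fun x => len (.inl x)) (fun x => len' (.inl x)))
    (Sum.elim (fun y => len (.inr y)) (fun y => len' (.inr y)))

omit [Fintype s] [Fintype b] [Fintype s'] [Fintype b'] [DecidableEq s] [DecidableEq b]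
  [DecidableEq s'] [DecidableEq b'] in
theorem sumLen_inl (len : s ⊕ b → ℕ) (len' : s' ⊕ b' → ℕ) (x : s ⊕ b) :
    sumLen len len' (idxL x) = len x := by rcases x with x | x <;> rfl

omit [Fintype s] [Fintype b] [Fintype s'] [Fintype b'] [DecidableEq s] [DecidableEq b]
  [DecidableEq s'] [DecidableEq b'] in
theorem sumLen_inr (len : s ⊕ b → ℕ) (len' : s' ⊕ b' → ℕ) (x : s' ⊕ b') :
    sumLen len len' (idxR x) = len' x := by rcases x with x | x <;> rfl

/-- The rows of the sum of two normal forms. -/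
def sumRow (len : s ⊕ b → ℕ) (len' : s' ⊕ b' → ℕ) :
    (P ⊕ Σ x, Fin (len x)) ⊕ (P' ⊕ Σ x, Fin (len' x)) →
      (P ⊕ P') ⊕ Σ x, Fin (sumLen len len' x)
  | .inl (.inl p) => .inl (.inl p)
  | .inl (.inr z) => .inr ⟨idxL z.1, Fin.cast (sumLen_inl len len' z.1).symm z.2⟩
  | .inr (.inl p) => .inl (.inr p)
  | .inr (.inr z) => .inr ⟨idxR z.1, Fin.cast (sumLen_inr len len' z.1).symm z.2⟩

theorem idxL_injective {s b s' b' : Type*} :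
    Function.Injective (idxL : s ⊕ b → (s ⊕ s') ⊕ (b ⊕ b')) :=
  Sum.map_injective.2 ⟨Sum.inl_injective, Sum.inl_injective⟩

theorem idxR_injective {s b s' b' : Type*} :
    Function.Injective (idxR : s' ⊕ b' → (s ⊕ s') ⊕ (b ⊕ b')) :=
  Sum.map_injective.2 ⟨Sum.inr_injective, Sum.inr_injective⟩

theorem idxL_ne_idxR {s b s' b' : Type*} (x : s ⊕ b) (x' : s' ⊕ b') :
    (idxL x : (s ⊕ s') ⊕ (b ⊕ b')) ≠ idxR x' := by
  rcases x with x | x <;> rcases x' with x' | x' <;> simp [idxL, idxR]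

omit [Fintype s] [Fintype b] [Fintype s'] [Fintype b'] [DecidableEq s] [DecidableEq b]
  [DecidableEq s'] [DecidableEq b'] [Fintype P] [Fintype P'] [DecidableEq P] [DecidableEq P'] in
theorem sumRow_bijective (len : s ⊕ b → ℕ) (len' : s' ⊕ b' → ℕ) :
    Function.Bijective (sumRow (P := P) (P' := P') len len') := by
  constructor
  · rintro ((p | z) | (p | z)) ((p' | z') | (p' | z')) h
    all_goals
      simp only [sumRow, Sum.inl.injEq, Sum.inr.injEq, sigma_fin_ext, reduceCtorEq,
        idxL_injective.eq_iff, idxR_injective.eq_iff, Fin.val_cast] at h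
    · rw [h]
    · rw [sigma_fin_ext.2 h]
    · exact absurd h.1 (idxL_ne_idxR _ _)
    · rw [h]
    · exact absurd h.1.symm (idxL_ne_idxR _ _)
    · rw [sigma_fin_ext.2 h]
  · rintro ((p | p) | ⟨(x | x) | (x | x), a⟩)
    · exact ⟨.inl (.inl p), rfl⟩
    · exact ⟨.inr (.inl p), rfl⟩
    · exact ⟨.inl (.inr ⟨.inl x, a⟩), rfl⟩
    · exact ⟨.inr (.inr ⟨.inl x, a⟩), rfl⟩
    · exact ⟨.inl (.inr ⟨.inr x, a⟩), rfl⟩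
    · exact ⟨.inr (.inr ⟨.inr x, a⟩), rfl⟩

include hμ in
theorem BIso.nf_sum (K : Matrix P P F) (K' : Matrix P' P' F) (len : s ⊕ b → ℕ) (len' : s' ⊕ b' → ℕ)
    (lab : s → ι) (lab' : s' → ι) :
    BIso μ r (Sum.elim lab lab') (Sum.elim lab lab') (bsum (NF K len) (NF K' len'))
      (NF (fromBlocks K 0 0 K') (sumLen len len')) := by
  refine BIso.of_equiv hμ (Equiv.ofBijective _ (sumRow_bijective len len')) (Equiv.refl _)
    (fun _ => rfl) ?_
  rintro ((p | z) | (p | z)) (((p' | z') | (p' | z')) | (c | c))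
  all_goals first
    | rfl
    | skip
  · change (if (idxL z.1 : (s ⊕ s') ⊕ (b ⊕ b')) = idxL z'.1 ∧ z.2.val + 1 = z'.2.val then (1 : F)
      else 0) = if z.1 = z'.1 ∧ z.2.val + 1 = z'.2.val then 1 else 0
    simp only [idxL_injective.eq_iff]
  · change (if (idxL z.1 : (s ⊕ s') ⊕ (b ⊕ b')) = idxR z'.1 ∧ z.2.val + 1 = z'.2.val then (1 : F)
      else 0) = 0
    rw [if_neg fun h => idxL_ne_idxR _ _ h.1]
  · change (if idxL z.1 = .inl (.inl c) ∧
      z.2.val + 1 = sumLen len len' (idxL z.1) then (1 : F)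
      else 0) = if z.1 = .inl c ∧ z.2.val + 1 = len z.1 then 1 else 0
    refine if_congr (and_congr ?_ (by rw [sumLen_inl])) rfl rfl
    exact idxL_injective.eq_iff (b := (.inl c : s ⊕ b))
  · change (if idxL z.1 = .inl (.inr c) ∧
      z.2.val + 1 = sumLen len len' (idxL z.1) then (1 : F) else 0) = 0
    exact if_neg fun h => idxL_ne_idxR z.1 (.inl c) h.1
  · change (if (idxR z.1 : (s ⊕ s') ⊕ (b ⊕ b')) = idxL z'.1 ∧ z.2.val + 1 = z'.2.val then (1 : F)
      else 0) = 0
    rw [if_neg fun h => idxL_ne_idxR _ _ h.1.symm]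
  · change (if (idxR z.1 : (s ⊕ s') ⊕ (b ⊕ b')) = idxR z'.1 ∧ z.2.val + 1 = z'.2.val then (1 : F)
      else 0) = if z.1 = z'.1 ∧ z.2.val + 1 = z'.2.val then 1 else 0
    simp only [idxR_injective.eq_iff]
  · change (if idxR z.1 = .inl (.inl c) ∧
      z.2.val + 1 = sumLen len len' (idxR z.1) then (1 : F) else 0) = 0
    exact if_neg fun h => idxL_ne_idxR (.inl c) z.1 h.1.symm
  · change (if idxR z.1 = .inl (.inr c) ∧
      z.2.val + 1 = sumLen len len' (idxR z.1) then (1 : F)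
      else 0) = if z.1 = .inl c ∧ z.2.val + 1 = len' z.1 then 1 else 0
    refine if_congr (and_congr ?_ (by rw [sumLen_inr])) rfl rfl
    exact idxR_injective.eq_iff (b := (.inl c : s' ⊕ b'))

include hμ in
theorem BIso.nf_congr {K : Matrix P P F} {K' : Matrix P' P' F} (e : P ≃ P')
    (h : ∀ p p', K' (e p) (e p') = K p p') (len : s ⊕ b → ℕ) (lab : s → ι) :
    BIso μ r lab lab (NF K len) (NF K' len) := by
  refine BIso.of_equiv hμ (Equiv.sumCongr e (Equiv.refl _)) (Equiv.refl _) (fun _ => rfl) ?_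
  rintro (p | z) ((p' | z') | c)
  · exact h p p'
  all_goals rfl

end NFSum

section Parts

variable {F : Type*} [DivisionRing F] {t : ℕ} {k : Fin t} {μ : Option (F → F)} (hμ : ModeOK μ)

namespace Bangle

include hμ in
theorem Equivalent.symm {A B : Bangle F k} (h : Equivalent μ A B) : Equivalent μ B A :=
  BIso.symm hμ h

include hμ in
theorem Equivalent.trans {A B C : Bangle F k} (h : Equivalent μ A B) (h' : Equivalent μ B C) :
    Equivalent μ A C := BIso.trans hμ h h'

include hμ in
theorem Equivalent.refl (A : Bangle F k) : Equivalent μ A A := BIso.refl hμ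

include hμ in
theorem bsum_dsum (A B : Bangle F k) :
    BIso μ (stripLT k) (Sum.elim Sigma.fst Sigma.fst) Sigma.fst
      (bsum A.boxFirst B.boxFirst) (A.dsum B).boxFirst := by
  refine BIso.of_equiv hμ finSumFinEquiv
    ((Equiv.sigmaSumDistrib (fun i : {i : Fin t // i ≠ k} => Fin (A.size i))
      (fun i => Fin (B.size i))).symm.trans (Equiv.sigmaCongrRight fun i => finSumFinEquiv)) ?_ ?_
  · rintro (⟨i, a⟩ | ⟨i, a⟩) <;> rfl
  · have key : ∀ i a b, (A.dsum B).strip i (finSumFinEquiv a) (finSumFinEquiv b) =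
        fromBlocks (A.strip i) 0 0 (B.strip i) a b := fun i a b => by simp [dsum]
    rintro (a | a) ((b | b) | (⟨i, b⟩ | ⟨i, b⟩)) <;> exact key _ _ _

include hμ in
theorem Equivalent.dsum {A A' B B' : Bangle F k} (h : Equivalent μ A A') (h' : Equivalent μ B B') :
    Equivalent μ (A.dsum B) (A'.dsum B') :=
  (((bsum_dsum hμ A B).symm hμ).trans hμ (BIso.sum hμ h h')).trans hμ (bsum_dsum hμ A' B')

include hμ in
theorem boxM_ofBox {p : ℕ} (K : Matrix (Fin p) (Fin p) F) :
    BIso μ (stripLT k) (Empty.elim) Sigma.fst (boxM Empty K) (ofBox k K).boxFirst := by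
  have : IsEmpty (OuterCol (ofBox k K).size k) := ⟨by
    rintro ⟨⟨i, hi⟩, a⟩
    exact (Fin.cast (if_neg hi) a).elim0⟩
  refine BIso.of_equiv hμ (finCongr (if_pos rfl).symm) (Equiv.equivOfIsEmpty _ _)
    (fun c => c.elim) ?_
  rintro a (b | c)
  · change (ofBox k K).strip k (Fin.cast (if_pos rfl).symm a)
      (Fin.cast (if_pos rfl).symm b) = K a b
    simp [ofBox]
  · exact c.elim

include hμ in
theorem ofBox_equivalent_iff {p p' : ℕ} {K : Matrix (Fin p) (Fin p) F}
    {K' : Matrix (Fin p') (Fin p') F} :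
    Equivalent μ (ofBox k K) (ofBox k K') ↔ MEq μ K K' := by
  rw [← BIso.box_iff (r := stripLT k) (lab := Empty.elim) (lab' := Empty.elim)]
  exact ⟨fun h => ((boxM_ofBox hμ K).trans hμ h).trans hμ ((boxM_ofBox hμ K').symm hμ),
    fun h => (((boxM_ofBox hμ K).symm hμ).trans hμ h).trans hμ (boxM_ofBox hμ K')⟩

include hμ in
theorem fromCols_ofBoxStrip {p m : ℕ} (K : Matrix (Fin p) (Fin p) F) {j : Fin t} (hj : j ≠ k)
    (E : Matrix (Fin p) (Fin m) F) :
    BIso μ (stripLT k) (fun _ : Fin m => ⟨j, hj⟩) Sigma.fst (fromCols K E)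
      (ofBoxStrip k K j E).boxFirst := by
  have hs : (ofBoxStrip k K j E).size j = m := (if_neg hj).trans (if_pos rfl)
  have hb : Function.Bijective (fun c : Fin m =>
      (⟨⟨j, hj⟩, Fin.cast hs.symm c⟩ : OuterCol (ofBoxStrip k K j E).size k)) := by
    constructor
    · intro c c' h
      simpa using h
    · rintro ⟨⟨i, hi⟩, a⟩
      by_cases hij : i = j
      · subst hij
        exact ⟨Fin.cast hs a, rfl⟩
      · exact (Fin.cast ((if_neg hi).trans (if_neg hij)) a).elim0
  refine BIso.of_equiv hμ (finCongr (if_pos rfl).symm) (Equiv.ofBijective _ hb) (fun _ => rfl) ?_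
  rintro a (b | c)
  · change (ofBoxStrip k K j E).strip k (Fin.cast (if_pos rfl).symm a)
      (Fin.cast (if_pos rfl).symm b) = K a b
    simp [ofBoxStrip]
  · change (ofBoxStrip k K j E).strip j (Fin.cast (if_pos rfl).symm a)
      (Fin.cast hs.symm c) = E a c
    simp [ofBoxStrip, hj]
    rfl

end Bangle

/-- The singular summands of a normal form. -/
def summandOf {s b : Type*} (lab : s → {i : Fin t // i ≠ k}) (q : s → ℕ) (qb : b → ℕ) :
    s ⊕ b → SingularSummand k :=
  Sum.elim (fun x => .strip (lab x).1 (lab x).2 (q x)) (fun y => .box (qb y + 1) (Nat.le_add_left _ _))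

open Bangle

include hμ in
theorem SingularSummand.exists_nf (x : SingularSummand k) :
    ∃ (s b : Type) (_ : Fintype s) (_ : Fintype b) (_ : DecidableEq s) (_ : DecidableEq b)
      (q : s → ℕ) (qb : b → ℕ) (lab : s → {i : Fin t // i ≠ k}),
      Finset.univ.val.map (summandOf lab q qb) = {x} ∧
      BIso μ (stripLT k) Sigma.fst lab (x.toBangle F).boxFirst
        (NF (0 : Matrix Empty Empty F) (Sum.elim q (fun y => qb y + 1))) := by
  rcases x with ⟨q, hq⟩ | ⟨j, hj, q⟩
  · obtain ⟨q, rfl⟩ : ∃ q', q = q' + 1 := ⟨q - 1, by omega⟩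
    refine ⟨Empty, Unit, inferInstance, inferInstance, inferInstance, inferInstance, Empty.elim,
      fun _ => q, Empty.elim, rfl, BIso.trans hμ ((boxM_ofBox hμ _).symm hμ) ?_⟩
    have hb : Function.Bijective (fun a : Fin (q + 1) => (.inr ⟨.inr (), a⟩ : Empty ⊕
        Σ x : Empty ⊕ Unit, Fin (Sum.elim (Empty.elim : Empty → ℕ) (fun _ => q + 1) x))) := by
      constructor
      · intro a a' h
        exact Fin.ext (sigma_fin_ext.1 (Sum.inr_injective h)).2
      · rintro (a | ⟨x | x, a⟩)
        · exact a.elim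
        · exact x.elim
        · exact ⟨a, rfl⟩
    refine BIso.of_equiv hμ (Equiv.ofBijective _ hb) (Equiv.refl _) (fun c => c.elim) ?_
    rintro a (b | c)
    · simp only [Equiv.ofBijective_apply, Sum.map_inl, NF, boxM, jordanJ, of_apply,
        fromCols_apply_inl, true_and]
      split_ifs <;> first | rfl | (exfalso; omega)
    · exact c.elim
  · refine ⟨Unit, Empty, inferInstance, inferInstance, inferInstance, inferInstance, fun _ => q,
      Empty.elim, fun _ => ⟨j, hj⟩, rfl, BIso.trans hμ ((fromCols_ofBoxStrip hμ _ hj _).symm hμ) ?_⟩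
    have hb : Function.Bijective (fun a : Fin q => (.inr ⟨.inl (), a⟩ : Empty ⊕
        Σ x : Unit ⊕ Empty, Fin (Sum.elim (fun _ => q) (fun y : Empty => Empty.elim y + 1) x))) := by
      constructor
      · intro a a' h
        exact Fin.ext (sigma_fin_ext.1 (Sum.inr_injective h)).2
      · rintro (a | ⟨x | x, a⟩)
        · exact a.elim
        · exact ⟨a, rfl⟩
        · exact x.elim
    refine BIso.of_equiv hμ (Equiv.ofBijective _ hb) (Equiv.ofUnique (Fin 1) Unit) (fun c => rfl) ?_
    rintro a (b | c)
    · simp only [Equiv.ofBijective_apply, Sum.map_inl, NF, jordanJ, of_apply,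
        fromCols_apply_inl, true_and]
      split_ifs <;> first | rfl | (exfalso; omega)
    · simp [NF, colE]

theorem map_summandOf_sum {s b s' b' : Type*} [Fintype s] [Fintype b] [Fintype s'] [Fintype b']
    (lab : s → {i : Fin t // i ≠ k}) (q : s → ℕ) (qb : b → ℕ)
    (lab' : s' → {i : Fin t // i ≠ k}) (q' : s' → ℕ) (qb' : b' → ℕ) :
    Finset.univ.val.map (summandOf (Sum.elim lab lab') (Sum.elim q q') (Sum.elim qb qb')) =
      Finset.univ.val.map (summandOf lab q qb) + Finset.univ.val.map (summandOf lab' q' qb') := by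
  rw [← map_univ_comp_equiv (Equiv.sumSumSumComm s b s' b'), map_univ_sum]
  congr 1
  · exact Multiset.map_congr rfl fun x _ => by rcases x with x | x <;> rfl
  · exact Multiset.map_congr rfl fun x _ => by rcases x with x | x <;> rfl

theorem sumLen_elim {s b s' b' : Type*} (q : s → ℕ) (qb : b → ℕ) (q' : s' → ℕ) (qb' : b' → ℕ) :
    sumLen (Sum.elim q (fun y => qb y + 1)) (Sum.elim q' (fun y => qb' y + 1)) =
      Sum.elim (Sum.elim q q') (fun y => Sum.elim qb qb' y + 1) := by
  funext x
  rcases x with (x | x) | (x | x) <;> rfl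

include hμ in
theorem singularPart_exists_nf (L : List (SingularSummand k)) :
    ∃ (s b : Type) (_ : Fintype s) (_ : Fintype b) (_ : DecidableEq s) (_ : DecidableEq b)
      (q : s → ℕ) (qb : b → ℕ) (lab : s → {i : Fin t // i ≠ k}),
      Finset.univ.val.map (summandOf lab q qb) = (L : Multiset (SingularSummand k)) ∧
      BIso μ (stripLT k) Sigma.fst lab (singularPart F L).boxFirst
        (NF (0 : Matrix Empty Empty F) (Sum.elim q (fun y => qb y + 1))) := by
  induction L with
  | nil =>
    refine ⟨Empty, Empty, inferInstance, inferInstance, inferInstance, inferInstance, Empty.elim,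
      Empty.elim, Empty.elim, rfl, ?_⟩
    have : IsEmpty (OuterCol (singularPart F (k := k) []).size k) :=
      ⟨fun p => Fin.elim0 p.2⟩
    have : IsEmpty (Fin ((singularPart F (k := k) []).size k)) := ⟨fun a => Fin.elim0 a⟩
    refine BIso.of_equiv hμ (Equiv.equivOfIsEmpty _ _) (Equiv.equivOfIsEmpty _ _)
      (fun c => Fin.elim0 c.2) (fun a => Fin.elim0 a)
  | cons x L ih =>
    obtain ⟨s, b, _, _, _, _, q, qb, lab, h1, h2⟩ := SingularSummand.exists_nf (F := F) hμ x
    obtain ⟨s', b', _, _, _, _, q', qb', lab', h3, h4⟩ := ih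
    refine ⟨s ⊕ s', b ⊕ b', inferInstance, inferInstance, inferInstance, inferInstance,
      Sum.elim q q', Sum.elim qb qb', Sum.elim lab lab', ?_, ?_⟩
    · rw [map_summandOf_sum, h1, h3]
      rfl
    · have h5 := ((bsum_dsum hμ _ _).symm hμ).trans hμ (BIso.sum hμ h2 h4)
      have h6 := h5.trans hμ (BIso.nf_sum hμ _ _ _ _ _ _)
      rw [sumLen_elim] at h6
      exact h6.trans hμ (BIso.nf_congr hμ (Equiv.sumEmpty Empty Empty)
        (fun p => isEmptyElim p) _ _)

include hμ in
theorem RegularizedForm.exists_nf (R : RegularizedForm F k) :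
    ∃ (s b : Type) (_ : Fintype s) (_ : Fintype b) (_ : DecidableEq s) (_ : DecidableEq b)
      (q : s → ℕ) (qb : b → ℕ) (lab : s → {i : Fin t // i ≠ k}),
      Finset.univ.val.map (summandOf lab q qb) = (R.sing : Multiset (SingularSummand k)) ∧
      BIso μ (stripLT k) Sigma.fst lab R.toBangle.boxFirst
        (NF R.K (Sum.elim q (fun y => qb y + 1))) := by
  obtain ⟨s, b, _, _, _, _, q, qb, lab, h1, h2⟩ := singularPart_exists_nf (F := F) hμ R.sing
  refine ⟨s, b, inferInstance, inferInstance, inferInstance, inferInstance, q, qb, lab, h1, ?_⟩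
  have h3 := ((boxM_ofBox (k := k) hμ R.K).symm hμ).trans hμ
    ((BIso.mod_empty hμ (s := Empty) (b := Empty) R.K (Sum.elim Empty.elim fun y => Empty.elim y + 1)
      Empty.elim Empty.elim).symm hμ)
  have h5 := ((bsum_dsum hμ _ _).symm hμ).trans hμ (BIso.sum hμ h3 h2)
  have h6 := h5.trans hμ (BIso.nf_sum hμ _ _ _ _ _ _)
  rw [sumLen_elim] at h6
  have h7 := h6.trans hμ (BIso.nf_congr hμ (K' := R.K) (Equiv.sumEmpty (Fin R.p) Empty)
    (by rintro (p | p) (p' | p') <;> first | rfl | exact isEmptyElim p | exact isEmptyElim p') _ _)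
  refine h7.trans hμ (BIso.mod_reindex hμ _ (Equiv.emptySum Empty s) (Equiv.emptySum Empty b) ?_ ?_)
  · rintro ((x | x) | (x | x)) <;> first | rfl | exact isEmptyElim x
  · rintro (x | x) <;> first | rfl | exact isEmptyElim x

theorem strip_data {s b s' b' : Type*} [Fintype s] [Fintype b] [Fintype s'] [Fintype b']
    {lab : s → {i : Fin t // i ≠ k}} {q : s → ℕ} {qb : b → ℕ}
    {lab' : s' → {i : Fin t // i ≠ k}} {q' : s' → ℕ} {qb' : b' → ℕ} :
    Finset.univ.val.map (summandOf lab q qb) = Finset.univ.val.map (summandOf lab' q' qb') ↔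
      Finset.univ.val.map (fun x => (lab x, q x)) = Finset.univ.val.map (fun x => (lab' x, q' x)) ∧
      Finset.univ.val.map qb = Finset.univ.val.map qb' := by
  constructor
  · intro h
    constructor
    · have := congrArg (Multiset.filterMap (fun z : SingularSummand k => match z with
        | .box _ _ => none
        | .strip j hj q => some ((⟨j, hj⟩ : {i : Fin t // i ≠ k}), q))) h
      rwa [filterMap_univ_sum_inl (g := fun x => (lab x, q x)) (fun _ => rfl) (fun _ => rfl),
        filterMap_univ_sum_inl (g := fun x => (lab' x, q' x)) (fun _ => rfl) (fun _ => rfl)] at this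
    · have := congrArg (Multiset.filterMap (fun z : SingularSummand k => match z with
        | .box q _ => some (q - 1)
        | .strip _ _ _ => none)) h
      rwa [filterMap_univ_sum_inr (g := qb) (fun _ => rfl) (fun _ => rfl),
        filterMap_univ_sum_inr (g := qb') (fun _ => rfl) (fun _ => rfl)] at this
  · rintro ⟨h1, h2⟩
    rw [map_univ_sum, map_univ_sum]
    congr 1
    · exact map_eq_map_of_map_eq_map h1 fun z => SingularSummand.strip z.1.1 z.1.2 z.2
    · exact map_eq_map_of_map_eq_map h2 fun z => SingularSummand.box (z + 1) (Nat.le_add_left _ _)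

include hμ in
theorem BIso.nf_of_data {P s b s' b' : Type*} [Fintype P] [DecidableEq P] [Fintype s] [Fintype b]
    [Fintype s'] [Fintype b'] [DecidableEq s] [DecidableEq b] [DecidableEq s'] [DecidableEq b']
    (K : Matrix P P F) {lab : s → {i : Fin t // i ≠ k}} {q : s → ℕ} {qb : b → ℕ}
    {lab' : s' → {i : Fin t // i ≠ k}} {q' : s' → ℕ} {qb' : b' → ℕ}
    (h : Finset.univ.val.map (summandOf lab q qb) = Finset.univ.val.map (summandOf lab' q' qb')) :
    BIso μ (stripLT k) lab lab' (NF K (Sum.elim q (fun y => qb y + 1)))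
      (NF K (Sum.elim q' (fun y => qb' y + 1))) := by
  obtain ⟨h1, h2⟩ := strip_data.1 h
  obtain ⟨es, hes⟩ := exists_equiv_of_map_univ_eq h1
  obtain ⟨eb, heb⟩ := exists_equiv_of_map_univ_eq h2
  refine BIso.mod_reindex hμ K es eb ?_ fun c => (Prod.ext_iff.1 (hes c)).1
  rintro (x | x)
  · exact (Prod.ext_iff.1 (hes x)).2
  · exact congrArg (· + 1) (heb x)

include hμ in
theorem singularPart_perm {L L' : List (SingularSummand k)} (h : L.Perm L') :
    Equivalent μ (singularPart F L) (singularPart F L') := by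
  obtain ⟨s, b, _, _, _, _, q, qb, lab, h1, h2⟩ := singularPart_exists_nf (F := F) hμ L
  obtain ⟨s', b', _, _, _, _, q', qb', lab', h3, h4⟩ := singularPart_exists_nf (F := F) hμ L'
  refine (h2.trans hμ (BIso.nf_of_data hμ _ ?_)).trans hμ (h4.symm hμ)
  rw [h1, h3]
  exact Multiset.coe_eq_coe.2 h

include hμ in
/-- The existence of regularizing decompositions. -/
theorem exists_regularizedForm (A : Bangle F k) :
    ∃ R : RegularizedForm F k, Equivalent μ A R.toBangle := by
  obtain ⟨P, s, b, _, _, _, _, _, _, K, K', q, qb, lab, hK, hK', h⟩ :=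
    _root_.exists_nf hμ (r := stripLT k) _ (Sigma.fst : OuterCol A.size k → _) A.boxFirst le_rfl
  let e := Fintype.equivFin P
  have h1 : K.submatrix e.symm e.symm * K'.submatrix e.symm e.symm = 1 := by
    rw [submatrix_mul_equiv, hK, submatrix_one_equiv]
  let R : RegularizedForm F k := ⟨Fintype.card P, K.submatrix e.symm e.symm,
    ⟨⟨_, _, h1, mul_eq_one_comm.1 h1⟩, rfl⟩,
    (Finset.univ.val.map (summandOf lab q qb)).toList⟩
  obtain ⟨s', b', _, _, _, _, q', qb', lab', h3, h4⟩ := RegularizedForm.exists_nf hμ R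
  refine ⟨R, (h.trans hμ ?_).trans hμ (h4.symm hμ)⟩
  refine (BIso.nf_congr hμ (K' := R.K) e (fun p p' => by simp [R]) _ _).trans hμ
    (BIso.nf_of_data hμ _ ?_)
  rw [h3, Multiset.coe_toList]

include hμ in
/-- The uniqueness of regularizing decompositions. -/
theorem regularizedForm_unique {R R' : RegularizedForm F k}
    (h : Equivalent μ R.toBangle R'.toBangle) : MEq μ R.K R'.K ∧ R.sing.Perm R'.sing := by
  obtain ⟨s, b, _, _, _, _, q, qb, lab, h1, h2⟩ := RegularizedForm.exists_nf hμ R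
  obtain ⟨s', b', _, _, _, _, q', qb', lab', h3, h4⟩ := RegularizedForm.exists_nf hμ R'
  obtain ⟨K₁, hK₁⟩ := R.nonsingular.exists_right_inv
  obtain ⟨K₁', hK₁'⟩ := R'.nonsingular.exists_right_inv
  have hb : ∀ {α : Type} [Fintype α] (f : α → ℕ) (x : α), f x ≤ ∑ x, f x := fun f x =>
    Finset.single_le_sum (fun _ _ => Nat.zero_le _) (Finset.mem_univ x)
  obtain ⟨h5, h6⟩ := nf_unique hμ ((∑ x, q x) + (∑ x, q' x) + (∑ x, qb x) + (∑ x, qb' x) + 2)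
    hK₁ hK₁' (fun x => by have := hb q x; omega) (fun x => by have := hb q' x; omega)
    (fun x => by have := hb qb x; omega) (fun x => by have := hb qb' x; omega)
    (((h2.symm hμ).trans hμ h).trans hμ h4)
  refine ⟨h5, ?_⟩
  rw [← Multiset.coe_eq_coe, ← h1, ← h3]
  exact strip_data.2 h6

end Parts

/-! ### Reduction of the canonical forms to matrices -/

section MEq

variable {F : Type*} [DivisionRing F] {μ : Option (F → F)} (hμ : ModeOK μ)
  {m n l m' n' : Type*} [Fintype m] [Fintype n] [Fintype l] [Fintype m'] [Fintype n']
  [DecidableEq m] [DecidableEq n] [DecidableEq l] [DecidableEq m'] [DecidableEq n']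

include hμ in
theorem MEq.symm {K : Matrix m m F} {K' : Matrix n n F} (h : MEq μ K K') : MEq μ K' K := by
  obtain ⟨S, S', h1, h2, e⟩ := h
  refine ⟨S', S, h2, h1, ?_⟩
  calc K' * S' = (tw μ S' S * tw μ S S') * K' * S' := by rw [tw_inv hμ h2, Matrix.one_mul]
    _ = tw μ S' S * (K * S) * S' := by rw [e]; simp only [Matrix.mul_assoc]
    _ = tw μ S' S * K := by rw [Matrix.mul_assoc, Matrix.mul_assoc K, h1, Matrix.mul_one]

include hμ in
theorem MEq.trans {K : Matrix m m F} {K' : Matrix n n F} {K'' : Matrix l l F} (h : MEq μ K K')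
    (h' : MEq μ K' K'') : MEq μ K K'' := by
  obtain ⟨S, S', h1, h2, e⟩ := h
  obtain ⟨T, T', h3, h4, e'⟩ := h'
  refine ⟨S * T, T' * S', ?_, ?_, ?_⟩
  · rw [Matrix.mul_assoc, ← Matrix.mul_assoc T, h3, Matrix.one_mul, h1]
  · rw [Matrix.mul_assoc, ← Matrix.mul_assoc S', h2, Matrix.one_mul, h4]
  · rw [tw_mul hμ, ← Matrix.mul_assoc, e, Matrix.mul_assoc, e', Matrix.mul_assoc]

include hμ in
theorem MEq.of_equiv {K : Matrix m m F} {K' : Matrix n n F} (e : m ≃ n)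
    (h : ∀ i j, K' (e i) (e j) = K i j) : MEq μ K K' := by
  have : IsStrictTotalOrder (Option Empty)
      (fun _ _ => False : Option Empty → Option Empty → Prop) :=
    { trichotomous := fun a b _ _ => Subsingleton.elim a b, irrefl := fun _ => id,
      trans := fun _ _ _ h => h.elim }
  have := BIso.of_equiv hμ (r := (fun _ _ => False : Option Empty → Option Empty → Prop))
    (lab := Empty.elim) (lab' := Empty.elim)
    (M := boxM Empty K) (M' := boxM Empty K') e (Equiv.refl _) (fun c => c.elim)
    (by rintro i (j | c) <;> [exact h i j; exact c.elim])
  exact BIso.box_iff.1 this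

include hμ in
theorem MEq.refl (K : Matrix m m F) : MEq μ K K := MEq.of_equiv hμ (Equiv.refl _) fun _ _ => rfl

include hμ in
theorem MEq.sum {K : Matrix m m F} {K' : Matrix n n F} {L : Matrix m' m' F}
    {L' : Matrix n' n' F} (h : MEq μ K K') (h' : MEq μ L L') :
    MEq μ (fromBlocks K 0 0 L) (fromBlocks K' 0 0 L') := by
  obtain ⟨S, S', h1, h2, e⟩ := h
  obtain ⟨T, T', h3, h4, e'⟩ := h'
  refine ⟨Matrix.fromBlocks S 0 0 T, Matrix.fromBlocks S' 0 0 T', ?_, ?_, ?_⟩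
  · simp [fromBlocks_multiply, h1, h3]
  · simp [fromBlocks_multiply, h2, h4]
  · rw [tw_fromBlocks_diag hμ]
    simp [fromBlocks_multiply, e, e']

end MEq

section Reduction

variable {F : Type*} [DivisionRing F] {t : ℕ} {k : Fin t} {μ : Option (F → F)} (hμ : ModeOK μ)

/-- A square matrix together with its size. -/
abbrev SqMat (F : Type*) : Type _ := Σ n : ℕ, Matrix (Fin n) (Fin n) F

/-- The block-diagonal sum of a list of square matrices. -/
def dsumMat {F : Type*} [Zero F] (L : List (SqMat F)) : SqMat F :=
  L.foldr (fun A B => ⟨A.1 + B.1, Matrix.reindex finSumFinEquiv finSumFinEquiv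
    (Matrix.fromBlocks A.2 0 0 B.2)⟩) ⟨0, 0⟩

include hμ in
theorem MEq.dsumMat_cons (A : SqMat F) (L : List (SqMat F)) :
    MEq μ (fromBlocks A.2 0 0 (dsumMat L).2) (dsumMat (A :: L)).2 :=
  MEq.of_equiv hμ finSumFinEquiv fun i j => by
    change Matrix.reindex finSumFinEquiv finSumFinEquiv (fromBlocks A.2 0 0 (dsumMat L).2)
      (finSumFinEquiv i) (finSumFinEquiv j) = _
    rw [reindex_apply, submatrix_apply, Equiv.symm_apply_apply, Equiv.symm_apply_apply]

theorem isUnit_dsumMat (L : List (SqMat F)) (h : ∀ A ∈ L, IsUnit A.2) : IsUnit (dsumMat L).2 := by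
  induction L with
  | nil => exact ⟨⟨_, 1, Subsingleton.elim (α := Matrix (Fin 0) (Fin 0) F) _ _,
      Subsingleton.elim (α := Matrix (Fin 0) (Fin 0) F) _ _⟩, rfl⟩
  | cons A L ih =>
    obtain ⟨X, hX⟩ := (h A (by simp)).exists_right_inv
    obtain ⟨Y, hY⟩ := (ih fun B hB => h B (by simp [hB])).exists_right_inv
    have : Matrix.reindex finSumFinEquiv finSumFinEquiv
        (Matrix.fromBlocks A.2 0 0 (dsumMat L).2) * Matrix.reindex finSumFinEquiv finSumFinEquiv
        (Matrix.fromBlocks X 0 0 Y) = 1 := by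
      simp only [reindex_apply, submatrix_mul_equiv, fromBlocks_multiply]
      simp [hX, hY]
    exact (⟨⟨_, _, this, mul_eq_one_comm.1 this⟩, rfl⟩ : IsUnit (Matrix.reindex finSumFinEquiv
      finSumFinEquiv (Matrix.fromBlocks A.2 0 0 (dsumMat L).2)))

open Bangle

include hμ in
theorem Bangle.ofBox_dsum {p p' : ℕ} (K : Matrix (Fin p) (Fin p) F) (K' : Matrix (Fin p') (Fin p') F) :
    Equivalent μ ((ofBox k K).dsum (ofBox k K')) (ofBox k (Matrix.reindex finSumFinEquiv
      finSumFinEquiv (Matrix.fromBlocks K 0 0 K'))) := by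
  have h1 := ((bsum_dsum (k := k) hμ _ _).symm hμ).trans hμ
    (BIso.sum hμ ((boxM_ofBox hμ K).symm hμ) ((boxM_ofBox hμ K').symm hμ))
  refine (h1.trans hμ ?_).trans hμ (boxM_ofBox hμ _)
  refine BIso.of_equiv hμ finSumFinEquiv (Equiv.sumEmpty Empty Empty) (fun c => isEmptyElim c) ?_
  rintro (a | a) ((b | b) | c)
  all_goals first
    | (simp [boxM, bsum]; done)
    | exact isEmptyElim c

include hμ in
theorem Bangle.dsumList_ofBox (L : List (SqMat F)) :
    Equivalent μ (dsumList (L.map fun A => ofBox k A.2)) (ofBox k (dsumMat L).2) := by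
  induction L with
  | nil =>
    have : IsEmpty (OuterCol (ofBox k (dsumMat ([] : List (SqMat F))).2).size k) := ⟨by
      rintro ⟨⟨i, hi⟩, a⟩
      exact (Fin.cast (if_neg hi) a).elim0⟩
    have : IsEmpty (Fin ((ofBox k (dsumMat ([] : List (SqMat F))).2).size k)) :=
      ⟨fun a => (Fin.cast (if_pos rfl) a).elim0⟩
    have : IsEmpty (OuterCol (dsumList (([] : List (SqMat F)).map fun A => ofBox k A.2)).size k) :=
      ⟨fun p => Fin.elim0 p.2⟩
    have : IsEmpty (Fin ((dsumList (([] : List (SqMat F)).map fun A => ofBox k A.2)).size k)) :=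
      ⟨fun a => Fin.elim0 a⟩
    exact BIso.of_equiv hμ (Equiv.equivOfIsEmpty _ _) (Equiv.equivOfIsEmpty _ _)
      (fun c => isEmptyElim c) (fun a => isEmptyElim a)
  | cons A L ih => exact ((Equivalent.refl hμ _).dsum hμ ih).trans hμ (ofBox_dsum hμ _ _)

include hμ in
/-- Canonical forms of nonsingular matrices give canonical forms of bangles. -/
theorem exists_canonical_form {β : Type*} (f : β → SqMat F) (hf : ∀ b, IsUnit (f b).2)
    (E : List β → List β → Prop)
    (hex : ∀ (n : ℕ) (K : Matrix (Fin n) (Fin n) F), IsUnit K →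
      ∃ Ks : List β, MEq μ K (dsumMat (Ks.map f)).2)
    (hun : ∀ Ks Ks' : List β, MEq μ (dsumMat (Ks.map f)).2 (dsumMat (Ks'.map f)).2 ↔ E Ks Ks')
    {A : Bangle F k} {R : RegularizedForm F k} (hR : Equivalent μ A R.toBangle) :
    ∃ Ks : List β, Equivalent μ R.regPart (dsumList (Ks.map fun b => ofBox k (f b).2)) ∧
      Equivalent μ A ((dsumList (Ks.map fun b => ofBox k (f b).2)).dsum (singularPart F R.sing)) ∧
      ∀ (Ks' : List β) (L' : List (SingularSummand k)),
        Equivalent μ A ((dsumList (Ks'.map fun b => ofBox k (f b).2)).dsum (singularPart F L')) ↔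
          E Ks Ks' ∧ R.sing.Perm L' := by
  obtain ⟨Ks, hKs⟩ := hex R.p R.K R.nonsingular
  have hl : ∀ Ks : List β, Equivalent μ (dsumList (Ks.map fun b => ofBox k (f b).2))
      (ofBox k (dsumMat (Ks.map f)).2) := fun Ks => by
    have := Bangle.dsumList_ofBox (k := k) hμ (Ks.map f)
    rwa [List.map_map] at this
  have hreg : Equivalent μ R.regPart (dsumList (Ks.map fun b => ofBox k (f b).2)) :=
    ((ofBox_equivalent_iff hμ).2 hKs).trans hμ ((hl Ks).symm hμ)
  have hA : Equivalent μ A ((dsumList (Ks.map fun b => ofBox k (f b).2)).dsum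
      (singularPart F R.sing)) := hR.trans hμ (hreg.dsum hμ (Equivalent.refl hμ _))
  refine ⟨Ks, hreg, hA, fun Ks' L' => ⟨fun h => ?_, fun h => ?_⟩⟩
  · let R' : RegularizedForm F k := ⟨_, (dsumMat (Ks'.map f)).2,
      isUnit_dsumMat _ (by simp only [List.mem_map]; rintro _ ⟨b, -, rfl⟩; exact hf b), L'⟩
    have h1 : Equivalent μ R.toBangle R'.toBangle :=
      ((hR.symm hμ).trans hμ h).trans hμ ((hl Ks').dsum hμ (Equivalent.refl hμ _))
    obtain ⟨h2, h3⟩ := regularizedForm_unique hμ h1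
    exact ⟨(hun _ _).1 ((hKs.symm hμ).trans hμ h2), h3⟩
  · refine hA.trans hμ (Equivalent.dsum hμ ?_ (singularPart_perm hμ h.2))
    exact ((hl Ks).trans hμ ((ofBox_equivalent_iff hμ).2 ((hun _ _).2 h.1))).trans hμ
      ((hl Ks').symm hμ)

end Reduction

/-! ### The splitting of a square matrix into a nonsingular and a nilpotent part -/

section Fitting

variable {F : Type*} [DivisionRing F] {μ : Option (F → F)} (hμ : ModeOK μ)

theorem modeOK_none {F : Type*} [Ring F] : ModeOK (none : Option (F → F)) := by rintro _ ⟨⟩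

theorem modeOK_some {F : Type*} [Ring F] {σ : F → F} (hσ : IsRingInvolution σ) :
    ModeOK (some σ) := by rintro _ ⟨⟩; exact hσ

/-- The direct sum of the nilpotent Jordan blocks of given sizes. -/
def nilSum (F : Type*) [Zero F] [One F] (L : List ℕ) : SqMat F :=
  dsumMat (L.map fun q => ⟨q, jordanJ q 0⟩)

open Bangle

include hμ in
theorem singularPart_map_box (L : List ℕ) (hL : ∀ q ∈ L, 1 ≤ q) :
    ∃ L' : List (SingularSummand (0 : Fin 1)),
      L'.map (fun x => match x with | .box q _ => q | .strip _ _ q => q) = L ∧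
      Equivalent μ (singularPart F L') (ofBox 0 (nilSum F L).2) := by
  have h : ∃ L' : List (SingularSummand (0 : Fin 1)),
      L'.map (fun x => match x with | .box q _ => q | .strip _ _ q => q) = L ∧
      L'.map (SingularSummand.toBangle F) =
        (L.map fun q => (⟨q, jordanJ q 0⟩ : SqMat F)).map fun A => ofBox 0 A.2 := by
    induction L with
    | nil => exact ⟨[], rfl, rfl⟩
    | cons q L ih =>
      obtain ⟨L', h1, h2⟩ := ih fun x hx => hL x (by simp [hx])
      exact ⟨.box q (hL q (by simp)) :: L', by simp [h1], by
        rw [List.map_cons, h2]; rfl⟩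
  obtain ⟨L', h1, h2⟩ := h
  refine ⟨L', h1, ?_⟩
  rw [singularPart, h2]
  exact dsumList_ofBox hμ _

theorem exists_map_box (L' : List (SingularSummand (0 : Fin 1))) :
    ∃ L : List ℕ, (∀ q ∈ L, 1 ≤ q) ∧ L'.map (SingularSummand.toBangle F) =
        (L.map fun q => (⟨q, jordanJ q 0⟩ : SqMat F)).map fun A => ofBox 0 A.2 := by
  induction L' with
  | nil => exact ⟨[], by simp, rfl⟩
  | cons x L' ih =>
    obtain ⟨L, h1, h2⟩ := ih
    rcases x with ⟨q, hq⟩ | ⟨j, hj, q⟩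
    · exact ⟨q :: L, by simpa [hq] using h1, by rw [List.map_cons, h2]; rfl⟩
    · exact absurd (Subsingleton.elim j 0) hj

include hμ in
theorem exists_fitting {n : ℕ} (A : Matrix (Fin n) (Fin n) F) :
    ∃ (p : ℕ) (K : Matrix (Fin p) (Fin p) F) (L : List ℕ), IsUnit K ∧ (∀ q ∈ L, 1 ≤ q) ∧
      MEq μ A (fromBlocks K 0 0 (nilSum F L).2) := by
  obtain ⟨R, hR⟩ := exists_regularizedForm hμ (ofBox (0 : Fin 1) A)
  obtain ⟨L, hL, h⟩ := exists_map_box (F := F) R.sing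
  refine ⟨R.p, R.K, L, R.nonsingular, hL, ?_⟩
  have h1 : Equivalent μ (singularPart F R.sing) (ofBox 0 (nilSum F L).2) := by
    rw [singularPart, h]
    exact dsumList_ofBox hμ _
  have h2 := (hR.trans hμ ((Equivalent.refl hμ _).dsum hμ h1)).trans hμ (ofBox_dsum hμ _ _)
  refine ((ofBox_equivalent_iff hμ).1 h2).trans hμ (MEq.symm hμ ?_)
  exact MEq.of_equiv hμ finSumFinEquiv fun i j => by simp

include hμ in
theorem fitting_unique {p p' : ℕ} {K : Matrix (Fin p) (Fin p) F} {K' : Matrix (Fin p') (Fin p') F}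
    {L L' : List ℕ} (hK : IsUnit K) (hK' : IsUnit K') (hL : ∀ q ∈ L, 1 ≤ q) (hL' : ∀ q ∈ L', 1 ≤ q)
    (h : MEq μ (fromBlocks K 0 0 (nilSum F L).2) (fromBlocks K' 0 0 (nilSum F L').2)) :
    MEq μ K K' ∧ L.Perm L' := by
  obtain ⟨M, h1, h2⟩ := singularPart_map_box hμ L hL
  obtain ⟨M', h1', h2'⟩ := singularPart_map_box hμ L' hL'
  let R : RegularizedForm F (0 : Fin 1) := ⟨p, K, hK, M⟩
  let R' : RegularizedForm F (0 : Fin 1) := ⟨p', K', hK', M'⟩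
  have h3 : MEq μ (Matrix.reindex finSumFinEquiv finSumFinEquiv (fromBlocks K 0 0 (nilSum F L).2))
      (Matrix.reindex finSumFinEquiv finSumFinEquiv (fromBlocks K' 0 0 (nilSum F L').2)) :=
    ((MEq.of_equiv hμ finSumFinEquiv fun i j => by simp).symm hμ).trans hμ
      (h.trans hμ (MEq.of_equiv hμ finSumFinEquiv fun i j => by simp))
  have h4 : ∀ {p : ℕ} (K : Matrix (Fin p) (Fin p) F) (L : List ℕ)
      (M : List (SingularSummand (0 : Fin 1))),
      Equivalent μ (singularPart F M) (ofBox 0 (nilSum F L).2) →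
      Equivalent μ ((ofBox 0 K).dsum (singularPart F M)) (ofBox 0 (Matrix.reindex finSumFinEquiv
        finSumFinEquiv (fromBlocks K 0 0 (nilSum F L).2))) := fun K L M h =>
    ((Equivalent.refl hμ _).dsum hμ h).trans hμ (ofBox_dsum hμ _ _)
  have h5 : Equivalent μ R.toBangle R'.toBangle :=
    ((h4 K L M h2).trans hμ ((ofBox_equivalent_iff hμ).2 h3)).trans hμ ((h4 K' L' M' h2').symm hμ)
  obtain ⟨h6, h7⟩ := regularizedForm_unique hμ h5
  refine ⟨h6, ?_⟩
  rw [← h1, ← h1']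
  exact h7.map _

end Fitting

section DsumPerm

variable {F : Type*} [DivisionRing F] {μ : Option (F → F)} (hμ : ModeOK μ)

include hμ in
theorem MEq.dsumMat_perm {L L' : List (SqMat F)} (h : L.Perm L') :
    MEq μ (dsumMat L).2 (dsumMat L').2 := by
  induction h with
  | nil => exact MEq.refl hμ _
  | cons A _ ih =>
    exact ((MEq.dsumMat_cons hμ A _).symm hμ).trans hμ
      (((MEq.refl hμ A.2).sum hμ ih).trans hμ (MEq.dsumMat_cons hμ A _))
  | swap A B L =>
    have h1 : ∀ A B : SqMat F, MEq μ (fromBlocks A.2 0 0 (fromBlocks B.2 0 0 (dsumMat L).2))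
        (dsumMat (A :: B :: L)).2 := fun A B =>
      ((MEq.refl hμ A.2).sum hμ (MEq.dsumMat_cons hμ B L)).trans hμ (MEq.dsumMat_cons hμ A _)
    refine ((h1 B A).symm hμ).trans hμ (MEq.trans hμ ?_ (h1 A B))
    refine MEq.of_equiv hμ ((Equiv.sumAssoc _ _ _).symm.trans
      ((Equiv.sumCongr (Equiv.sumComm _ _) (Equiv.refl _)).trans (Equiv.sumAssoc _ _ _))) ?_
    rintro (i | i | i) (j | j | j) <;> rfl
  | trans _ _ ih ih' => exact ih.trans hμ ih'

theorem isEmpty_dsumMat_nil : IsEmpty (Fin (dsumMat ([] : List (SqMat F))).1) :=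
  ⟨fun a => Fin.elim0 a⟩

include hμ in
theorem MEq.of_isEmpty {m n : Type*} [Fintype m] [Fintype n] [DecidableEq m] [DecidableEq n]
    [IsEmpty m] [IsEmpty n] (A : Matrix m m F) (B : Matrix n n F) : MEq μ A B :=
  MEq.of_equiv hμ (Equiv.equivOfIsEmpty m n) fun i => isEmptyElim i

include hμ in
theorem MEq.dsumMat_append (L L' : List (SqMat F)) :
    MEq μ (fromBlocks (dsumMat L).2 0 0 (dsumMat L').2) (dsumMat (L ++ L')).2 := by
  induction L with
  | nil =>
    have := isEmpty_dsumMat_nil (F := F)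
    refine MEq.of_equiv hμ (Equiv.emptySum (Fin (dsumMat ([] : List (SqMat F))).1) _) ?_
    rintro (i | i) (j | j) <;> first | exact (IsEmpty.false i).elim | exact (IsEmpty.false j).elim | rfl
  | cons A L ih =>
    refine MEq.trans hμ (((MEq.dsumMat_cons hμ A L).symm hμ).sum hμ (MEq.refl hμ (dsumMat L').2)) ?_
    refine MEq.trans hμ ?_ (((MEq.refl hμ A.2).sum hμ ih).trans hμ (MEq.dsumMat_cons hμ A (L ++ L')))
    refine MEq.of_equiv hμ (Equiv.sumAssoc _ _ _) ?_
    rintro ((i | i) | i) ((j | j) | j) <;> rfl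

theorem MEq.card_eq {m n : Type*} [Fintype m] [Fintype n] [DecidableEq m] [DecidableEq n]
    {A : Matrix m m F} {B : Matrix n n F} (h : MEq μ A B) : Fintype.card m = Fintype.card n := by
  obtain ⟨S, S', h1, h2, -⟩ := h
  exact card_eq_of_mul_eq_one h1 h2

include hμ in
theorem MEq.isUnit {m n : Type*} [Fintype m] [Fintype n] [DecidableEq m] [DecidableEq n]
    {A : Matrix m m F} {B : Matrix n n F} (h : MEq μ A B) (hB : IsUnit B) : IsUnit A := by
  obtain ⟨S, S', h1, h2, e⟩ := h
  obtain ⟨B', hB'⟩ := hB.exists_right_inv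
  have h3 := tw_inv hμ h1
  have : A * (S * B' * tw μ S' S) = 1 := by
    rw [← Matrix.mul_assoc, ← Matrix.mul_assoc, e, Matrix.mul_assoc (tw μ S S'), hB',
      Matrix.mul_one, h3]
  exact ⟨⟨_, _, this, mul_eq_one_comm.1 this⟩, rfl⟩

theorem isUnit_fromBlocks {m n : Type*} [Fintype m] [Fintype n] [DecidableEq m] [DecidableEq n]
    {A : Matrix m m F} {B : Matrix n n F} (hA : IsUnit A) (hB : IsUnit B) :
    IsUnit (fromBlocks A 0 0 B) := by
  obtain ⟨A', hA'⟩ := hA.exists_right_inv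
  obtain ⟨B', hB'⟩ := hB.exists_right_inv
  have : fromBlocks A 0 0 B * fromBlocks A' 0 0 B' = 1 := by
    simp [fromBlocks_multiply, hA', hB']
  exact ⟨⟨_, _, this, mul_eq_one_comm.1 this⟩, rfl⟩

theorem isUnit_of_isEmpty {m : Type*} [Fintype m] [DecidableEq m] [IsEmpty m] (A : Matrix m m F) :
    IsUnit A :=
  ⟨⟨A, 1, Subsingleton.elim _ _, Subsingleton.elim _ _⟩, rfl⟩

end DsumPerm

/-! ### Jordan canonical form -/

section Jordan

theorem MEq.shift {m n : Type*} [Fintype m] [Fintype n] [DecidableEq m] [DecidableEq n]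
    {A : Matrix m m ℂ} {B : Matrix n n ℂ} (h : MEq none A B) (c : ℂ) :
    MEq none (A + c • 1) (B + c • 1) := by
  obtain ⟨S, S', h1, h2, e⟩ := h
  refine ⟨S, S', h1, h2, ?_⟩
  simp only [tw] at e ⊢
  rw [Matrix.add_mul, Matrix.mul_add, e]
  simp

theorem jordanJ_shift (n : ℕ) (a c : ℂ) : jordanJ n a + c • 1 = jordanJ n (a + c) := by
  ext i j
  by_cases h : i = j
  · simp [jordanJ, h]
  · simp [jordanJ, h, Matrix.one_apply]

theorem fromBlocks_shift {m n : Type*} [DecidableEq m] [DecidableEq n] (A : Matrix m m ℂ)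
    (B : Matrix n n ℂ) (c : ℂ) :
    fromBlocks A 0 0 B + c • 1 = fromBlocks (A + c • 1) 0 0 (B + c • 1) := by
  rw [← fromBlocks_one, fromBlocks_smul, fromBlocks_add]
  simp

theorem jordanJ_isUnit {n : ℕ} {a : ℂ} (ha : a ≠ 0) : IsUnit (jordanJ n a) := by
  have h : (jordanJ n a).BlockTriangular id := by
    intro i j hij
    have : j.val < i.val := hij
    simp only [jordanJ, of_apply]
    rw [if_neg (by rintro rfl; omega), if_neg (by omega)]
  rw [Matrix.isUnit_iff_isUnit_det, Matrix.det_of_isUpperTriangular h]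
  simp [jordanJ, ha]

/-- The direct sum of the Jordan blocks with given sizes and eigenvalues. -/
noncomputable def jordanSum (L : List (ℕ × ℂ)) : SqMat ℂ :=
  dsumMat (L.map fun x => ⟨x.1, jordanJ x.1 x.2⟩)

/-- `HasJordan C D` says that `C` is similar to the direct sum of the Jordan blocks whose sizes
and eigenvalues are listed in the multiset `D`. -/
def HasJordan {m : Type} [Fintype m] [DecidableEq m] (C : Matrix m m ℂ)
    (D : Multiset (ℕ × ℂ)) : Prop :=
  (∀ x ∈ D, 1 ≤ x.1) ∧ ∃ L : List (ℕ × ℂ), (L : Multiset (ℕ × ℂ)) = D ∧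
    MEq none C (jordanSum L).2

variable {m n : Type} [Fintype m] [Fintype n] [DecidableEq m] [DecidableEq n]
  {C : Matrix m m ℂ} {C' : Matrix n n ℂ} {D D' : Multiset (ℕ × ℂ)}

theorem HasJordan.of_mEq (h : MEq none C C') (h' : HasJordan C' D) : HasJordan C D := by
  obtain ⟨h1, L, h2, h3⟩ := h'
  exact ⟨h1, L, h2, h.trans modeOK_none h3⟩

theorem HasJordan.mEq (h : HasJordan C D) (h' : HasJordan C' D) : MEq none C C' := by
  obtain ⟨h1, L, h2, h3⟩ := h
  obtain ⟨h1', L', h2', h3'⟩ := h'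
  refine (h3.trans modeOK_none (MEq.dsumMat_perm modeOK_none ?_)).trans modeOK_none
    (h3'.symm modeOK_none)
  exact List.Perm.map _ (Multiset.coe_eq_coe.1 (h2.trans h2'.symm))

theorem HasJordan.sum (h : HasJordan C D) (h' : HasJordan C' D') :
    HasJordan (fromBlocks C 0 0 C') (D + D') := by
  obtain ⟨h1, L, h2, h3⟩ := h
  obtain ⟨h1', L', h2', h3'⟩ := h'
  refine ⟨fun x hx => (Multiset.mem_add.1 hx).elim (h1 x) (h1' x), L ++ L', ?_, ?_⟩
  · rw [← h2, ← h2']; rfl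
  · have := (h3.sum modeOK_none h3').trans modeOK_none (MEq.dsumMat_append modeOK_none _ _)
    rwa [← List.map_append] at this

theorem HasJordan.empty [IsEmpty m] (C : Matrix m m ℂ) : HasJordan C 0 := by
  have : IsEmpty (Fin (jordanSum []).1) := ⟨fun a => Fin.elim0 a⟩
  exact ⟨by simp, [], rfl, MEq.of_isEmpty modeOK_none _ _⟩

theorem HasJordan.single {q : ℕ} (hq : 1 ≤ q) (a : ℂ) : HasJordan (jordanJ q a) {(q, a)} := by
  refine ⟨by simpa using hq, [(q, a)], rfl, ?_⟩
  refine MEq.trans modeOK_none ?_ (MEq.dsumMat_cons modeOK_none ⟨q, jordanJ q a⟩ [])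
  have := isEmpty_dsumMat_nil (F := ℂ)
  refine (MEq.of_equiv modeOK_none (Equiv.sumEmpty (Fin q) _) ?_).symm modeOK_none
  rintro (i | i) (j | j) <;> first | exact (IsEmpty.false i).elim | exact (IsEmpty.false j).elim | rfl

/-- To prove a property of matrices that is invariant under similarity, it suffices to prove it for
Jordan blocks and to show that it is inherited by direct sums. -/
theorem HasJordan.induction {P : ∀ {m : Type} [Fintype m] [DecidableEq m], Matrix m m ℂ →
      Multiset (ℕ × ℂ) → Prop}
    (hP : ∀ {m n : Type} [Fintype m] [DecidableEq m] [Fintype n] [DecidableEq n] (A : Matrix m m ℂ)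
      (B : Matrix n n ℂ) (D : Multiset (ℕ × ℂ)), MEq none A B → P B D → P A D)
    (h0 : P (0 : Matrix (Fin 0) (Fin 0) ℂ) 0)
    (h1 : ∀ q a, 1 ≤ q → P (jordanJ q a) {(q, a)})
    (hsum : ∀ {m n : Type} [Fintype m] [DecidableEq m] [Fintype n] [DecidableEq n]
      (A : Matrix m m ℂ) (B : Matrix n n ℂ) (D D' : Multiset (ℕ × ℂ)), P A D → P B D' →
      P (fromBlocks A 0 0 B) (D + D'))
    (h : HasJordan C D) : P C D := by
  obtain ⟨h2, L, rfl, h3⟩ := h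
  refine hP _ _ _ h3 ?_
  clear h3
  induction L with
  | nil => exact h0
  | cons x L ih =>
    refine hP _ _ _ ((MEq.dsumMat_cons modeOK_none _ _).symm modeOK_none) ?_
    have := hsum _ _ _ _ (h1 x.1 x.2 (h2 x (by simp))) (ih fun y hy => h2 y (by simp at hy ⊢; tauto))
    exact this

theorem HasJordan.shift (h : HasJordan C D) (c : ℂ) :
    HasJordan (C + c • 1) (D.map fun x => (x.1, x.2 + c)) := by
  refine HasJordan.induction (P := fun C D => HasJordan (C + c • 1) (D.map fun x => (x.1, x.2 + c)))
    ?_ ?_ ?_ ?_ h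
  · exact fun A B D h h' => h'.of_mEq (h.shift c)
  · exact HasJordan.empty _
  · intro q a hq
    rw [jordanJ_shift]
    exact HasJordan.single hq _
  · intro m n _ _ _ _ A B D D' h h'
    rw [fromBlocks_shift, Multiset.map_add]
    exact h.sum h'

theorem hasJordan_nilSum (L : List ℕ) (hL : ∀ q ∈ L, 1 ≤ q) :
    HasJordan (nilSum ℂ L).2 ((L : Multiset ℕ).map fun q => (q, 0)) := by
  refine ⟨?_, L.map fun q => (q, 0), rfl, ?_⟩
  · simpa using hL
  · rw [jordanSum, List.map_map]
    exact MEq.refl modeOK_none _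

theorem exists_det_add_smul_eq_zero {n : ℕ} (hn : n ≠ 0) (A : Matrix (Fin n) (Fin n) ℂ) :
    ∃ c : ℂ, ¬ IsUnit (A + c • 1) := by
  obtain ⟨a, ha⟩ := IsAlgClosed.exists_root A.charpoly (by
    rw [Matrix.charpoly_degree_eq_dim]; simpa using hn)
  refine ⟨-a, fun h => ?_⟩
  rw [Matrix.isUnit_iff_isUnit_det] at h
  have h1 : (Matrix.scalar (Fin n) a - A).det = 0 := by rw [← Matrix.eval_charpoly]; exact ha
  have h2 : A + (-a) • 1 = -(Matrix.scalar (Fin n) a - A) := by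
    rw [Matrix.scalar_apply, ← Matrix.smul_one_eq_diagonal]
    simp [sub_eq_add_neg]
  rw [h2, Matrix.det_neg, h1] at h
  simp at h

theorem exists_hasJordan_fin (n : ℕ) (A : Matrix (Fin n) (Fin n) ℂ) : ∃ D, HasJordan A D := by
  induction n using Nat.strong_induction_on with
  | _ n ih =>
  rcases Nat.eq_zero_or_pos n with rfl | hn
  · exact ⟨0, HasJordan.empty _⟩
  · obtain ⟨c, hc⟩ := exists_det_add_smul_eq_zero hn.ne' A
    obtain ⟨p, K, L, hK, hL, h⟩ := exists_fitting modeOK_none (A + c • 1)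
    have hp : p < n := by
      have h1 := h.card_eq
      simp only [Fintype.card_fin, Fintype.card_sum] at h1
      rcases Nat.eq_zero_or_pos (nilSum ℂ L).1 with h2 | h2
      · have : IsEmpty (Fin (nilSum ℂ L).1) := by rw [h2]; infer_instance
        exact absurd (h.isUnit modeOK_none (isUnit_fromBlocks hK (isUnit_of_isEmpty _))) hc
      · omega
    obtain ⟨D, hD⟩ := ih p hp (K + (-c) • 1)
    have h1 := h.shift (-c)
    rw [fromBlocks_shift, add_assoc, ← add_smul, add_neg_cancel, zero_smul, add_zero] at h1
    exact ⟨_, (hD.sum ((hasJordan_nilSum L hL).shift (-c))).of_mEq h1⟩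

/-- The existence of the Jordan canonical form. -/
theorem exists_hasJordan (C : Matrix m m ℂ) : ∃ D, HasJordan C D := by
  obtain ⟨D, hD⟩ := exists_hasJordan_fin _
    (C.submatrix (Fintype.equivFin m).symm (Fintype.equivFin m).symm)
  exact ⟨D, hD.of_mEq (MEq.of_equiv modeOK_none (Fintype.equivFin m) fun i j => by simp)⟩

/-- The blocks with eigenvalue `c` constitute the nilpotent part of `C - c`. -/
theorem HasJordan.fitting (h : HasJordan C D) (c : ℂ) :
    ∃ (p : ℕ) (K : Matrix (Fin p) (Fin p) ℂ) (L : List ℕ), IsUnit K ∧ (∀ q ∈ L, 1 ≤ q) ∧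
      MEq none (C + (-c) • 1) (fromBlocks K 0 0 (nilSum ℂ L).2) ∧
      (L : Multiset ℕ) = (D.filter (fun x => x.2 = c)).map Prod.fst := by
  refine HasJordan.induction (P := fun C D =>
    ∃ (p : ℕ) (K : Matrix (Fin p) (Fin p) ℂ) (L : List ℕ), IsUnit K ∧ (∀ q ∈ L, 1 ≤ q) ∧
      MEq none (C + (-c) • 1) (fromBlocks K 0 0 (nilSum ℂ L).2) ∧
      (L : Multiset ℕ) = (D.filter (fun x => x.2 = c)).map Prod.fst) ?_ ?_ ?_ ?_ h
  · rintro m n _ _ _ _ A B D h ⟨p, K, L, h1, h2, h3, h4⟩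
    exact ⟨p, K, L, h1, h2, (h.shift (-c)).trans modeOK_none h3, h4⟩
  · have : IsEmpty (Fin (nilSum ℂ []).1) := ⟨fun a => Fin.elim0 a⟩
    exact ⟨0, 0, [], isUnit_of_isEmpty _, by simp, MEq.of_isEmpty modeOK_none _ _, rfl⟩
  · intro q a hq
    by_cases ha : a = c
    · subst ha
      refine ⟨0, 0, [q], isUnit_of_isEmpty _, by simpa using hq, ?_, by
        rw [Multiset.filter_singleton, if_pos rfl]; rfl⟩
      rw [jordanJ_shift, add_neg_cancel]
      have h1 := (HasJordan.single hq 0).mEq (hasJordan_nilSum [q] (by simpa using hq))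
      refine h1.trans modeOK_none ((MEq.of_equiv modeOK_none (Equiv.emptySum (Fin 0) _) ?_).symm
        modeOK_none)
      rintro (i | i) (j | j) <;>
        first | exact (IsEmpty.false i).elim | exact (IsEmpty.false j).elim | rfl
    · have : IsEmpty (Fin (nilSum ℂ []).1) := ⟨fun a => Fin.elim0 a⟩
      refine ⟨q, jordanJ q (a + -c), [], jordanJ_isUnit (by rwa [← sub_eq_add_neg, sub_ne_zero]),
        by simp, ?_, by simp [Multiset.filter_singleton, ha]⟩
      rw [jordanJ_shift]
      refine (MEq.of_equiv modeOK_none (Equiv.sumEmpty (Fin q) _) ?_).symm modeOK_none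
      rintro (i | i) (j | j) <;>
        first | exact (IsEmpty.false i).elim | exact (IsEmpty.false j).elim | rfl
  · rintro m n _ _ _ _ A B D D' ⟨p, K, L, h1, h2, h3, h4⟩ ⟨p', K', L', h1', h2', h3', h4'⟩
    refine ⟨p + p', Matrix.reindex finSumFinEquiv finSumFinEquiv (fromBlocks K 0 0 K'), L ++ L',
      ?_, ?_, ?_, ?_⟩
    · exact (MEq.of_equiv modeOK_none (μ := none) finSumFinEquiv.symm fun i j => by simp).isUnit
        modeOK_none (isUnit_fromBlocks h1 h1')
    · intro q hq
      exact (List.mem_append.1 hq).elim (h2 q) (h2' q)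
    · rw [fromBlocks_shift]
      refine (h3.sum modeOK_none h3').trans modeOK_none ?_
      have h5 : MEq none (fromBlocks K 0 0 K') (Matrix.reindex finSumFinEquiv finSumFinEquiv
        (fromBlocks K 0 0 K')) := MEq.of_equiv modeOK_none finSumFinEquiv fun i j => by simp
      have h6 : MEq none (fromBlocks (nilSum ℂ L).2 0 0 (nilSum ℂ L').2) (nilSum ℂ (L ++ L')).2 := by
        rw [nilSum, nilSum, nilSum, List.map_append]
        exact MEq.dsumMat_append modeOK_none _ _
      refine MEq.trans modeOK_none ?_ (h5.sum modeOK_none h6)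
      refine MEq.of_equiv modeOK_none (Equiv.sumSumSumComm _ _ _ _) ?_
      rintro ((i | i) | (i | i)) ((j | j) | (j | j)) <;> rfl
    · rw [Multiset.filter_add, Multiset.map_add, ← h4, ← h4']
      rfl

/-- The uniqueness of the Jordan canonical form. -/
theorem HasJordan.unique (h : HasJordan C D) (h' : HasJordan C D') : D = D' := by
  have key : ∀ c, (D.filter (fun x => x.2 = c)).map Prod.fst =
      (D'.filter (fun x => x.2 = c)).map Prod.fst := fun c => by
    obtain ⟨p, K, L, h1, h2, h3, h4⟩ := h.fitting c
    obtain ⟨p', K', L', h1', h2', h3', h4'⟩ := h'.fitting c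
    rw [← h4, ← h4']
    exact Multiset.coe_eq_coe.2
      (fitting_unique modeOK_none h1 h1' h2 h2' ((h3.symm modeOK_none).trans modeOK_none h3')).2
  ext ⟨q, c⟩
  have h1 := congrArg (Multiset.count q) (key c)
  have h2 : ∀ D : Multiset (ℕ × ℂ), Multiset.count q ((D.filter (fun x => x.2 = c)).map Prod.fst) =
      Multiset.count (q, c) D := fun D => by
    rw [Multiset.count_map, Multiset.filter_filter, Multiset.count, Multiset.countP_eq_card_filter]
    congr 1
    refine Multiset.filter_congr fun x _ => ?_
    rw [Prod.ext_iff]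
    exact and_congr_right fun _ => eq_comm
  rwa [h2, h2] at h1

end Jordan

section JordanBlocks

variable {m n : Type} [Fintype m] [Fintype n] [DecidableEq m] [DecidableEq n]
  {C : Matrix m m ℂ} {C' : Matrix n n ℂ} {D D' : Multiset (ℕ × ℂ)}

theorem HasJordan.ne_zero (h : HasJordan C D) (hC : IsUnit C) {x : ℕ × ℂ} (hx : x ∈ D) :
    x.2 ≠ 0 := by
  intro h0
  obtain ⟨p, K, L, h1, h2, h3, h4⟩ := h.fitting 0
  rw [neg_zero, zero_smul, add_zero] at h3
  have e := Fintype.equivFin m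
  have h5 : MEq none C (C.submatrix e.symm e.symm) :=
    MEq.of_equiv modeOK_none e fun i j => by simp
  have : IsEmpty (Fin (nilSum ℂ []).1) := ⟨fun a => Fin.elim0 a⟩
  have h6 : MEq none (C.submatrix e.symm e.symm)
      (fromBlocks (C.submatrix e.symm e.symm) 0 0 (nilSum ℂ []).2) := by
    refine (MEq.of_equiv modeOK_none (Equiv.sumEmpty _ _) ?_).symm modeOK_none
    rintro (i | i) (j | j) <;>
        first | exact (IsEmpty.false i).elim | exact (IsEmpty.false j).elim | rfl
  have h7 := (fitting_unique modeOK_none h1 ((h5.symm modeOK_none).isUnit modeOK_none hC) h2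
    (by simp) ((h3.symm modeOK_none).trans modeOK_none (h5.trans modeOK_none h6))).2
  rw [List.perm_nil.1 h7] at h4
  have h8 : x.1 ∈ (D.filter (fun x => x.2 = 0)).map Prod.fst :=
    Multiset.mem_map_of_mem _ (Multiset.mem_filter.2 ⟨hx, h0⟩)
  rw [← h4] at h8
  simp at h8

/-- The matrix of a Jordan block. -/
def JordanBlock.toMat (J : JordanBlock) : SqMat ℂ := ⟨J.q, jordanJ J.q J.c⟩

/-- The size and the eigenvalue of a Jordan block. -/
def JordanBlock.toPair (J : JordanBlock) : ℕ × ℂ := (J.q, J.c)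

theorem JordanBlock.toPair_injective : Function.Injective JordanBlock.toPair := by
  rintro ⟨q, hq, c, hc⟩ ⟨q', hq', c', hc'⟩ h
  simpa [JordanBlock.toPair] using h

theorem hasJordan_jordanBlocks (Ks : List JordanBlock) :
    HasJordan (dsumMat (Ks.map JordanBlock.toMat)).2
      ((Ks : Multiset JordanBlock).map JordanBlock.toPair) := by
  refine ⟨?_, Ks.map JordanBlock.toPair, rfl, ?_⟩
  · intro x hx
    obtain ⟨J, -, rfl⟩ := Multiset.mem_map.1 hx
    exact J.hq
  · rw [jordanSum, List.map_map]
    exact MEq.refl modeOK_none _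

theorem jordanBlock_isUnit (b : JordanBlock) : IsUnit b.toMat.2 := jordanJ_isUnit b.hc

theorem exists_jordanBlocks (n : ℕ) (K : Matrix (Fin n) (Fin n) ℂ) (hK : IsUnit K) :
    ∃ Ks : List JordanBlock, MEq none K (dsumMat (Ks.map JordanBlock.toMat)).2 := by
  obtain ⟨D, hD⟩ := exists_hasJordan K
  have h0 : ∀ x ∈ D, x.2 ≠ 0 := fun x hx => hD.ne_zero hK hx
  obtain ⟨h1, L, rfl, h2⟩ := hD
  obtain ⟨Ks, rfl⟩ : ∃ Ks : List JordanBlock, Ks.map JordanBlock.toPair = L := by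
    clear h2
    induction L with
    | nil => exact ⟨[], rfl⟩
    | cons x L ih =>
      obtain ⟨Ks, rfl⟩ := ih (fun y hy => h0 y (by simp at hy ⊢; tauto))
        (fun y hy => h1 y (by simp at hy ⊢; tauto))
      exact ⟨⟨x.1, h1 x (by simp), x.2, h0 x (by simp)⟩ :: Ks, rfl⟩
  rw [jordanSum, List.map_map] at h2
  exact ⟨Ks, h2⟩

theorem jordanBlocks_mEq_iff (Ks Ks' : List JordanBlock) :
    MEq none (dsumMat (Ks.map JordanBlock.toMat)).2 (dsumMat (Ks'.map JordanBlock.toMat)).2 ↔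
      Ks.Perm Ks' := by
  refine ⟨fun h => ?_, fun h => MEq.dsumMat_perm modeOK_none (h.map _)⟩
  have h1 := (hasJordan_jordanBlocks Ks).unique ((hasJordan_jordanBlocks Ks').of_mEq h)
  exact Multiset.coe_eq_coe.1 (Multiset.map_injective JordanBlock.toPair_injective h1)

end JordanBlocks

/-! ### Operations on Jordan canonical forms -/

section JordanOps

theorem jordanJ_zero_pow_apply {F : Type*} [Ring F] (n k : ℕ) (i j : Fin n) :
    (jordanJ n (0 : F) ^ k) i j = if i.val + k = j.val then 1 else 0 := by
  induction k generalizing j with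
  | zero => simp [Matrix.one_apply, Fin.ext_iff]
  | succ k ih =>
    rw [pow_succ, Matrix.mul_apply]
    by_cases h : i.val + (k + 1) = j.val
    · rw [if_pos h, Finset.sum_eq_single ⟨i.val + k, by omega⟩]
      · rw [ih, if_pos rfl]
        have : ((⟨i.val + k, by omega⟩ : Fin n) = j) ↔ False := by
          rw [Fin.ext_iff]; simp only [iff_false]; omega
        simp only [jordanJ, of_apply, this]
        rw [if_neg id, if_pos (by omega), one_mul]
      · intro l _ hl
        rw [ih, if_neg, zero_mul]
        intro h'
        exact hl (Fin.ext h'.symm)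
      · simp
    · rw [if_neg h]
      refine Finset.sum_eq_zero fun l _ => ?_
      rw [ih]
      by_cases h1 : i.val + k = l.val
      · rw [if_pos h1, one_mul]
        simp only [jordanJ, of_apply]
        split_ifs with h2 h3
        · rfl
        · omega
        · rfl
      · rw [if_neg h1, zero_mul]

theorem jordanJ_zero_pow_eq_zero_iff {q k : ℕ} : jordanJ q (0 : ℂ) ^ k = 0 ↔ q ≤ k := by
  constructor
  · intro h
    by_contra hk
    have := congrFun (congrFun h ⟨0, by omega⟩) ⟨k, by omega⟩
    rw [jordanJ_zero_pow_apply] at this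
    simp at this
  · intro h
    ext i j
    rw [jordanJ_zero_pow_apply, if_neg (by omega), Matrix.zero_apply]

theorem jordanJ_pow_eq_zero_iff {q k : ℕ} (hq : 1 ≤ q) {a : ℂ} :
    jordanJ q a ^ k = 0 ↔ a = 0 ∧ q ≤ k := by
  by_cases ha : a = 0
  · subst ha
    rw [jordanJ_zero_pow_eq_zero_iff, eq_self_iff_true, true_and]
  · have : Nonempty (Fin q) := ⟨⟨0, hq⟩⟩
    simp only [ha, false_and, iff_false]
    exact ((jordanJ_isUnit ha).pow k).ne_zero

variable {m n : Type} [Fintype m] [Fintype n] [DecidableEq m] [DecidableEq n]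
  {C : Matrix m m ℂ} {C' : Matrix n n ℂ} {D D' : Multiset (ℕ × ℂ)}

theorem MEq.pow {m n : Type*} [Fintype m] [Fintype n] [DecidableEq m] [DecidableEq n]
    {A : Matrix m m ℂ} {B : Matrix n n ℂ} (h : MEq none A B) (k : ℕ) :
    MEq none (A ^ k) (B ^ k) := by
  obtain ⟨S, S', h1, h2, e⟩ := h
  refine ⟨S, S', h1, h2, ?_⟩
  simp only [tw] at e ⊢
  induction k with
  | zero => simp
  | succ k ih => rw [pow_succ, Matrix.mul_assoc, e, ← Matrix.mul_assoc, ih, Matrix.mul_assoc, pow_succ]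

theorem MEq.eq_zero_iff {m n : Type*} [Fintype m] [Fintype n] [DecidableEq m] [DecidableEq n]
    {A : Matrix m m ℂ} {B : Matrix n n ℂ} (h : MEq none A B) : A = 0 ↔ B = 0 := by
  obtain ⟨S, S', h1, h2, e⟩ := h
  simp only [tw] at e
  constructor
  · rintro rfl
    rw [← Matrix.one_mul B, ← h2, Matrix.mul_assoc, ← e, Matrix.zero_mul, Matrix.mul_zero]
  · rintro rfl
    rw [← Matrix.mul_one A, ← h1, ← Matrix.mul_assoc, e, Matrix.mul_zero, Matrix.zero_mul]

theorem fromBlocks_pow {m n : Type*} [Fintype m] [Fintype n] [DecidableEq m] [DecidableEq n]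
    (A : Matrix m m ℂ) (B : Matrix n n ℂ) (k : ℕ) :
    fromBlocks A 0 0 B ^ k = fromBlocks (A ^ k) 0 0 (B ^ k) := by
  induction k with
  | zero => simp
  | succ k ih => rw [pow_succ, ih, fromBlocks_multiply]; simp [pow_succ]

theorem HasJordan.pow_eq_zero_iff (h : HasJordan C D) (k : ℕ) :
    C ^ k = 0 ↔ ∀ x ∈ D, x.2 = 0 ∧ x.1 ≤ k := by
  refine HasJordan.induction (P := fun C D => C ^ k = 0 ↔ ∀ x ∈ D, x.2 = 0 ∧ x.1 ≤ k) ?_ ?_ ?_ ?_ h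
  · intro m n _ _ _ _ A B D h h'
    rw [(h.pow k).eq_zero_iff, h']
  · simp only [Multiset.notMem_zero, IsEmpty.forall_iff, implies_true, iff_true]
    exact Subsingleton.elim _ _
  · intro q a hq
    rw [jordanJ_pow_eq_zero_iff hq]
    simp
  · intro m n _ _ _ _ A B D D' h h'
    rw [fromBlocks_pow, ← fromBlocks_zero, fromBlocks_inj, h, h']
    simp only [true_and, Multiset.mem_add]
    constructor
    · rintro ⟨h1, h2⟩ x (hx | hx)
      · exact h1 x hx
      · exact h2 x hx
    · intro h3
      exact ⟨fun x hx => h3 x (.inl hx), fun x hx => h3 x (.inr hx)⟩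

theorem HasJordan.card (h : HasJordan C D) : (D.map Prod.fst).sum = Fintype.card m := by
  refine HasJordan.induction (P := fun {m} _ _ _ D => (D.map Prod.fst).sum = Fintype.card m)
    ?_ ?_ ?_ ?_ h
  · intro m n _ _ _ _ A B D h h'
    rw [h', h.card_eq]
  · simp
  · simp
  · intro m n _ _ _ _ A B D D' h h'
    rw [Multiset.map_add, Multiset.sum_add, h, h', Fintype.card_sum]

/-- A nilpotent matrix of maximal index is similar to one Jordan block. -/
theorem HasJordan.of_pow {n : ℕ} (hn : 1 ≤ n) {M : Matrix (Fin n) (Fin n) ℂ} (h0 : M ^ n = 0)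
    (h1 : M ^ (n - 1) ≠ 0) : HasJordan M {(n, 0)} := by
  obtain ⟨D, hD⟩ := exists_hasJordan M
  have h2 := (hD.pow_eq_zero_iff n).1 h0
  rw [Ne, hD.pow_eq_zero_iff] at h1
  push Not at h1
  obtain ⟨⟨q, a⟩, hx, hq⟩ := h1
  obtain ⟨ha, hqn⟩ := h2 _ hx
  have h3 := hq ha
  simp only at ha hqn h3
  obtain rfl : q = n := by omega
  subst ha
  obtain ⟨D', rfl⟩ := Multiset.exists_cons_of_mem hx
  have h4 := hD.card
  rw [Multiset.map_cons, Multiset.sum_cons, Fintype.card_fin] at h4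
  have h5 : (D'.map Prod.fst).sum = 0 := by simpa using h4
  obtain rfl : D' = 0 := by
    refine Multiset.eq_zero_of_forall_notMem fun y hy => ?_
    have h6 := hD.1 y (Multiset.mem_cons_of_mem hy)
    have h7 := Multiset.single_le_sum (fun _ _ => Nat.zero_le _) _ (Multiset.mem_map_of_mem Prod.fst hy)
    omega
  exact hD

/-- Multiplying a nilpotent Jordan block by a unit that commutes with it does not change its
similarity class. -/
theorem HasJordan.of_commute {n : ℕ} (hn : 1 ≤ n) {M U : Matrix (Fin n) (Fin n) ℂ} (c : ℂ)
    (hU : IsUnit U) (h : Commute U (jordanJ n 0)) (hM : M = c • 1 + U * jordanJ n 0) :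
    HasJordan M {(n, c)} := by
  have h1 : HasJordan (U * jordanJ n (0 : ℂ)) {(n, 0)} := by
    refine HasJordan.of_pow hn ?_ ?_
    · rw [h.mul_pow, jordanJ_zero_pow_eq_zero_iff.2 le_rfl, mul_zero]
    · rw [h.mul_pow, Ne, (hU.pow _).mul_right_eq_zero, jordanJ_zero_pow_eq_zero_iff]
      omega
  have h2 := h1.shift c
  rw [hM, add_comm]
  simpa using h2

theorem jordanJ_eq (n : ℕ) (a : ℂ) : jordanJ n a = a • 1 + jordanJ n 0 := by
  rw [add_comm, jordanJ_shift, zero_add]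

/-- The Jordan canonical form of the inverse. -/
theorem HasJordan.inv (h : HasJordan C D) {X : Matrix m m ℂ} (hX : C * X = 1) :
    HasJordan X (D.map fun x => (x.1, x.2⁻¹)) := by
  refine HasJordan.induction (P := fun {m} _ _ C D => ∀ X : Matrix m m ℂ, C * X = 1 →
    HasJordan X (D.map fun x => (x.1, x.2⁻¹))) ?_ ?_ ?_ ?_ h X hX
  · rintro m n _ _ _ _ A B D ⟨S, S', h1, h2, e⟩ h X hX
    simp only [tw] at e
    have hX' := mul_eq_one_comm.1 hX
    have h3 : B * (S' * X * S) = 1 := by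
      calc B * (S' * X * S) = S' * S * B * (S' * X * S) := by rw [h2, Matrix.one_mul]
        _ = S' * (S * B) * (S' * X * S) := by rw [Matrix.mul_assoc S']
        _ = S' * A * (S * S') * X * S := by rw [← e]; simp only [Matrix.mul_assoc]
        _ = S' * (A * X) * S := by rw [h1, Matrix.mul_one]; simp only [Matrix.mul_assoc]
        _ = 1 := by rw [hX, Matrix.mul_one, h2]
    refine (h _ h3).of_mEq ⟨S, S', h1, h2, ?_⟩
    simp only [tw]
    rw [← Matrix.mul_assoc, ← Matrix.mul_assoc, h1, Matrix.one_mul]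
  · intro X _
    exact HasJordan.empty _
  · intro q a hq X hX
    have hX' := mul_eq_one_comm.1 hX
    have ha : a ≠ 0 := (HasJordan.single hq a).ne_zero ⟨⟨_, X, hX, hX'⟩, rfl⟩
      (Multiset.mem_singleton_self _)
    have h1 : Commute X (jordanJ q a) := by rw [Commute, SemiconjBy, hX, hX']
    have h2 : Commute X (jordanJ q 0) := by
      have : jordanJ q (0 : ℂ) = jordanJ q a - a • 1 := by rw [jordanJ_eq q a]; simp
      rw [this]
      exact h1.sub_right ((Commute.one_right X).smul_right a)
    refine HasJordan.of_commute (U := (-a⁻¹) • X) hq a⁻¹ ?_ (h2.smul_left _) ?_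
    · have h3 : IsUnit X := ⟨⟨X, _, hX', hX⟩, rfl⟩
      refine ⟨⟨(-a⁻¹) • X, (-a) • jordanJ q a, ?_, ?_⟩, rfl⟩
      · simp [hX', smul_smul, ha]
      · simp [hX, smul_smul, ha]
    · have h4 : jordanJ q (0 : ℂ) = jordanJ q a - a • 1 := by rw [jordanJ_eq q a]; simp
      rw [h4, smul_mul, mul_sub, hX']
      simp [smul_sub, smul_smul, ha]
  · intro m n _ _ _ _ A B D D' h h' X hX
    have h1 : A * X.toBlocks₁₁ = 1 ∧ B * X.toBlocks₂₂ = 1 := by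
      rw [← fromBlocks_toBlocks X, fromBlocks_multiply, ← fromBlocks_one, fromBlocks_inj] at hX
      simp only [Matrix.zero_mul, add_zero, zero_add] at hX
      exact ⟨hX.1, hX.2.2.2⟩
    have h2 : X = fromBlocks X.toBlocks₁₁ 0 0 X.toBlocks₂₂ := by
      have h3 : fromBlocks A 0 0 B * fromBlocks X.toBlocks₁₁ 0 0 X.toBlocks₂₂ = 1 := by
        rw [fromBlocks_multiply]
        simp [h1.1, h1.2]
      exact left_inv_eq_right_inv (mul_eq_one_comm.1 hX) h3
    rw [h2, Multiset.map_add]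
    exact (h _ h1.1).sum (h' _ h1.2)

theorem MEq.adj {m n : Type*} [Fintype m] [Fintype n] [DecidableEq m] [DecidableEq n]
    {σ : ℂ → ℂ} (hσ : IsRingInvolution σ) {A : Matrix m m ℂ} {B : Matrix n n ℂ}
    (h : MEq none A B) : MEq none (A.transpose.map σ) (B.transpose.map σ) := by
  obtain ⟨S, S', h1, h2, e⟩ := h
  simp only [tw] at e
  refine ⟨S'.transpose.map σ, S.transpose.map σ, ?_, ?_, ?_⟩
  · rw [← hσ.adj_mul, h1, hσ.adj_one]
  · rw [← hσ.adj_mul, h2, hσ.adj_one]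
  · simp only [tw]
    rw [← hσ.adj_mul, ← hσ.adj_mul]
    congr 2
    calc S' * A = S' * A * (S * S') := by rw [h1, Matrix.mul_one]
      _ = S' * (A * S) * S' := by simp only [Matrix.mul_assoc]
      _ = S' * S * B * S' := by rw [e]; simp only [Matrix.mul_assoc]
      _ = B * S' := by rw [h2, Matrix.one_mul]

/-- The Jordan canonical form of the adjoint. -/
theorem HasJordan.adj {σ : ℂ → ℂ} (hσ : IsRingInvolution σ) (h : HasJordan C D) :
    HasJordan (C.transpose.map σ) (D.map fun x => (x.1, σ x.2)) := by
  refine HasJordan.induction (P := fun C D => HasJordan (C.transpose.map σ)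
    (D.map fun x => (x.1, σ x.2))) ?_ ?_ ?_ ?_ h
  · intro m n _ _ _ _ A B D h h'
    exact h'.of_mEq (h.adj hσ)
  · exact HasJordan.empty _
  · intro q a hq
    refine (HasJordan.single hq (σ a)).of_mEq (MEq.of_equiv modeOK_none Fin.revPerm ?_)
    intro i j
    simp only [jordanJ, Fin.revPerm_apply, of_apply, map_apply, transpose_apply, Fin.rev_inj,
      Fin.val_rev]
    by_cases h1 : i = j
    · simp [h1]
    · have h2 : ¬ j = i := fun h => h1 h.symm
      have h3 : q - (i.val + 1) + 1 = q - (j.val + 1) ↔ j.val + 1 = i.val := by omega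
      simp only [h1, h2, if_false, h3]
      split_ifs <;> simp [hσ.map_one, hσ.map_zero]
  · intro m n _ _ _ _ A B D D' h h'
    have h1 : (fromBlocks A 0 0 B).transpose.map σ =
        fromBlocks (A.transpose.map σ) 0 0 (B.transpose.map σ) := by
      ext (i | i) (j | j) <;> simp [hσ.map_zero]
    rw [h1, Multiset.map_add]
    exact h.sum h'

end JordanOps

/-! ### Cosquares -/

section Cosquare

/-- The Jordan canonical form of the cosquare `(A^*)⁻¹ A` of a nonsingular matrix `A`. -/
def CosqJordan (σ : ℂ → ℂ) {m : Type} [Fintype m] [DecidableEq m] (A : Matrix m m ℂ)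
    (D : Multiset (ℕ × ℂ)) : Prop :=
  IsUnit A ∧ ∃ C, A = A.transpose.map σ * C ∧ HasJordan C D

variable {σ : ℂ → ℂ} (hσ : IsRingInvolution σ) {m n : Type} [Fintype m] [DecidableEq m]
  [Fintype n] [DecidableEq n] {A : Matrix m m ℂ} {B : Matrix n n ℂ} {D D' : Multiset (ℕ × ℂ)}

include hσ in
theorem isUnit_adj {m : Type*} [Fintype m] [DecidableEq m] {A : Matrix m m ℂ} (hA : IsUnit A) :
    IsUnit (A.transpose.map σ) := by
  obtain ⟨A', h⟩ := hA.exists_left_inv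
  have h1 : A.transpose.map σ * A'.transpose.map σ = 1 := by rw [← hσ.adj_mul, h, hσ.adj_one]
  exact ⟨⟨_, _, h1, mul_eq_one_comm.1 h1⟩, rfl⟩

include hσ in
theorem exists_cosqJordan (hA : IsUnit A) : ∃ D, CosqJordan σ A D := by
  obtain ⟨X, hX⟩ := (isUnit_adj hσ hA).exists_right_inv
  obtain ⟨D, hD⟩ := exists_hasJordan (X * A)
  exact ⟨D, hA, X * A, by rw [← Matrix.mul_assoc, hX, Matrix.one_mul], hD⟩

include hσ in
/-- Congruent matrices have similar cosquares. -/
theorem cosq_mEq {C : Matrix n n ℂ} (hB : B = B.transpose.map σ * C) {S : Matrix m n ℂ}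
    {S' : Matrix n m ℂ} (h1 : S * S' = 1) (h2 : S' * S = 1) (e : A * S = S'.transpose.map σ * B) :
    A = A.transpose.map σ * (S * C * S') := by
  have h3 : A = S'.transpose.map σ * B * S' := by rw [← e, Matrix.mul_assoc, h1, Matrix.mul_one]
  have h4 : A.transpose.map σ = S'.transpose.map σ * B.transpose.map σ * S' := by
    rw [h3, hσ.adj_mul, hσ.adj_mul, hσ.adj_adj, Matrix.mul_assoc]
  rw [h4]
  calc A = S'.transpose.map σ * (B.transpose.map σ * C) * S' := by rw [← hB, h3]
    _ = S'.transpose.map σ * B.transpose.map σ * (S' * S) * C * S' := by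
      rw [h2, Matrix.mul_one]; simp only [Matrix.mul_assoc]
    _ = _ := by simp only [Matrix.mul_assoc]

include hσ in
theorem CosqJordan.of_mEq (h : MEq (some σ) A B) (hB : CosqJordan σ B D) : CosqJordan σ A D := by
  refine ⟨h.isUnit (modeOK_some hσ) hB.1, ?_⟩
  obtain ⟨S, S', h1, h2, e⟩ := h
  obtain ⟨-, C, h3, h4⟩ := hB
  refine ⟨S * C * S', cosq_mEq hσ h3 h1 h2 e, h4.of_mEq ⟨S, S', h1, h2, ?_⟩⟩
  simp only [tw]
  rw [Matrix.mul_assoc, h2, Matrix.mul_one]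

include hσ in
theorem adj_fromBlocks {m n : Type*} (A : Matrix m m ℂ) (B : Matrix m n ℂ) (C : Matrix n m ℂ)
    (E : Matrix n n ℂ) : (fromBlocks A B C E).transpose.map σ =
      fromBlocks (A.transpose.map σ) (C.transpose.map σ) (B.transpose.map σ)
        (E.transpose.map σ) := by
  ext (i | i) (j | j) <;> rfl

include hσ in
theorem adj_zero {m n : Type*} : ((0 : Matrix m n ℂ).transpose.map σ) = 0 := by
  ext i j
  simp [hσ.map_zero]

include hσ in
theorem adj_fromBlocks_diag {m n : Type*} (A : Matrix m m ℂ) (E : Matrix n n ℂ) :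
    (fromBlocks A 0 0 E).transpose.map σ =
      fromBlocks (A.transpose.map σ) 0 0 (E.transpose.map σ) := by
  rw [adj_fromBlocks hσ, adj_zero hσ, adj_zero hσ]

include hσ in
theorem CosqJordan.sum (hA : CosqJordan σ A D) (hB : CosqJordan σ B D') :
    CosqJordan σ (fromBlocks A 0 0 B) (D + D') := by
  obtain ⟨h1, C, h2, h3⟩ := hA
  obtain ⟨h1', C', h2', h3'⟩ := hB
  refine ⟨isUnit_fromBlocks h1 h1', fromBlocks C 0 0 C', ?_, h3.sum h3'⟩
  rw [adj_fromBlocks_diag hσ, fromBlocks_multiply]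
  simp [← h2, ← h2']

theorem CosqJordan.empty [IsEmpty m] (A : Matrix m m ℂ) : CosqJordan σ A 0 :=
  ⟨isUnit_of_isEmpty A, 1, Subsingleton.elim _ _, HasJordan.empty _⟩

include hσ in
theorem CosqJordan.unique (h : CosqJordan σ A D) (h' : CosqJordan σ A D') : D = D' := by
  obtain ⟨h1, C, h2, h3⟩ := h
  obtain ⟨h1', C', h2', h3'⟩ := h'
  have h4 : C = C' := (isUnit_adj hσ h1).mul_left_cancel (h2.symm.trans h2')
  exact h3.unique (h4 ▸ h3')

theorem isUnit_cosq {m : Type*} [Fintype m] [DecidableEq m] {A C : Matrix m m ℂ} (hA : IsUnit A)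
    (h : A = A.transpose.map σ * C) : IsUnit C := by
  obtain ⟨X, hX⟩ := hA.exists_left_inv
  have h1 : X * A.transpose.map σ * C = 1 := by rw [Matrix.mul_assoc, ← h, hX]
  exact ⟨⟨C, _, mul_eq_one_comm.1 h1, h1⟩, rfl⟩

theorem CosqJordan.ne_zero (h : CosqJordan σ A D) {x : ℕ × ℂ} (hx : x ∈ D) : x.2 ≠ 0 := by
  obtain ⟨h1, C, h2, h3⟩ := h
  exact h3.ne_zero (isUnit_cosq h1 h2) hx

include hσ in
/-- A cosquare is similar to the adjoint of its inverse, whence a symmetry of its Jordan canonical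
form. -/
theorem CosqJordan.map_eq (h : CosqJordan σ A D) : D.map (fun x => (x.1, (σ x.2)⁻¹)) = D := by
  obtain ⟨h1, C, h2, h3⟩ := h
  obtain ⟨X, hX⟩ := (isUnit_cosq h1 h2).exists_right_inv
  obtain ⟨A', hA'⟩ := h1.exists_right_inv
  have h4 : A.transpose.map σ = C.transpose.map σ * A := by
    conv_lhs => rw [h2, hσ.adj_mul, hσ.adj_adj]
  have h5 : C.transpose.map σ * A = A * X := by
    conv_rhs => rw [h2, Matrix.mul_assoc, hX, Matrix.mul_one, h4]
  have h6 : MEq none (C.transpose.map σ) X := ⟨A, A', hA', mul_eq_one_comm.1 hA', h5⟩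
  have h7 := (h3.adj hσ).unique ((h3.inv hX).of_mEq h6)
  have h8 := congrArg (Multiset.map fun x : ℕ × ℂ => (x.1, x.2⁻¹)) h7
  rw [Multiset.map_map, Multiset.map_map] at h8
  refine h8.trans ?_
  simp

include hσ in
theorem cosqJordan_hyp (q : ℕ) (hq : 1 ≤ q) {c : ℂ} (hc : c ≠ 0) :
    CosqJordan σ (hyperbolicH q c) {(q, c), (q, (σ c)⁻¹)} := by
  have h0 : MEq (some σ) (hyperbolicH q c) (fromBlocks 0 1 (jordanJ q c) 0) :=
    MEq.of_equiv (modeOK_some hσ) finSumFinEquiv.symm fun i j => by simp [hyperbolicH]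
  refine CosqJordan.of_mEq hσ h0 ?_
  have hJ := jordanJ_isUnit (n := q) hc
  obtain ⟨Y, hY⟩ := hJ.exists_right_inv
  obtain ⟨X, hX⟩ := (isUnit_adj hσ hJ).exists_right_inv
  have hu : fromBlocks 0 1 (jordanJ q c) 0 * fromBlocks 0 Y 1 0 = 1 := by
    rw [fromBlocks_multiply]
    simp [hY]
  refine ⟨⟨⟨_, _, hu, mul_eq_one_comm.1 hu⟩, rfl⟩, fromBlocks (jordanJ q c) 0 0 X, ?_, ?_⟩
  · rw [adj_fromBlocks hσ, adj_zero hσ, hσ.adj_one, fromBlocks_multiply]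
    simp [hX]
  · exact (HasJordan.single hq c).sum (((HasJordan.single hq c).adj hσ).inv hX)

/-- A common computation for the matrices `Γ_n` and `Δ_n`. -/
theorem cosq_of_nilpotent {n : ℕ} {A Q : Matrix (Fin n) (Fin n) ℂ} {a b β : ℂ} (hb : b ≠ 0)
    (h1 : A = a • (Q * (1 + β • jordanJ n 0)))
    (h2 : A.transpose.map σ = b • (Q * (1 - β • jordanJ n 0))) :
    ∃ Y : Matrix (Fin n) (Fin n) ℂ, IsUnit Y ∧ Commute Y (jordanJ n 0) ∧
      (1 - β • jordanJ n 0) * Y = 1 ∧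
      A = A.transpose.map σ * ((a / b) • 1 + ((2 * (a / b) * β) • Y) * jordanJ n 0) := by
  have hnil : IsNilpotent (β • jordanJ n (0 : ℂ)) :=
    ⟨n, by rw [smul_pow, jordanJ_zero_pow_eq_zero_iff.2 le_rfl, smul_zero]⟩
  obtain ⟨Y, hY⟩ := hnil.isUnit_one_sub.exists_right_inv
  have hY' := mul_eq_one_comm.1 hY
  have hc : Commute (1 - β • jordanJ n (0 : ℂ)) (jordanJ n 0) :=
    (Commute.one_left _).sub_left ((Commute.refl _).smul_left β)
  have hYc : Commute Y (jordanJ n (0 : ℂ)) := by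
    rw [Commute, SemiconjBy]
    calc Y * jordanJ n 0 = Y * (jordanJ n 0 * (1 - β • jordanJ n 0)) * Y := by
          rw [Matrix.mul_assoc, Matrix.mul_assoc, hY, Matrix.mul_one]
      _ = (Y * (1 - β • jordanJ n 0)) * jordanJ n 0 * Y := by
          rw [← hc.eq]; simp only [Matrix.mul_assoc]
      _ = _ := by rw [hY', Matrix.one_mul]
  refine ⟨Y, ⟨⟨Y, _, hY', hY⟩, rfl⟩, hYc, hY, ?_⟩
  have h3 : (1 - β • jordanJ n 0) * ((a / b) • 1 + ((2 * (a / b) * β) • Y) * jordanJ n 0) =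
      (a / b) • (1 + β • jordanJ n (0 : ℂ)) := by
    rw [mul_add, ← Matrix.mul_assoc, Matrix.mul_smul _ _ Y, hY, Matrix.mul_smul, Matrix.mul_one,
      smul_mul, Matrix.one_mul]
    module
  rw [h2, smul_mul, Matrix.mul_assoc, h3, h1, Matrix.mul_smul, smul_smul, mul_div_cancel₀ _ hb]

/-- The cosquare of such a matrix is `a / b` times a unipotent matrix with a single Jordan block. -/
theorem cosqJordan_of_nilpotent {n : ℕ} (hn : 1 ≤ n) {A Q : Matrix (Fin n) (Fin n) ℂ} {a b β : ℂ}
    (hQ : IsUnit Q) (ha : a ≠ 0) (hb : b ≠ 0) (hβ : β ≠ 0)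
    (h1 : A = a • (Q * (1 + β • jordanJ n 0)))
    (h2 : A.transpose.map σ = b • (Q * (1 - β • jordanJ n 0))) :
    CosqJordan σ A {(n, a / b)} := by
  obtain ⟨Y, hY, hc, -, h3⟩ := cosq_of_nilpotent hb h1 h2
  have hnil : IsNilpotent (β • jordanJ n (0 : ℂ)) :=
    ⟨n, by rw [smul_pow, jordanJ_zero_pow_eq_zero_iff.2 le_rfl, smul_zero]⟩
  refine ⟨?_, _, h3, HasJordan.of_commute hn _ ?_ (hc.smul_left _) rfl⟩
  · rw [h1]
    exact (hQ.mul hnil.isUnit_one_add).smul (Units.mk0 a ha)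
  · exact hY.smul (Units.mk0 (2 * (a / b) * β) (by
      exact mul_ne_zero (mul_ne_zero two_ne_zero (div_ne_zero ha hb)) hβ))

/-- The antidiagonal matrix with alternating signs. -/
def antidiag (s : ℂ) (n : ℕ) : Matrix (Fin n) (Fin n) ℂ :=
  Matrix.of fun i j => if i.val + j.val + 1 = n then s ^ (n - 1 - i.val) else 0

theorem antidiag_mul_apply (s : ℂ) (n : ℕ) (M : Matrix (Fin n) (Fin n) ℂ) (i j : Fin n) :
    (antidiag s n * M) i j = s ^ (n - 1 - i.val) * M i.rev j := by
  rw [Matrix.mul_apply, Finset.sum_eq_single i.rev]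
  · simp only [antidiag, of_apply, Fin.val_rev]
    rw [if_pos (by omega)]
  · intro l _ hl
    simp only [antidiag, of_apply]
    rw [if_neg, zero_mul]
    intro h
    exact hl (Fin.ext (by rw [Fin.val_rev]; omega))
  · simp

theorem antidiag_isUnit {s : ℂ} (hs : s ≠ 0) (n : ℕ) : IsUnit (antidiag s n) := by
  have h : antidiag s n * (Matrix.of fun i j => if i.val + j.val + 1 = n then (s ^ i.val)⁻¹ else 0)
      = 1 := by
    ext i j
    rw [antidiag_mul_apply]
    simp only [of_apply, Fin.val_rev, Matrix.one_apply, Fin.ext_iff]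
    by_cases h : i.val = j.val
    · rw [if_pos (by omega), if_pos h, show n - 1 - i.val = n - (i.val + 1) by omega,
        mul_inv_cancel₀ (pow_ne_zero _ hs)]
    · rw [if_neg (by omega), if_neg h, mul_zero]
  exact ⟨⟨_, _, h, mul_eq_one_comm.1 h⟩, rfl⟩

theorem gam_eq (n : ℕ) : Gam n = antidiag (-1) n * (1 + (1 : ℂ) • jordanJ n 0) := by
  ext i j
  rw [antidiag_mul_apply]
  simp only [Gam, of_apply, Matrix.add_apply, Matrix.one_apply, jordanJ, Matrix.smul_apply,
    Fin.ext_iff, Fin.val_rev, smul_eq_mul, one_mul]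
  by_cases h1 : i.val + j.val + 1 = n
  · rw [if_pos (.inl h1), if_pos (by omega), if_pos (by omega)]
    simp
  · by_cases h2 : i.val + j.val = n
    · rw [if_pos (.inr h2), if_neg (by omega), if_neg (by omega), if_pos (by omega)]
      simp
    · rw [if_neg (by omega), if_neg (by omega), if_neg (by omega), if_neg (by omega)]
      simp

theorem gam_transpose_eq {n : ℕ} (hn : 1 ≤ n) : (Gam n).transpose =
    (-1 : ℂ) ^ (n + 1) • (antidiag (-1) n * (1 - (1 : ℂ) • jordanJ n 0)) := by
  ext i j
  rw [Matrix.smul_apply, antidiag_mul_apply]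
  simp only [Gam, of_apply, Matrix.sub_apply, Matrix.one_apply, jordanJ, Matrix.smul_apply,
    transpose_apply, Fin.ext_iff, Fin.val_rev, smul_eq_mul, one_mul]
  by_cases h1 : i.val + j.val + 1 = n
  · rw [if_pos (.inl (by omega)), if_pos (by omega), if_pos (by omega)]
    simp only [sub_zero, mul_one]
    rw [← pow_add]
    refine neg_one_pow_congr ?_
    rw [show n + 1 + (n - 1 - i.val) = (n - 1 - j.val) + 2 * (j.val + 1) by omega, Nat.even_add]
    simp
  · by_cases h2 : i.val + j.val = n
    · rw [if_pos (.inr (by omega)), if_neg (by omega), if_neg (by omega), if_pos (by omega), zero_sub,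
        ← pow_succ, ← pow_add, ← add_assoc]
      refine neg_one_pow_congr ?_
      rw [show n + 1 + (n - 1 - i.val) + 1 = (n - 1 - j.val) + 2 * (j.val + 1) by omega,
        Nat.even_add]
      simp
    · rw [if_neg (by omega), if_neg (by omega), if_neg (by omega), if_neg (by omega)]
      simp

theorem del_eq (n : ℕ) : Del n = antidiag 1 n * (1 + Complex.I • jordanJ n 0) := by
  ext i j
  rw [antidiag_mul_apply]
  simp only [Del, of_apply, Matrix.add_apply, Matrix.one_apply, jordanJ, Matrix.smul_apply,
    Fin.ext_iff, Fin.val_rev, smul_eq_mul, one_mul, one_pow]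
  by_cases h1 : i.val + j.val + 1 = n
  · rw [if_pos h1, if_pos (by omega), if_pos (by omega)]
    simp
  · by_cases h2 : i.val + j.val = n
    · rw [if_neg h1, if_pos h2, if_neg (by omega), if_neg (by omega), if_pos (by omega)]
      simp
    · rw [if_neg (by omega), if_neg (by omega), if_neg (by omega), if_neg (by omega),
        if_neg (by omega)]
      simp

theorem del_adj_eq (n : ℕ) : (Del n).transpose.map star =
    (1 : ℂ) • (antidiag 1 n * (1 - Complex.I • jordanJ n 0)) := by
  rw [one_smul]
  ext i j
  rw [antidiag_mul_apply]
  simp only [Del, of_apply, Matrix.sub_apply, Matrix.one_apply, jordanJ, Matrix.smul_apply,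
    Fin.ext_iff, Fin.val_rev, smul_eq_mul, one_mul, one_pow, map_apply, transpose_apply]
  by_cases h1 : i.val + j.val + 1 = n
  · rw [if_pos (by omega), if_pos (by omega), if_pos (by omega)]
    simp
  · by_cases h2 : i.val + j.val = n
    · rw [if_neg (by omega), if_pos (by omega), if_neg (by omega), if_neg (by omega),
        if_pos (by omega)]
      simp
    · rw [if_neg (by omega), if_neg (by omega), if_neg (by omega), if_neg (by omega),
        if_neg (by omega)]
      simp

include hσ in
theorem sigma_neg (a : ℂ) : σ (-a) = -σ a := by
  have := hσ.map_add a (-a)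
  rw [add_neg_cancel, hσ.map_zero] at this
  exact (neg_eq_of_add_eq_zero_right this.symm).symm

include hσ in
theorem gam_adj (n : ℕ) : (Gam n).transpose.map σ = (Gam n).transpose := by
  ext i j
  have h1 : ∀ k : ℕ, σ ((-1) ^ k) = (-1) ^ k := fun k => by
    rcases neg_one_pow_eq_or ℂ k with h | h <;> simp [h, sigma_neg hσ, hσ.map_one]
  simp only [Gam, map_apply, transpose_apply, of_apply]
  split_ifs
  · exact h1 _
  · exact hσ.map_zero

include hσ in
theorem gam_smul_adj {n : ℕ} (hn : 1 ≤ n) (c : ℂ) : (c • Gam n).transpose.map σ =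
    (σ c * (-1) ^ (n + 1)) • (antidiag (-1) n * (1 - (1 : ℂ) • jordanJ n 0)) := by
  rw [mul_smul, ← gam_transpose_eq hn, ← gam_adj hσ]
  ext i j
  simp only [map_apply, transpose_apply, Matrix.smul_apply, smul_eq_mul, hσ.map_mul]
  exact mul_comm _ _

include hσ in
theorem sigma_ne_zero {c : ℂ} (hc : c ≠ 0) : σ c ≠ 0 := fun h => hc (by
  rw [← hσ.involutive c, h, hσ.map_zero])

include hσ in
theorem cosqJordan_gam {n : ℕ} (hn : 1 ≤ n) {c : ℂ} (hc : c ≠ 0) :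
    CosqJordan σ (c • Gam n) {(n, c / (σ c * (-1) ^ (n + 1)))} :=
  cosqJordan_of_nilpotent hn (antidiag_isUnit (by simp) n) hc
    (mul_ne_zero (sigma_ne_zero hσ hc) (by simp)) one_ne_zero (by rw [gam_eq])
    (gam_smul_adj hσ hn c)

end Cosquare

/-! ### Square roots in the algebra generated by one matrix -/

section SquareRoot

open Polynomial

theorem dvd_of_aeval_eq_zero {p q : ℝ[X]} (hp : Irreducible p) {z : ℂ} (h1 : aeval z p = 0)
    (h2 : aeval z q = 0) : p ∣ q := by
  by_contra h
  obtain ⟨a, b, hab⟩ := (hp.coprime_iff_not_dvd).2 h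
  have := congrArg (aeval z) hab
  simp [h1, h2] at this

/-- The residue field of an irreducible real polynomial is `ℝ` or `ℂ`, in which every element is a
square up to sign. -/
theorem exists_sq_root_mod_irreducible {p : ℝ[X]} (hp : Irreducible p) (h0 : p.eval 0 ≠ 0) :
    ∃ (e : ℝ) (r : ℝ[X]), e ^ 2 = 1 ∧ IsCoprime r p ∧ p ∣ r ^ 2 - C e * X := by
  obtain ⟨z, hz⟩ := IsAlgClosed.exists_aeval_eq_zero ℂ p
    (fun h => hp.not_isUnit (Polynomial.isUnit_iff_degree_eq_zero.2 h))
  have hz0 : z ≠ 0 := by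
    rintro rfl
    rw [← map_zero (algebraMap ℝ ℂ), aeval_algebraMap_apply, coe_aeval_eq_eval] at hz
    exact h0 (Complex.ofReal_injective hz)
  suffices h : ∃ (e : ℝ) (r : ℝ[X]), e ^ 2 = 1 ∧ aeval z r ^ 2 = (e : ℂ) * z by
    obtain ⟨e, r, h1, h2⟩ := h
    refine ⟨e, r, h1, ?_, dvd_of_aeval_eq_zero hp hz ?_⟩
    · refine (hp.coprime_iff_not_dvd.2 ?_).symm
      rintro ⟨s, rfl⟩
      rw [map_mul, hz, zero_mul, zero_pow two_ne_zero, eq_comm, mul_eq_zero] at h2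
      rcases h2 with h2 | h2
      · rw [Complex.ofReal_eq_zero] at h2
        simp [h2] at h1
      · exact hz0 h2
    · simp [h2]
  by_cases hi : z.im = 0
  · obtain ⟨x, rfl⟩ : ∃ x : ℝ, z = x := ⟨z.re, by apply Complex.ext <;> simp [hi]⟩
    refine ⟨if 0 ≤ x then 1 else -1, C (√|x|), by split_ifs <;> norm_num, ?_⟩
    simp only [aeval_C, Complex.coe_algebraMap]
    rw [← Complex.ofReal_pow, Real.sq_sqrt (abs_nonneg _), ← Complex.ofReal_mul]
    congr 1
    split_ifs with h
    · rw [abs_of_nonneg h, one_mul]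
    · rw [abs_of_neg (not_le.1 h), neg_one_mul]
  · obtain ⟨w, hw⟩ := IsAlgClosed.exists_pow_nat_eq z two_pos
    refine ⟨1, C (w.re - w.im / z.im * z.re) + C (w.im / z.im) * X, by norm_num, ?_⟩
    have : aeval z (C (w.re - w.im / z.im * z.re) + C (w.im / z.im) * X : ℝ[X]) = w := by
      simp only [map_add, map_mul, aeval_C, aeval_X, Complex.coe_algebraMap]
      apply Complex.ext <;> simp
      field_simp
    rw [this, hw, Complex.ofReal_one, one_mul]

/-- Modulo a polynomial `m` with `m(0) ≠ 0`, the indeterminate is a square up to an involution.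
Over a power of an irreducible polynomial a square root modulo that polynomial is lifted by
Newton's method, and the Chinese remainder theorem does the rest. -/
theorem exists_sq_root_mod (m : ℝ[X]) : m.eval 0 ≠ 0 →
    ∃ e r : ℝ[X], m ∣ e ^ 2 - 1 ∧ m ∣ r ^ 2 - e * X := by
  refine UniqueFactorizationMonoid.induction_on_coprime m ?_ ?_ ?_ ?_
  · intro h
    simp at h
  · intro x hx _
    exact ⟨0, 0, hx.dvd, hx.dvd⟩
  · intro p i hp h0
    rcases Nat.eq_zero_or_pos i with rfl | hi
    · exact ⟨0, 0, by simp, by simp⟩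
    rw [eval_pow, Ne, pow_eq_zero_iff hi.ne'] at h0
    obtain ⟨e, r, he, hr, hd⟩ := exists_sq_root_mod_irreducible hp.irreducible h0
    let I := Ideal.span {p ^ i}
    have hI : ∀ f : ℝ[X], Ideal.Quotient.mk I f = 0 ↔ p ^ i ∣ f := fun f => by
      rw [Ideal.Quotient.eq_zero_iff_mem, Ideal.mem_span_singleton]
    let g := Ideal.Quotient.mk I (C e * X)
    let P : (ℝ[X] ⧸ I)[X] := X ^ 2 - C g
    have hn : IsNilpotent (aeval (Ideal.Quotient.mk I r) P) := by
      refine ⟨i, ?_⟩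
      have : aeval (Ideal.Quotient.mk I r) P = Ideal.Quotient.mk I (r ^ 2 - C e * X) := by
        simp [P, g]
      rw [this, ← map_pow, hI]
      exact pow_dvd_pow_of_dvd hd i
    have hu : IsUnit (aeval (Ideal.Quotient.mk I r) (derivative P)) := by
      have : aeval (Ideal.Quotient.mk I r) (derivative P) = Ideal.Quotient.mk I (C 2 * r) := by
        rw [← one_add_one_eq_two, C_add, C_1]
        simp [P]
      rw [this]
      obtain ⟨a, b, hab⟩ := hr.pow_right (n := i)
      refine IsUnit.of_mul_eq_one (Ideal.Quotient.mk I (C (1 / 2) * a)) ?_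
      rw [← map_mul, ← sub_eq_zero, ← map_one (Ideal.Quotient.mk I), ← map_sub, hI]
      refine ⟨-b, ?_⟩
      have h2 : (C 2 * C (1 / 2) : ℝ[X]) = 1 := by rw [← C_mul]; norm_num
      linear_combination (a * r) * h2 + hab
    obtain ⟨y, ⟨-, hy⟩, -⟩ := Polynomial.existsUnique_nilpotent_sub_and_aeval_eq_zero hn hu
    obtain ⟨s, rfl⟩ := Ideal.Quotient.mk_surjective y
    refine ⟨C e, s, ?_, ?_⟩
    · rw [← map_pow, he]
      simp
    · rw [← hI, map_sub, map_pow]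
      simpa [P, g] using hy
  · intro x y hxy hx hy h
    rw [eval_mul, mul_ne_zero_iff] at h
    obtain ⟨e, r, ⟨a1, h1⟩, ⟨a2, h2⟩⟩ := hx h.1
    obtain ⟨e', r', ⟨a1', h1'⟩, ⟨a2', h2'⟩⟩ := hy h.2
    have hc : IsCoprime x y := hxy.isCoprime
    obtain ⟨u, v, huv⟩ := id hc
    have hu : u * x = 1 - v * y := by linear_combination huv
    have k1 : ∀ f f' : ℝ[X], f * v * y + f' * u * x = f + x * ((f' - f) * u) := fun f f' => by
      linear_combination f * hu
    have k2 : ∀ f f' : ℝ[X], f * v * y + f' * u * x = f' + y * ((f - f') * v) := fun f f' => by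
      linear_combination f' * hu
    refine ⟨e * v * y + e' * u * x, r * v * y + r' * u * x, hc.mul_dvd ?_ ?_, hc.mul_dvd ?_ ?_⟩
    · rw [k1]
      exact ⟨a1 + (e' - e) * u * (2 * e + x * ((e' - e) * u)), by linear_combination h1⟩
    · rw [k2]
      exact ⟨a1' + (e - e') * v * (2 * e' + y * ((e - e') * v)), by linear_combination h1'⟩
    · rw [k1, k1]
      exact ⟨a2 + (r' - r) * u * (2 * r + x * ((r' - r) * u)) - (e' - e) * u * X,
        by linear_combination h2⟩
    · rw [k2, k2]
      exact ⟨a2' + (r - r') * v * (2 * r' + y * ((r - r') * v)) - (e - e') * v * X,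
        by linear_combination h2'⟩

/-- An invertible algebraic element of a real algebra is, up to an involution, the square of a
polynomial in itself. -/
theorem exists_aeval_sq {R : Type*} [Ring R] [Algebra ℝ R] [Nontrivial R] {H : R}
    (hi : IsIntegral ℝ H) (hH : IsUnit H) :
    ∃ e r : ℝ[X], aeval H e ^ 2 = 1 ∧ aeval H r ^ 2 = aeval H e * H := by
  have h0 : (minpoly ℝ H).eval 0 ≠ 0 := by
    intro h
    obtain ⟨q, hq⟩ := (X_dvd_iff (f := minpoly ℝ H)).2 (by rwa [coeff_zero_eq_eval_zero])
    have h1 := minpoly.aeval ℝ H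
    rw [hq, map_mul, aeval_X, hH.mul_right_eq_zero] at h1
    have hq0 : q ≠ 0 := by
      rintro rfl
      exact minpoly.ne_zero hi (by rw [hq, mul_zero])
    have h2 := minpoly.degree_le_of_ne_zero ℝ H hq0 h1
    rw [hq, degree_mul, degree_X, degree_eq_natDegree hq0] at h2
    have h3 : (1 + q.natDegree : ℕ) ≤ q.natDegree := by exact_mod_cast h2
    omega
  obtain ⟨e, r, ⟨a, h1⟩, ⟨b, h2⟩⟩ := exists_sq_root_mod _ h0
  refine ⟨e, r, ?_, ?_⟩
  · have := congrArg (aeval H) h1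
    simpa [sub_eq_zero] using this
  · have := congrArg (aeval H) h2
    simpa [sub_eq_zero] using this

end SquareRoot

section Square

theorem isRingInvolution_id {F : Type*} [CommRing F] : IsRingInvolution (id : F → F) :=
  ⟨fun _ _ => rfl, fun _ _ => mul_comm _ _, fun _ => rfl⟩

theorem isRingInvolution_star : IsRingInvolution (star : ℂ → ℂ) :=
  ⟨star_add, star_mul, star_star⟩

variable {σ : ℂ → ℂ} (hσ : IsRingInvolution σ) {m n : Type} [Fintype m] [DecidableEq m]
  [Fintype n] [DecidableEq n] {A : Matrix m m ℂ} {B : Matrix n n ℂ} {D D' : Multiset (ℕ × ℂ)}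

include hσ in
/-- If two matrices have the same cosquare, then `B⁻¹A` and everything generated by it over the
real numbers is selfadjoint with respect to `B`. -/
theorem exists_selfadjoint_root (hr : ∀ x : ℝ, σ x = x) {A B C : Matrix m m ℂ} (hA : IsUnit A)
    (hB : IsUnit B) (h1 : A = A.transpose.map σ * C) (h2 : B = B.transpose.map σ * C) :
    ∃ e r : Matrix m m ℂ, e ^ 2 = 1 ∧ IsUnit r ∧ Commute e r ∧
      B * e = e.transpose.map σ * B ∧ A = r.transpose.map σ * (B * e) * r := by
  rcases isEmpty_or_nonempty m with hm | hm
  · exact ⟨1, 1, Subsingleton.elim _ _, isUnit_one, Commute.refl _, Subsingleton.elim _ _,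
      Subsingleton.elim _ _⟩
  obtain ⟨B', hB'⟩ := hB.exists_right_inv
  have hB'' := mul_eq_one_comm.1 hB'
  obtain ⟨H, hH⟩ : ∃ H, H = B' * A := ⟨_, rfl⟩
  have hBH : B * H = A := by rw [hH, ← Matrix.mul_assoc, hB', Matrix.one_mul]
  have hHu : IsUnit H := by
    rw [hH]
    exact IsUnit.mul ⟨⟨B', B, hB'', hB'⟩, rfl⟩ hA
  have hHB : H.transpose.map σ * B = A := by
    conv_lhs => rw [h2]
    rw [← Matrix.mul_assoc, ← hσ.adj_mul, hBH, ← h1]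
  have hp : ∀ p : Polynomial ℝ, B * Polynomial.aeval H p =
      (Polynomial.aeval H p).transpose.map σ * B := by
    intro p
    induction p using Polynomial.induction_on' with
    | add p q hp hq =>
      rw [map_add, mul_add, hp, hq, ← add_mul]
      congr 1
      ext i j
      simp [hσ.map_add]
    | monomial k a =>
      have hk : B * H ^ k = (H ^ k).transpose.map σ * B := by
        induction k with
        | zero => rw [pow_zero, hσ.adj_one, Matrix.mul_one, Matrix.one_mul]
        | succ k ih =>
          rw [pow_succ, ← Matrix.mul_assoc, ih, Matrix.mul_assoc, hBH, ← hHB, ← Matrix.mul_assoc,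
            ← hσ.adj_mul, ← pow_succ', pow_succ]
      have ha : (a • H ^ k).transpose.map σ = a • (H ^ k).transpose.map σ := by
        ext i j
        simp only [map_apply, transpose_apply, Matrix.smul_apply, Complex.real_smul, hσ.map_mul, hr]
        exact mul_comm _ _
      rw [Polynomial.aeval_monomial, ← Algebra.smul_def, Matrix.mul_smul, hk, ha, smul_mul]
  obtain ⟨e, r, he, hr⟩ := exists_aeval_sq (Algebra.IsIntegral.isIntegral (R := ℝ) H) hHu
  have heu : IsUnit (Polynomial.aeval H e) := IsUnit.of_pow_eq_one he two_ne_zero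
  have hc : ∀ p q : Polynomial ℝ, Commute (Polynomial.aeval H p) (Polynomial.aeval H q) :=
    fun p q => by rw [Commute, SemiconjBy, ← map_mul, mul_comm, map_mul]
  refine ⟨_, Polynomial.aeval H r, he, ?_, hc _ _, hp e, ?_⟩
  · rw [← isUnit_pow_iff two_ne_zero, hr]
    exact heu.mul hHu
  · have hcH : Commute H (Polynomial.aeval H e) := by simpa using hc Polynomial.X e
    rw [← Matrix.mul_assoc, ← hp, Matrix.mul_assoc, Matrix.mul_assoc, (hc e r).eq,
      ← Matrix.mul_assoc (Polynomial.aeval H r), ← pow_two, hr, Matrix.mul_assoc, hcH.eq,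
      ← Matrix.mul_assoc _ _ H, ← pow_two, he, Matrix.one_mul, hBH]

include hσ in
/-- Matrices with similar cosquares are congruent to matrices with the same cosquare. -/
theorem exists_mEq_cosq (hA : CosqJordan σ A D) (hB : CosqJordan σ B D) :
    ∃ (B' C : Matrix m m ℂ), MEq (some σ) B' B ∧ IsUnit B' ∧ A = A.transpose.map σ * C ∧
      B' = B'.transpose.map σ * C := by
  obtain ⟨-, C, h1, h2⟩ := hA
  obtain ⟨hB, C', h1', h2'⟩ := hB
  obtain ⟨S, S', h3, h4, e⟩ := h2.mEq h2'
  simp only [tw] at e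
  have h5 : S'.transpose.map σ * B * S' * S = S'.transpose.map σ * B := by
    rw [Matrix.mul_assoc, h4, Matrix.mul_one]
  have h6 : MEq (some σ) (S'.transpose.map σ * B * S') B := ⟨S, S', h3, h4, h5⟩
  refine ⟨_, C, h6, h6.isUnit (modeOK_some hσ) hB, h1, ?_⟩
  have h7 : C = S * C' * S' := by rw [← e, Matrix.mul_assoc, h3, Matrix.mul_one]
  rw [h7]
  exact cosq_mEq hσ h1' h3 h4 h5

/-- Complex matrices with similar cosquares are congruent. -/
theorem mEq_id_of_cosqJordan (hA : CosqJordan id A D) (hB : CosqJordan id B D) :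
    MEq (some id) A B := by
  have hσ := isRingInvolution_id (F := ℂ)
  obtain ⟨B', C, h1, h2, h3, h4⟩ := exists_mEq_cosq hσ hA hB
  refine MEq.trans (modeOK_some hσ) ?_ h1
  obtain ⟨e, r, he, hr, -, hBe, h5⟩ := exists_selfadjoint_root hσ (fun _ => rfl) hA.1 h2 h3 h4
  -- over the complex numbers the involution `e` has the square root `f`
  obtain ⟨f, hf⟩ : ∃ f : Matrix m m ℂ, f = ((1 + Complex.I) / 2) • 1 + ((1 - Complex.I) / 2) • e :=
    ⟨_, rfl⟩
  have hff : f * f = e := by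
    rw [hf]
    simp only [mul_add, add_mul, Matrix.smul_mul, Matrix.mul_smul, Matrix.mul_one, Matrix.one_mul,
      smul_smul, ← pow_two e, he]
    have k1 : (1 + Complex.I) / 2 * ((1 + Complex.I) / 2) +
        (1 - Complex.I) / 2 * ((1 - Complex.I) / 2) = 0 := by
      linear_combination (1 / 2) * Complex.I_sq
    have k2 : 2 * ((1 + Complex.I) / 2 * ((1 - Complex.I) / 2)) = 1 := by
      linear_combination (-1 / 2) * Complex.I_sq
    refine Eq.trans (b := ((1 + Complex.I) / 2 * ((1 + Complex.I) / 2) +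
        (1 - Complex.I) / 2 * ((1 - Complex.I) / 2)) • (1 : Matrix m m ℂ) +
        (2 * ((1 + Complex.I) / 2 * ((1 - Complex.I) / 2))) • e) (by module) ?_
    rw [k1, k2, zero_smul, zero_add, one_smul]
  have hBf : B' * f = f.transpose.map id * B' := by
    rw [hf]
    simp only [mul_add, Matrix.mul_smul, hBe, Matrix.mul_one]
    simp [add_mul]
  have hfu : IsUnit f := (isUnit_pow_iff two_ne_zero).1 (by
    rw [pow_two, hff]
    exact IsUnit.of_pow_eq_one he two_ne_zero)
  obtain ⟨s, hs⟩ := (hfu.mul hr).exists_left_inv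
  refine ⟨s, f * r, hs, mul_eq_one_comm.1 hs, ?_⟩
  simp only [tw]
  rw [h5, ← hff, ← Matrix.mul_assoc B', hBf, hσ.adj_mul]
  rw [← Matrix.mul_one (r.transpose.map id * f.transpose.map id * B'), ← mul_eq_one_comm.1 hs]
  simp only [Matrix.mul_assoc]

end Square

/-! ### Splitting off the involution -/

section SignSplit

variable {m n : Type} [Fintype m] [DecidableEq m] [Fintype n] [DecidableEq n]

/-- An involutory matrix is diagonalizable with eigenvalues `-1` and `1`. The Fitting decomposition
of `e - 1` shows this. -/
theorem exists_diag_of_sq_eq_one {e : Matrix m m ℂ} (he : e ^ 2 = 1) :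
    ∃ p q : ℕ, MEq none e (fromBlocks (-1 : Matrix (Fin p) (Fin p) ℂ) 0 0
      (1 : Matrix (Fin q) (Fin q) ℂ)) := by
  have hμ := modeOK_none (F := ℂ)
  have h0 : MEq none e (reindex (Fintype.equivFin m) (Fintype.equivFin m) e) :=
    MEq.of_equiv hμ (Fintype.equivFin m) fun i j => by simp
  obtain ⟨p, K, L, hK, hL, h1⟩ := exists_fitting hμ
    (reindex (Fintype.equivFin m) (Fintype.equivFin m) e + (-1 : ℂ) • 1)
  have h2 : MEq none (e + (-1 : ℂ) • 1) (fromBlocks K 0 0 (nilSum ℂ L).2) := (h0.shift (-1)).trans hμ h1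
  have h3 : (fromBlocks K 0 0 (nilSum ℂ L).2) * (fromBlocks K 0 0 (nilSum ℂ L).2) =
      (-2 : ℂ) • (fromBlocks K 0 0 (nilSum ℂ L).2) := by
    obtain ⟨S, S', k1, k2, k3⟩ := h2
    simp only [tw] at k3
    have k4 : fromBlocks K 0 0 (nilSum ℂ L).2 = S' * (e + (-1 : ℂ) • 1) * S := by
      rw [Matrix.mul_assoc, k3, ← Matrix.mul_assoc, k2, Matrix.one_mul]
    rw [k4]
    calc _ = S' * (e + (-1 : ℂ) • 1) * (S * S') * (e + (-1 : ℂ) • 1) * S := by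
          simp only [Matrix.mul_assoc]
      _ = S' * ((e + (-1 : ℂ) • 1) * (e + (-1 : ℂ) • 1)) * S := by
          rw [k1, Matrix.mul_one]; simp only [Matrix.mul_assoc]
      _ = S' * ((-2 : ℂ) • (e + (-1 : ℂ) • 1)) * S := by
          congr 2
          simp only [mul_add, add_mul, Matrix.mul_smul, Matrix.smul_mul, Matrix.mul_one,
            Matrix.one_mul, ← pow_two e, he, smul_smul]
          module
      _ = _ := by rw [Matrix.mul_smul, Matrix.smul_mul]
  rw [fromBlocks_multiply, fromBlocks_smul, fromBlocks_inj] at h3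
  simp only [Matrix.mul_zero, add_zero, zero_add] at h3
  obtain ⟨h3, -, -, h4⟩ := h3
  have h5 : K = (-2 : ℂ) • 1 := by
    refine hK.mul_left_cancel ?_
    rw [h3, Matrix.mul_smul, Matrix.mul_one]
  have h6 : (nilSum ℂ L).2 = 0 := by
    have hn : IsNilpotent (nilSum ℂ L).2 := by
      refine ⟨L.sum, ((hasJordan_nilSum L hL).pow_eq_zero_iff _).2 ?_⟩
      intro x hx
      rw [Multiset.mem_map] at hx
      obtain ⟨q, hq, rfl⟩ := hx
      exact ⟨rfl, List.le_sum_of_mem hq⟩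
    have hu : IsUnit ((nilSum ℂ L).2 + (2 : ℂ) • 1) := by
      have h7 : IsUnit ((2 : ℂ) • (1 : Matrix (Fin (nilSum ℂ L).1) (Fin (nilSum ℂ L).1) ℂ)) :=
        isUnit_one.smul (Units.mk0 (2 : ℂ) two_ne_zero)
      exact hn.isUnit_add_right_of_commute h7 ((Commute.one_right _).smul_right _)
    refine (hu.mul_left_eq_zero).1 ?_
    rw [mul_add, h4, Matrix.mul_smul, Matrix.mul_one]
    module
  refine ⟨p, (nilSum ℂ L).1, ?_⟩
  have h7 := h2.shift 1
  rw [h5, h6, fromBlocks_shift] at h7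
  convert h7 using 2
  · module
  · module
  · simp

/-- Nonsingular matrices with similar cosquares are `*`congruent up to the signs of direct
summands. -/
theorem exists_mEq_signed {A : Matrix m m ℂ} {B : Matrix n n ℂ} {D : Multiset (ℕ × ℂ)}
    (hA : CosqJordan star A D) (hB : CosqJordan star B D) :
    ∃ (p q : ℕ) (B₁ : Matrix (Fin p) (Fin p) ℂ) (B₂ : Matrix (Fin q) (Fin q) ℂ),
      MEq (some star) B (fromBlocks B₁ 0 0 B₂) ∧ MEq (some star) A (fromBlocks (-B₁) 0 0 B₂) := by
  have hσ := isRingInvolution_star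
  have hμ := modeOK_some hσ
  obtain ⟨B', C, h1, h2, h3, h4⟩ := exists_mEq_cosq hσ hA hB
  obtain ⟨e, r, he, hr, -, hBe, h5⟩ :=
    exists_selfadjoint_root hσ (fun x => Complex.conj_ofReal x) hA.1 h2 h3 h4
  obtain ⟨p, q, S, S', k1, k2, k3⟩ := exists_diag_of_sq_eq_one he
  simp only [tw] at k3
  obtain ⟨E, hE⟩ : ∃ E, E = fromBlocks (-1 : Matrix (Fin p) (Fin p) ℂ) 0 0
      (1 : Matrix (Fin q) (Fin q) ℂ) := ⟨_, rfl⟩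
  rw [← hE] at k3
  have hEE : E.transpose.map star = E := by
    rw [hE, adj_fromBlocks_diag hσ, hσ.adj_one]
    congr 1
    ext i j
    simp [Matrix.one_apply, eq_comm]
  obtain ⟨M, hM⟩ : ∃ M, M = S.transpose.map star * B' * S := ⟨_, rfl⟩
  have h6 : S'.transpose.map star * S.transpose.map star = 1 := by rw [← hσ.adj_mul, k1, hσ.adj_one]
  have hMB : MEq (some star) B' M := by
    refine ⟨S, S', k1, k2, ?_⟩
    simp only [tw]
    rw [hM, ← Matrix.mul_assoc, ← Matrix.mul_assoc, h6, Matrix.one_mul]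
  have hME : M * E = S.transpose.map star * (B' * e) * S := by
    rw [hM, Matrix.mul_assoc, Matrix.mul_assoc, ← k3]
    simp only [Matrix.mul_assoc]
  have hEM : M * E = E * M := by
    have h7 : E * S.transpose.map star = S.transpose.map star * e.transpose.map star := by
      rw [← hσ.adj_mul, k3, hσ.adj_mul, hEE]
    rw [hME, hBe, hM, ← Matrix.mul_assoc, ← Matrix.mul_assoc, ← Matrix.mul_assoc, h7]
  have hMA : MEq (some star) A (M * E) := by
    obtain ⟨s, hs⟩ := hr.exists_left_inv
    have hs' := mul_eq_one_comm.1 hs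
    refine MEq.trans hμ (K' := B' * e) ⟨s, r, hs, hs', ?_⟩ ⟨S, S', k1, k2, ?_⟩
    · simp only [tw]
      rw [h5, Matrix.mul_assoc, hs', Matrix.mul_one]
    · simp only [tw]
      rw [hME, ← Matrix.mul_assoc, ← Matrix.mul_assoc, h6, Matrix.one_mul]
  rw [← fromBlocks_toBlocks M, hE, fromBlocks_multiply, fromBlocks_multiply, fromBlocks_inj] at hEM
  simp only [Matrix.mul_zero, Matrix.zero_mul, Matrix.mul_one, Matrix.one_mul, add_zero, zero_add,
    Matrix.mul_neg, Matrix.neg_mul] at hEM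
  obtain ⟨-, h8, h9, -⟩ := hEM
  have h8' : M.toBlocks₁₂ = 0 := by
    ext i j
    exact self_eq_neg.1 (congrFun (congrFun h8 i) j)
  have h9' : M.toBlocks₂₁ = 0 := by
    ext i j
    exact self_eq_neg.1 (congrFun (congrFun h9.symm i) j)
  have hM' : M = fromBlocks M.toBlocks₁₁ 0 0 M.toBlocks₂₂ := by
    conv_lhs => rw [← fromBlocks_toBlocks M, h8', h9']
  refine ⟨p, q, M.toBlocks₁₁, M.toBlocks₂₂, ?_, ?_⟩
  · rw [← hM']
    exact (h1.symm hμ).trans hμ hMB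
  · convert hMA using 1
    rw [hM', hE, fromBlocks_multiply]
    simp

end SignSplit

/-! ### Parity of the numbers of Jordan blocks of a cosquare -/

section Parity

variable {m n : Type} [Fintype m] [DecidableEq m] [Fintype n] [DecidableEq n]

theorem rank_le_of_eq_mul {m n : Type*} [Fintype m] [Fintype n] {A : Matrix m m ℂ}
    {B : Matrix n n ℂ} {X : Matrix m n ℂ} {Y : Matrix n m ℂ} (h : A = X * B * Y) :
    A.rank ≤ B.rank := by
  rw [h]
  exact (Matrix.rank_mul_le_left _ _).trans (Matrix.rank_mul_le_right _ _)

theorem MEq.rank_eq {A : Matrix m m ℂ} {B : Matrix n n ℂ} (h : MEq none A B) :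
    A.rank = B.rank := by
  obtain ⟨S, S', h1, h2, e⟩ := h
  simp only [tw] at e
  refine le_antisymm (rank_le_of_eq_mul (X := S) (Y := S') ?_)
    (rank_le_of_eq_mul (X := S') (Y := S) ?_)
  · rw [← e, Matrix.mul_assoc, h1, Matrix.mul_one]
  · rw [Matrix.mul_assoc, e, ← Matrix.mul_assoc, h2, Matrix.one_mul]

theorem rank_mul_isUnit_left {U F : Matrix m m ℂ} (hU : IsUnit U) : (U * F).rank = F.rank :=
  Matrix.rank_mul_eq_right_of_isUnit_det _ _ ((Matrix.isUnit_iff_isUnit_det _).1 hU)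

theorem rank_mul_isUnit_right {U F : Matrix m m ℂ} (hU : IsUnit U) : (F * U).rank = F.rank :=
  Matrix.rank_mul_eq_left_of_isUnit_det _ _ ((Matrix.isUnit_iff_isUnit_det _).1 hU)

theorem exists_eq_mul_diagonal_mul (A : Matrix m m ℂ) : ∃ (P Q : Matrix m m ℂ) (d : m → ℂ),
    IsUnit P ∧ IsUnit Q ∧ A = P * diagonal d * Q := by
  obtain ⟨L, L', d, h⟩ := Matrix.Pivot.exists_list_transvec_mul_diagonal_mul_list_transvec A
  refine ⟨_, _, d, ?_, ?_, h⟩ <;>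
  · rw [Matrix.isUnit_iff_isUnit_det, Matrix.TransvectionStruct.det_toMatrix_prod]
    exact isUnit_one

theorem rank_fromBlocks_diag (A : Matrix m m ℂ) (B : Matrix n n ℂ) :
    (fromBlocks A 0 0 B).rank = A.rank + B.rank := by
  classical
  obtain ⟨P, Q, d, hP, hQ, rfl⟩ := exists_eq_mul_diagonal_mul A
  obtain ⟨P', Q', d', hP', hQ', rfl⟩ := exists_eq_mul_diagonal_mul B
  have h : fromBlocks (P * diagonal d * Q) 0 0 (P' * diagonal d' * Q') =
      fromBlocks P 0 0 P' * diagonal (Sum.elim d d') * fromBlocks Q 0 0 Q' := by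
    rw [← fromBlocks_diagonal, fromBlocks_multiply, fromBlocks_multiply]
    simp
  rw [h, rank_mul_isUnit_right (isUnit_fromBlocks hQ hQ'),
    rank_mul_isUnit_left (isUnit_fromBlocks hP hP'), rank_mul_isUnit_right hQ,
    rank_mul_isUnit_left hP, rank_mul_isUnit_right hQ', rank_mul_isUnit_left hP', rank_diagonal,
    rank_diagonal, rank_diagonal, ← Fintype.card_sum]
  exact Fintype.card_congr Equiv.subtypeSum

theorem nilSum_apply (L : List ℕ) (i j : Fin (nilSum ℂ L).1) :
    (nilSum ℂ L).2 i j = 0 ∨ (nilSum ℂ L).2 i j = 1 := by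
  induction L with
  | nil => exact Fin.elim0 i
  | cons q L ih =>
    obtain ⟨i, rfl⟩ := (finSumFinEquiv (m := q) (n := (nilSum ℂ L).1)).surjective i
    obtain ⟨j, rfl⟩ := (finSumFinEquiv (m := q) (n := (nilSum ℂ L).1)).surjective j
    have h : (nilSum ℂ (q :: L)).2 (finSumFinEquiv i) (finSumFinEquiv j) =
        fromBlocks (jordanJ q (0 : ℂ)) 0 0 (nilSum ℂ L).2 i j := by
      change Matrix.reindex finSumFinEquiv finSumFinEquiv (fromBlocks (jordanJ q (0 : ℂ)) 0 0
        (nilSum ℂ L).2) (finSumFinEquiv i) (finSumFinEquiv j) = _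
      rw [reindex_apply, submatrix_apply, Equiv.symm_apply_apply, Equiv.symm_apply_apply]
    erw [h]
    rcases i with i | i <;> rcases j with j | j
    · simp only [fromBlocks_apply₁₁, jordanJ, of_apply]
      split_ifs <;> simp
    · simp
    · simp
    · simpa using ih i j

/-- The regularizing decomposition for congruence reduces this to a nonsingular matrix, where the
determinant decides, and to nilpotent Jordan blocks, which are skew-symmetric only if they
are zero. -/
theorem even_rank_of_skew_fin {n : ℕ} {A : Matrix (Fin n) (Fin n) ℂ} (hA : A.transpose = -A) :
    Even A.rank := by
  have hσ := isRingInvolution_id (F := ℂ)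
  obtain ⟨p, K, L, hK, hL, S, S', h1, h2, e⟩ := exists_fitting (modeOK_some hσ) A
  simp only [tw, map_id] at e
  have h3 : S.transpose * S'.transpose = 1 := by rw [← transpose_mul, h2, transpose_one]
  have h3' : S'.transpose * S.transpose = 1 := by rw [← transpose_mul, h1, transpose_one]
  have h4 : fromBlocks K 0 0 (nilSum ℂ L).2 = S.transpose * A * S := by
    rw [Matrix.mul_assoc, e, ← Matrix.mul_assoc, h3, Matrix.one_mul]
  have h5 : A = S'.transpose * fromBlocks K 0 0 (nilSum ℂ L).2 * S' := by
    rw [← e, Matrix.mul_assoc, h1, Matrix.mul_one]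
  have h6 : (fromBlocks K 0 0 (nilSum ℂ L).2).transpose = -fromBlocks K 0 0 (nilSum ℂ L).2 := by
    rw [h4, transpose_mul, transpose_mul, transpose_transpose, hA]
    simp [Matrix.mul_assoc]
  rw [fromBlocks_transpose, fromBlocks_neg, fromBlocks_inj] at h6
  obtain ⟨h7, -, -, h8⟩ := h6
  have h9 : (nilSum ℂ L).2 = 0 := by
    ext i j
    have := congrFun (congrFun h8 i) j
    rw [transpose_apply, neg_apply] at this
    rcases nilSum_apply L i j with h | h
    · exact h
    · rcases nilSum_apply L j i with h' | h' <;> rw [h, h'] at this <;> norm_num at this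
  have h10 : A.rank = p := by
    rw [le_antisymm (rank_le_of_eq_mul h5) (rank_le_of_eq_mul h4), rank_fromBlocks_diag, h9,
      rank_zero, rank_of_isUnit _ hK, Fintype.card_fin, add_zero]
  rw [h10]
  have h11 := congrArg Matrix.det h7
  rw [det_transpose, det_neg, Fintype.card_fin] at h11
  by_contra hp
  rw [(Nat.not_even_iff_odd.1 hp).neg_one_pow, neg_one_mul] at h11
  have h12 := (Matrix.isUnit_iff_isUnit_det _).1 hK
  rw [self_eq_neg.1 h11] at h12
  exact not_isUnit_zero h12

theorem even_rank_of_skew {A : Matrix m m ℂ} (hA : A.transpose = -A) : Even A.rank := by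
  rw [← rank_reindex (Fintype.equivFin m) (Fintype.equivFin m)]
  refine even_rank_of_skew_fin ?_
  rw [transpose_reindex, hA]
  rfl

theorem rank_jordanJ_zero_pow (q k : ℕ) : (jordanJ q (0 : ℂ) ^ k).rank = q - k := by
  refine le_antisymm ?_ ?_
  · have h := rank_le_card_of_support_subset (jordanJ q (0 : ℂ) ^ k)
      (Finset.univ.filter fun i : Fin q => i.val < q - k) (by
        intro i hi
        simp only [Finset.coe_filter, Finset.mem_univ, true_and, Set.mem_ofPred_eq]
        by_contra hik
        refine hi (funext fun j => ?_)
        rw [row_apply, jordanJ_zero_pow_apply, if_neg (by omega)]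
        rfl)
    refine h.trans ?_
    rw [Fin.card_filter_val_lt]
    omega
  · have h := rank_submatrix_le (jordanJ q (0 : ℂ) ^ k) (fun i : Fin (q - k) => ⟨i.val, by omega⟩)
      (fun i : Fin (q - k) => ⟨i.val + k, by omega⟩)
    refine le_trans (le_of_eq ?_) h
    rw [show (jordanJ q (0 : ℂ) ^ k).submatrix (fun i : Fin (q - k) => ⟨i.val, by omega⟩)
      (fun i : Fin (q - k) => ⟨i.val + k, by omega⟩) = 1 from ?_, rank_one, Fintype.card_fin]
    ext i j
    rw [submatrix_apply, jordanJ_zero_pow_apply]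
    simp [Matrix.one_apply, Fin.ext_iff]

/-- The matrix whose rank detects the parity of the number of Jordan blocks. -/
def rankTest (k : ℕ) (c : ℂ) (C : Matrix m m ℂ) : Matrix m m ℂ :=
  (C + (-c) • 1) ^ k * (C + (-1 : ℂ) • 1)

theorem rankTest_mEq {A : Matrix m m ℂ} {B : Matrix n n ℂ} (h : MEq none A B) (k : ℕ) (c : ℂ) :
    (rankTest k c A).rank = (rankTest k c B).rank := by
  refine MEq.rank_eq ?_
  obtain ⟨S, S', h1, h2, e⟩ := h
  have hs : ∀ a : ℂ, (A + a • 1) * S = S * (B + a • 1) := fun a => by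
    simp only [tw] at e
    rw [Matrix.add_mul, Matrix.mul_add, e]
    simp
  have hp : (A + (-c) • 1) ^ k * S = S * (B + (-c) • 1) ^ k := by
    induction k with
    | zero => simp
    | succ k ih => rw [pow_succ, Matrix.mul_assoc, hs, ← Matrix.mul_assoc, ih, Matrix.mul_assoc,
        ← pow_succ]
  refine ⟨S, S', h1, h2, ?_⟩
  simp only [tw]
  rw [rankTest, Matrix.mul_assoc, hs, ← Matrix.mul_assoc, hp, Matrix.mul_assoc, rankTest]

theorem rankTest_fromBlocks (k : ℕ) (c : ℂ) (A : Matrix m m ℂ) (B : Matrix n n ℂ) :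
    (rankTest k c (fromBlocks A 0 0 B)).rank = (rankTest k c A).rank + (rankTest k c B).rank := by
  rw [← rank_fromBlocks_diag, rankTest, fromBlocks_shift, fromBlocks_shift, fromBlocks_pow,
    fromBlocks_multiply]
  simp [rankTest]

theorem rankTest_jordanJ_of_ne {q k : ℕ} {c a : ℂ} (h : a ≠ c) :
    (rankTest k c (jordanJ q a)).rank = (jordanJ q (a + -1)).rank := by
  rw [rankTest, jordanJ_shift, jordanJ_shift, rank_mul_isUnit_left]
  exact (jordanJ_isUnit (by rwa [← sub_eq_add_neg, sub_ne_zero])).pow k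

theorem rankTest_jordanJ_one (q k : ℕ) :
    (rankTest k 1 (jordanJ q (1 : ℂ))).rank = q - (k + 1) := by
  rw [rankTest, jordanJ_shift, add_neg_cancel, ← pow_succ, rank_jordanJ_zero_pow]

theorem rankTest_jordanJ_neg_one (q k : ℕ) :
    (rankTest k (-1) (jordanJ q (-1 : ℂ))).rank = q - k := by
  rw [rankTest, jordanJ_shift, jordanJ_shift, add_neg_cancel, rank_mul_isUnit_right,
    rank_jordanJ_zero_pow]
  exact jordanJ_isUnit (by norm_num)

/-- Up to parity, the multiplicity of such a Jordan block is the sum of two ranks. -/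
theorem HasJordan.even_rankTest {C : Matrix m m ℂ} {D : Multiset (ℕ × ℂ)} (h : HasJordan C D)
    (k : ℕ) (x : ℕ × ℂ) (hx : x = (k + 2, 1) ∨ x = (k + 1, -1)) :
    Even ((rankTest k x.2 C).rank + (rankTest (k + 2) x.2 C).rank + D.count x) := by
  refine HasJordan.induction (P := fun {m} _ _ C D =>
    Even ((rankTest k x.2 C).rank + (rankTest (k + 2) x.2 C).rank + D.count x)) ?_ ?_ ?_ ?_ h
  · intro m n _ _ _ _ A B D h h'
    rwa [rankTest_mEq h, rankTest_mEq h]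
  · have : ∀ M : Matrix (Fin 0) (Fin 0) ℂ, M.rank = 0 := fun M =>
      Nat.le_zero.1 (M.rank_le_width)
    simp [this]
  · intro q a hq
    rw [Multiset.count_singleton]
    by_cases ha : a = x.2
    · subst ha
      rcases hx with rfl | rfl
      · simp only [rankTest_jordanJ_one]
        simp only [Prod.mk.injEq, and_true]
        split_ifs <;> grind
      · simp only [rankTest_jordanJ_neg_one]
        simp only [Prod.mk.injEq, and_true]
        split_ifs <;> grind
    · rw [rankTest_jordanJ_of_ne ha, rankTest_jordanJ_of_ne ha, if_neg]
      · simp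
      · rintro rfl
        exact ha rfl
  · intro m n _ _ _ _ A B D D' h h'
    rw [rankTest_fromBlocks, rankTest_fromBlocks, Multiset.count_add]
    have h1 := h.add h'
    rw [Nat.even_iff] at h1 ⊢
    omega

/-- These ranks are even for a cosquare `C` of `A`, because multiplication by nonsingular
matrices turns `rankTest` into a skew-symmetric matrix. -/
theorem even_rankTest_cosq {A C : Matrix m m ℂ} (hA : IsUnit A) (h : A = A.transpose * C) {c : ℂ}
    (hc : c * c = 1) (i : ℕ) : Even (rankTest (2 * i) c C).rank := by
  have hC : IsUnit C := isUnit_cosq (σ := id) hA (by simpa using h)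
  have h0 : A.transpose = C.transpose * A := by
    conv_lhs => rw [h, transpose_mul, transpose_transpose]
  obtain ⟨X, hX⟩ : ∃ X, X = C + (-c) • 1 := ⟨_, rfl⟩
  have hXC : Commute X C := by
    rw [hX]
    exact (Commute.refl C).add_left ((Commute.one_left C).smul_left _)
  have h1 : X.transpose * A.transpose * C = (-c) • (A.transpose * X) := by
    have h2 : X.transpose = C.transpose + (-c) • 1 := by
      rw [hX, transpose_add, transpose_smul, transpose_one]
    rw [Matrix.mul_assoc, ← h, h2, hX, Matrix.add_mul, ← h0, Matrix.mul_add, ← h, smul_mul,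
      Matrix.mul_smul, smul_add, smul_smul, Matrix.one_mul, Matrix.mul_one, neg_mul_neg, hc,
      one_smul, add_comm]
  have h2 : ∀ i, (X ^ i).transpose * A.transpose * C ^ i = (-c) ^ i • (A.transpose * X ^ i) := by
    intro i
    induction i with
    | zero => simp
    | succ i ih =>
      calc (X ^ (i + 1)).transpose * A.transpose * C ^ (i + 1)
          = X.transpose * ((X ^ i).transpose * A.transpose * C ^ i) * C := by
            rw [pow_succ X, transpose_mul, pow_succ C]
            simp only [Matrix.mul_assoc]
        _ = (-c) ^ i • ((X.transpose * A.transpose * C) * X ^ i) := by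
            rw [ih, Matrix.mul_smul, smul_mul, Matrix.mul_assoc, Matrix.mul_assoc,
              Matrix.mul_assoc, Matrix.mul_assoc, (hXC.pow_left i).eq]
        _ = _ := by rw [h1, smul_mul, smul_smul, Matrix.mul_assoc, ← pow_succ', ← pow_succ]
  -- the skew-symmetric matrix in question
  obtain ⟨M, hM⟩ : ∃ M, M = (X ^ i).transpose * (A - A.transpose) * X ^ i := ⟨_, rfl⟩
  have h3 : M.transpose = -M := by
    rw [hM, transpose_mul, transpose_mul, transpose_transpose, transpose_sub, transpose_transpose,
      ← neg_sub A]
    simp only [Matrix.mul_neg, Matrix.neg_mul, Matrix.mul_assoc]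
  have h4 : M * C ^ i = ((-c) ^ i • A.transpose) * rankTest (2 * i) c C := by
    have h5 : A - A.transpose = A.transpose * (C + (-1 : ℂ) • 1) := by
      rw [mul_add, ← h, Matrix.mul_smul, Matrix.mul_one, neg_one_smul, sub_eq_add_neg]
    have hC1 : Commute (C + (-1 : ℂ) • 1) C :=
      (Commute.refl C).add_left ((Commute.one_left C).smul_left _)
    have hX1 : Commute (C + (-1 : ℂ) • 1) X := by
      rw [hX]
      exact hC1.add_right ((Commute.one_right _).smul_right _)
    calc M * C ^ i = (X ^ i).transpose * A.transpose * ((C + (-1 : ℂ) • 1) * (X ^ i * C ^ i)) := by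
          rw [hM, h5]; simp only [Matrix.mul_assoc]
      _ = ((X ^ i).transpose * A.transpose * C ^ i) * ((C + (-1 : ℂ) • 1) * X ^ i) := by
          rw [((hXC.pow_left i).pow_right i).eq, ← Matrix.mul_assoc (C + (-1 : ℂ) • 1),
            (hC1.pow_right i).eq]
          simp only [Matrix.mul_assoc]
      _ = _ := by
          rw [h2, (hX1.pow_right i).eq, rankTest, ← hX, two_mul, pow_add, smul_mul, smul_mul]
          simp only [Matrix.mul_assoc]
  have hc0 : -c ≠ 0 := by
    rintro h
    rw [neg_eq_zero] at h
    simp [h] at hc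
  rw [← rank_mul_isUnit_left (U := (-c) ^ i • A.transpose), ← h4,
    rank_mul_isUnit_right (hC.pow i)]
  · exact even_rank_of_skew h3
  · have : IsUnit A.transpose := by simpa using isUnit_adj (isRingInvolution_id (F := ℂ)) hA
    exact this.smul (Units.mk0 _ (pow_ne_zero i hc0))

/-- The blocks that cannot come from a matrix `Γ_n` occur in pairs. -/
theorem CosqJordan.even_count {A : Matrix m m ℂ} {D : Multiset (ℕ × ℂ)} (h : CosqJordan id A D)
    {n : ℕ} (hn : 1 ≤ n) : Even (D.count (n, (-1) ^ n)) := by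
  obtain ⟨hA, C, h1, h2⟩ := h
  rw [map_id] at h1
  have key : ∀ (c : ℂ), c * c = 1 → ∀ i, ((n, c) = (2 * i + 2, (1 : ℂ)) ∨ (n, c) = (2 * i + 1, -1)) →
      Even (D.count (n, c)) := by
    intro c hc i hx
    have h3 := h2.even_rankTest (2 * i) _ hx
    have h4 := even_rankTest_cosq hA h1 hc i
    have h5 := even_rankTest_cosq hA h1 hc (i + 1)
    rw [show 2 * (i + 1) = 2 * i + 2 by ring] at h5
    rwa [Nat.even_add, iff_true_left (h4.add h5)] at h3
  rcases Nat.even_or_odd n with hn' | hn'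
  · rw [hn'.neg_one_pow]
    obtain ⟨i, hi⟩ := hn'
    exact key 1 (by norm_num) (i - 1) (.inl (by rw [Prod.mk.injEq]; exact ⟨by omega, rfl⟩))
  · rw [hn'.neg_one_pow]
    obtain ⟨i, hi⟩ := hn'
    exact key (-1) (by norm_num) i (.inr (by rw [Prod.mk.injEq]; exact ⟨by omega, rfl⟩))

end Parity

/-! ### Canonical forms of nonsingular matrices for congruence -/

section Pairing

variable {α β : Type*} [DecidableEq α]

/-- A multiset that is stable under an involution `f` is made up of orbits of `f`. The orbits are
to be chosen among the values of `data`; the fixed points for which only the repeated orbit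
`{x, x}` is available have to occur with even multiplicity. -/
theorem exists_list_sum_eq (data : β → Multiset α) {f : α → α} (hf : Function.Involutive f)
    (D : Multiset α) (hD : D.map f = D)
    (h1 : ∀ x ∈ D, f x = x → (∃ b, data b = {x}) ∨ ((∃ b, data b = {x, x}) ∧ Even (D.count x)))
    (h2 : ∀ x ∈ D, f x ≠ x → ∃ b, data b = {x, f x}) :
    ∃ L : List β, (L.map data).sum = D := by
  induction hn : Multiset.card D using Nat.strong_induction_on generalizing D with
  | _ N ih =>
  rcases Multiset.empty_or_exists_mem D with rfl | ⟨x, hx⟩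
  · exact ⟨[], rfl⟩
  -- it suffices to split off one value of `data`, an orbit with even or irrelevant multiplicities
  suffices h : ∃ (b : β) (D' : Multiset α), D = data b + D' ∧ D'.map f = D' ∧ data b ≠ 0 ∧
      ∀ y, f y = y → (∃ b, data b = {y}) ∨ Even ((data b).count y) by
    obtain ⟨b, D', rfl, h3, h4, h5⟩ := h
    have h6 : ∀ y ∈ D', f y = y →
        (∃ b, data b = {y}) ∨ ((∃ b, data b = {y, y}) ∧ Even (D'.count y)) := by
      intro y hy hy'
      rcases h1 y (Multiset.mem_add.2 (.inr hy)) hy' with h6 | ⟨h6, h7⟩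
      · exact .inl h6
      · refine (h5 y hy').imp id fun h8 => ⟨h6, ?_⟩
        rw [Multiset.count_add, Nat.even_add] at h7
        exact h7.1 h8
    obtain ⟨L, hL⟩ := ih (Multiset.card D') (by
      rw [← hn, Multiset.card_add]
      have := Multiset.card_pos.2 h4
      omega) D' h3 h6 (fun y hy => h2 y (Multiset.mem_add.2 (.inr hy))) rfl
    exact ⟨b :: L, by rw [List.map_cons, List.sum_cons, hL]⟩
  by_cases hfx : f x = x
  · rcases h1 x hx hfx with ⟨b, hb⟩ | ⟨⟨b, hb⟩, he⟩
    · obtain ⟨D', rfl⟩ := Multiset.exists_cons_of_mem hx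
      refine ⟨b, D', by rw [hb]; rfl, ?_, by simp [hb], fun y hy => ?_⟩
      · rw [Multiset.map_cons, hfx] at hD
        exact Multiset.cons_inj_right _ |>.1 hD
      · by_cases hyx : y = x
        · exact .inl ⟨b, by rw [hb, hyx]⟩
        · right
          rw [hb, Multiset.count_singleton, if_neg hyx]
          exact Even.zero
    · obtain ⟨D', rfl⟩ := Multiset.exists_cons_of_mem hx
      have hx' : x ∈ D' := by
        rw [← Multiset.count_pos]
        rw [Multiset.count_cons_self] at he
        rcases Nat.eq_zero_or_pos (D'.count x) with h | h
        · rw [h] at he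
          exact absurd he (by decide)
        · exact h
      obtain ⟨D'', rfl⟩ := Multiset.exists_cons_of_mem hx'
      refine ⟨b, D'', by simp [hb, Multiset.insert_eq_cons], ?_, by simp [hb], fun y _ => .inr ?_⟩
      · rw [Multiset.map_cons, Multiset.map_cons, hfx] at hD
        exact Multiset.cons_inj_right _ |>.1 (Multiset.cons_inj_right _ |>.1 hD)
      · rw [hb]
        by_cases hyx : y = x
        · subst hyx
          simp
        · simp [Multiset.count_singleton, Multiset.count_cons, hyx]
  · obtain ⟨b, hb⟩ := h2 x hx hfx
    have hfD : f x ∈ D := by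
      rw [← hD]
      exact Multiset.mem_map_of_mem f hx
    obtain ⟨D', rfl⟩ := Multiset.exists_cons_of_mem hx
    have hfD' : f x ∈ D' := (Multiset.mem_cons.1 hfD).resolve_left hfx
    obtain ⟨D'', rfl⟩ := Multiset.exists_cons_of_mem hfD'
    refine ⟨b, D'', by simp [hb, Multiset.insert_eq_cons], ?_, by simp [hb], fun y hy => .inr ?_⟩
    · rw [Multiset.map_cons, Multiset.map_cons, hf x, Multiset.cons_swap] at hD
      exact Multiset.cons_inj_right _ |>.1 (Multiset.cons_inj_right _ |>.1 hD)
    · rw [hb]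
      have h3 : y ≠ x := by
        rintro rfl
        exact hfx hy
      have h4 : y ≠ f x := by
        rintro rfl
        exact hfx (hf.injective hy)
      simp [Multiset.count_singleton, Multiset.count_cons, h3, h4]

/-- If two blocks whose data meet are related, then the data determine a multiset of blocks up to
this relation. -/
theorem rel_of_sum_eq {data : β → Multiset α} {r : β → β → Prop} (h0 : ∀ b, data b ≠ 0)
    (h1 : ∀ b b' x, x ∈ data b → x ∈ data b' → r b b')
    (h2 : ∀ b b', r b b' → data b = data b') (s s' : Multiset β) :
    (s.map data).sum = (s'.map data).sum ↔ Multiset.Rel r s s' := by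
  constructor
  · intro h
    induction s using Multiset.induction generalizing s' with
    | empty =>
      obtain rfl : s' = 0 := by
        refine Multiset.eq_zero_of_forall_notMem fun b hb => ?_
        obtain ⟨t, rfl⟩ := Multiset.exists_cons_of_mem hb
        rw [Multiset.map_cons, Multiset.sum_cons, Multiset.map_zero, Multiset.sum_zero, eq_comm,
          add_eq_zero] at h
        exact h0 b h.1
      exact Multiset.Rel.zero
    | cons b s ih =>
      obtain ⟨x, hx⟩ := Multiset.exists_mem_of_ne_zero (h0 b)
      have hx' : x ∈ (s'.map data).sum := by
        rw [← h, Multiset.map_cons, Multiset.sum_cons]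
        exact Multiset.mem_add.2 (.inl hx)
      obtain ⟨b', hb', hxt⟩ : ∃ b' ∈ s', x ∈ data b' := by
        by_contra hcon
        push Not at hcon
        refine absurd hx' ?_
        clear * - hcon
        induction s' using Multiset.induction with
        | empty => simp
        | cons a t ih =>
          rw [Multiset.map_cons, Multiset.sum_cons, Multiset.mem_add]
          rintro (h | h)
          · exact hcon a (Multiset.mem_cons_self _ _) h
          · exact ih (fun b hb => hcon b (Multiset.mem_cons_of_mem hb)) h
      obtain ⟨s', rfl⟩ := Multiset.exists_cons_of_mem hb'
      have hr := h1 b b' x hx hxt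
      refine Multiset.Rel.cons hr (ih s' ?_)
      rw [Multiset.map_cons, Multiset.map_cons, Multiset.sum_cons, Multiset.sum_cons, h2 _ _ hr] at h
      exact add_left_cancel h
  · intro h
    induction h with
    | zero => rfl
    | cons hr _ ih =>
      rw [Multiset.map_cons, Multiset.map_cons, Multiset.sum_cons, Multiset.sum_cons, h2 _ _ hr, ih]

end Pairing

section Congruence

theorem cosqJordan_dsumMat {β : Type*} {σ : ℂ → ℂ} (hσ : IsRingInvolution σ) {f : β → SqMat ℂ}
    {data : β → Multiset (ℕ × ℂ)} (h : ∀ b, CosqJordan σ (f b).2 (data b)) (L : List β) :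
    CosqJordan σ (dsumMat (L.map f)).2 (L.map data).sum := by
  induction L with
  | nil =>
    have := isEmpty_dsumMat_nil (F := ℂ)
    exact CosqJordan.empty (m := Fin (dsumMat ([] : List (SqMat ℂ))).1) _
  | cons b L ih =>
    rw [List.map_cons, List.map_cons, List.sum_cons]
    exact ((h b).sum hσ ih).of_mEq hσ
      ((MEq.dsumMat_cons (modeOK_some hσ) _ _).symm (modeOK_some hσ))

/-- The matrix of a block for congruence. -/
def CongBlock.toMat : CongBlock → SqMat ℂ
  | .gam n _ => ⟨n, Gam n⟩
  | .hyp n _ c _ _ => ⟨n + n, hyperbolicH n c⟩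

/-- The Jordan blocks of the cosquare of a block for congruence. -/
noncomputable def CongBlock.data : CongBlock → Multiset (ℕ × ℂ)
  | .gam n _ => {(n, (-1) ^ (n + 1))}
  | .hyp n _ c _ _ => {(n, c), (n, c⁻¹)}

theorem inv_neg_one_pow (n : ℕ) : ((-1 : ℂ) ^ n)⁻¹ = (-1) ^ n := by
  rcases neg_one_pow_eq_or ℂ n with h | h <;> rw [h] <;> norm_num

theorem CongBlock.cosqJordan (b : CongBlock) : CosqJordan id b.toMat.2 b.data := by
  have hσ := isRingInvolution_id (F := ℂ)
  cases b with
  | gam n hn =>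
    have := cosqJordan_gam hσ hn one_ne_zero
    rw [one_smul, id, one_mul, one_div, inv_neg_one_pow] at this
    exact this
  | hyp n hn c h0 h1 => exact cosqJordan_hyp hσ n hn h0

theorem CongBlock.same_of_mem (b b' : CongBlock) (x : ℕ × ℂ) (hx : x ∈ b.data) (hx' : x ∈ b'.data) :
    b.Same b' := by
  have inv_eq : ∀ {c : ℂ} {n : ℕ}, c⁻¹ = (-1) ^ (n + 1) → c = (-1) ^ (n + 1) := fun {c n} h => by
    rw [← inv_inv c, h, inv_neg_one_pow]
  cases b with
  | gam n hn =>
    obtain rfl := Multiset.mem_singleton.1 hx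
    cases b' with
    | gam n' hn' =>
      have := Multiset.mem_singleton.1 hx'
      exact (Prod.ext_iff.1 this).1
    | hyp n' hn' c h0 h1 =>
      simp only [data, Multiset.insert_eq_cons, Multiset.mem_cons, Multiset.mem_singleton,
        Prod.mk.injEq] at hx'
      obtain ⟨rfl, h⟩ | ⟨rfl, h⟩ := hx'
      · exact (h1 h.symm).elim
      · exact (h1 (inv_eq h.symm)).elim
  | hyp n hn c h0 h1 =>
    simp only [data, Multiset.insert_eq_cons, Multiset.mem_cons, Multiset.mem_singleton] at hx
    cases b' with
    | gam n' hn' =>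
      obtain rfl := Multiset.mem_singleton.1 hx'
      simp only [Prod.mk.injEq] at hx
      obtain ⟨rfl, h⟩ | ⟨rfl, h⟩ := hx
      · exact (h1 h.symm).elim
      · exact (h1 (inv_eq h.symm)).elim
    | hyp n' hn' c' h0' h1' =>
      simp only [data, Multiset.insert_eq_cons, Multiset.mem_cons, Multiset.mem_singleton] at hx'
      rcases hx with rfl | rfl <;> simp only [Prod.mk.injEq] at hx' <;>
        rcases hx' with ⟨rfl, rfl⟩ | ⟨rfl, h⟩
      · exact ⟨rfl, .inl rfl⟩
      · exact ⟨rfl, .inr (by rw [h, inv_inv])⟩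
      · exact ⟨rfl, .inr rfl⟩
      · exact ⟨rfl, .inl (inv_injective h).symm⟩

theorem CongBlock.data_eq_of_same (b b' : CongBlock) (h : b.Same b') : b.data = b'.data := by
  cases b <;> cases b'
  · obtain rfl : _ = _ := h
    rfl
  · exact h.elim
  · exact h.elim
  · obtain ⟨rfl, rfl | rfl⟩ := h
    · rfl
    · simp only [data, inv_inv]
      exact Multiset.cons_swap _ _ _

/-- The cosquare determines the blocks for congruence, up to replacing `λ` by `λ⁻¹`. -/
theorem congBlocks_unique (Ks Ks' : List CongBlock) :
    MEq (some id) (dsumMat (Ks.map CongBlock.toMat)).2 (dsumMat (Ks'.map CongBlock.toMat)).2 ↔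
      Multiset.Rel CongBlock.Same (Ks : Multiset CongBlock) (Ks' : Multiset CongBlock) := by
  have hσ := isRingInvolution_id (F := ℂ)
  classical
  rw [← rel_of_sum_eq (data := CongBlock.data) (fun b => by cases b <;> simp [CongBlock.data])
    CongBlock.same_of_mem CongBlock.data_eq_of_same]
  simp only [Multiset.map_coe, Multiset.sum_coe]
  have h := cosqJordan_dsumMat hσ CongBlock.cosqJordan Ks
  have h' := cosqJordan_dsumMat hσ CongBlock.cosqJordan Ks'
  exact ⟨fun e => h.unique hσ (h'.of_mEq hσ e), fun e => mEq_id_of_cosqJordan h (e ▸ h')⟩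

/-- The Jordan form of the cosquare is stable under inversion of the eigenvalues, and the parity
condition on blocks `J_n((-1)^n)` allows to combine these into cosquares of `H_{2n}((-1)^n)`. -/
theorem exists_congBlocks (n : ℕ) (K : Matrix (Fin n) (Fin n) ℂ) (hK : IsUnit K) :
    ∃ Ks : List CongBlock, MEq (some id) K (dsumMat (Ks.map CongBlock.toMat)).2 := by
  have hσ := isRingInvolution_id (F := ℂ)
  classical
  obtain ⟨D, hD⟩ := exists_cosqJordan hσ hK
  have hq : ∀ x ∈ D, 1 ≤ x.1 := by
    obtain ⟨-, C, -, h⟩ := hD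
    exact h.1
  suffices h : ∃ Ks : List CongBlock, (Ks.map CongBlock.data).sum = D by
    obtain ⟨Ks, hKs⟩ := h
    refine ⟨Ks, mEq_id_of_cosqJordan hD ?_⟩
    rw [← hKs]
    exact cosqJordan_dsumMat hσ CongBlock.cosqJordan Ks
  refine exists_list_sum_eq CongBlock.data (f := fun x : ℕ × ℂ => (x.1, x.2⁻¹))
    (fun x => by simp) D (hD.map_eq hσ) ?_ ?_
  · rintro ⟨n, c⟩ hx hc
    simp only [Prod.mk.injEq, true_and] at hc
    have h0 := hD.ne_zero hx
    have h1 : c ^ 2 = 1 := by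
      rw [pow_two]
      nth_rewrite 1 [← hc]
      exact inv_mul_cancel₀ h0
    by_cases h : c = (-1) ^ (n + 1)
    · exact .inl ⟨.gam n (hq _ hx), by simp only [h, CongBlock.data]⟩
    · have h2 : c = (-1) ^ n := by
        rw [sq_eq_one_iff] at h1
        rcases h1 with rfl | rfl <;>
        rcases neg_one_pow_eq_or ℂ n with h3 | h3 <;> simp_all [pow_succ]
      refine .inr ⟨⟨.hyp n (hq _ hx) c h0 h, ?_⟩, ?_⟩
      · rw [CongBlock.data, hc]
      · rw [h2]
        exact hD.even_count (hq _ hx)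
  · rintro ⟨n, c⟩ hx hc
    refine ⟨.hyp n (hq _ hx) c (hD.ne_zero hx) ?_, rfl⟩
    rintro rfl
    exact hc (by rw [inv_neg_one_pow])

end Congruence

/-! ### Canonical forms of nonsingular matrices for `*`congruence: existence -/

section StarExistence

/-- The matrix of a block for `*`congruence. -/
def StarBlock.toMat (G : ∀ n : ℕ, Matrix (Fin n) (Fin n) ℂ) : StarBlock → SqMat ℂ
  | .unim n _ c _ => ⟨n, c • G n⟩
  | .hyp n _ c _ => ⟨n + n, hyperbolicH n c⟩

/-- The common features of the families `Γ_n` and `Δ_n`: up to a scalar factor, the matrix and its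
adjoint are obtained from `1 + β J_n(0)` and `1 - β J_n(0)` by the same antidiagonal matrix. -/
structure IsStarFamily (G : ∀ n : ℕ, Matrix (Fin n) (Fin n) ℂ) (s β : ℂ) (ε : ℕ → ℂ) : Prop where
  s_ne_zero : s ≠ 0
  β_ne_zero : β ≠ 0
  ε_sq : ∀ n, ε n * ε n = 1
  eq : ∀ n, G n = antidiag s n * (1 + β • jordanJ n 0)
  adj_eq : ∀ n, 1 ≤ n → ∀ c : ℂ, (c • G n).transpose.map star =
    (star c * ε n) • (antidiag s n * (1 - β • jordanJ n 0))

theorem isStarFamily_gam : IsStarFamily Gam (-1) 1 fun n => (-1) ^ (n + 1) where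
  s_ne_zero := by simp
  β_ne_zero := one_ne_zero
  ε_sq n := by rw [← mul_pow]; simp
  eq := gam_eq
  adj_eq _ hn := gam_smul_adj isRingInvolution_star hn

theorem isStarFamily_del : IsStarFamily Del 1 Complex.I fun _ => 1 where
  s_ne_zero := one_ne_zero
  β_ne_zero := Complex.I_ne_zero
  ε_sq _ := one_mul 1
  eq := del_eq
  adj_eq n _ c := by
    have h : (c • Del n).transpose.map star = star c • (Del n).transpose.map star := by
      ext i j
      simp
    rw [h, del_adj_eq, smul_smul]

theorem exists_isStarFamily {G : ∀ n : ℕ, Matrix (Fin n) (Fin n) ℂ} (hG : G = Gam ∨ G = Del) :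
    ∃ s β ε, IsStarFamily G s β ε := by
  rcases hG with rfl | rfl
  · exact ⟨_, _, _, isStarFamily_gam⟩
  · exact ⟨_, _, _, isStarFamily_del⟩

/-- The Jordan blocks of the cosquare of a block for `*`congruence. -/
noncomputable def StarBlock.data (ε : ℕ → ℂ) : StarBlock → Multiset (ℕ × ℂ)
  | .unim n _ c _ => {(n, c ^ 2 * ε n)}
  | .hyp n _ c _ => {(n, c), (n, (star c)⁻¹)}

/-- The block for `*`congruence that is `*`congruent to the negative of a given one. -/
def StarBlock.neg : StarBlock → StarBlock
  | .unim n hn c hc => .unim n hn (-c) (by rwa [norm_neg])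
  | .hyp n hn c hc => .hyp n hn c hc

theorem star_eq_inv {c : ℂ} (hc : ‖c‖ = 1) : star c = c⁻¹ := by
  rw [Complex.inv_def, Complex.normSq_eq_norm_sq, hc]
  simp

theorem norm_eq_one_of_star {c : ℂ} (h0 : c ≠ 0) (hc : (star c)⁻¹ = c) : ‖c‖ = 1 := by
  have h := congrArg norm hc
  rw [norm_inv, norm_star] at h
  have h1 : ‖c‖ ≠ 0 := norm_ne_zero_iff.2 h0
  have h2 : ‖c‖ * ‖c‖ = 1 := by
    nth_rewrite 1 [← h]
    exact inv_mul_cancel₀ h1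
  nlinarith [norm_nonneg c]

variable {G : ∀ n : ℕ, Matrix (Fin n) (Fin n) ℂ} {s β : ℂ} {ε : ℕ → ℂ}

theorem IsStarFamily.ε_ne_zero (hG : IsStarFamily G s β ε) (n : ℕ) : ε n ≠ 0 :=
  left_ne_zero_of_mul_eq_one (hG.ε_sq n)

theorem IsStarFamily.norm_ε (hG : IsStarFamily G s β ε) (n : ℕ) : ‖ε n‖ = 1 := by
  have := congrArg norm (hG.ε_sq n)
  rw [norm_mul, norm_one] at this
  nlinarith [norm_nonneg (ε n)]

theorem IsStarFamily.div_eq (hG : IsStarFamily G s β ε) {c : ℂ} (hc : ‖c‖ = 1) (n : ℕ) :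
    c / (star c * ε n) = c ^ 2 * ε n := by
  have hc0 : c ≠ 0 := fun h => by simp [h] at hc
  rw [star_eq_inv hc, div_eq_iff (mul_ne_zero (inv_ne_zero hc0) (hG.ε_ne_zero n))]
  field_simp
  rw [pow_two, hG.ε_sq]

theorem IsStarFamily.cosqJordan (hG : IsStarFamily G s β ε) (b : StarBlock) :
    CosqJordan star (b.toMat G).2 (b.data ε) := by
  have hσ := isRingInvolution_star
  cases b with
  | unim n hn c hc =>
    have hc0 : c ≠ 0 := fun h => by simp [h] at hc
    have := cosqJordan_of_nilpotent hn (antidiag_isUnit hG.s_ne_zero n) hc0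
      (mul_ne_zero (star_ne_zero.2 hc0) (hG.ε_ne_zero n)) hG.β_ne_zero (by rw [hG.eq])
      (hG.adj_eq n hn c)
    rw [hG.div_eq hc] at this
    exact this
  | hyp n hn c hc =>
    exact cosqJordan_hyp hσ n hn fun h => by
      rw [h, norm_zero] at hc
      exact absurd hc (by norm_num)

theorem MEq.neg {σ : ℂ → ℂ} {m n : Type*} [Fintype m] [Fintype n] [DecidableEq m]
    [DecidableEq n] {A : Matrix m m ℂ} {B : Matrix n n ℂ} (h : MEq (some σ) A B) :
    MEq (some σ) (-A) (-B) := by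
  obtain ⟨S, S', h1, h2, e⟩ := h
  exact ⟨S, S', h1, h2, by rw [Matrix.neg_mul, e, Matrix.mul_neg]⟩

theorem hyperbolicH_mEq {σ : ℂ → ℂ} (hσ : IsRingInvolution σ) (n : ℕ) (c : ℂ) :
    MEq (some σ) (hyperbolicH n c) (fromBlocks 0 1 (jordanJ n c) 0) :=
  MEq.of_equiv (modeOK_some hσ) finSumFinEquiv.symm fun i j => by simp [hyperbolicH]

theorem hyperbolicH_neg {σ : ℂ → ℂ} (hσ : IsRingInvolution σ) (n : ℕ) (c : ℂ) :
    MEq (some σ) (-hyperbolicH n c) (hyperbolicH n c) := by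
  have hμ := modeOK_some hσ
  have h := hyperbolicH_mEq hσ n c
  refine h.neg.trans hμ (MEq.trans hμ ?_ (h.symm hμ))
  have h1 : (fromBlocks (1 : Matrix (Fin n) (Fin n) ℂ) 0 0 (-1 : Matrix (Fin n) (Fin n) ℂ)) *
      fromBlocks 1 0 0 (-1) = 1 := by
    rw [fromBlocks_multiply]
    simp
  refine ⟨_, _, h1, h1, ?_⟩
  have h2 : (-1 : Matrix (Fin n) (Fin n) ℂ).transpose.map σ = -1 := by
    ext i j
    simp only [map_apply, transpose_apply, Matrix.neg_apply, Matrix.one_apply, sigma_neg hσ,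
      eq_comm (a := j)]
    split_ifs <;> simp [hσ.map_one, hσ.map_zero]
  simp only [tw]
  rw [adj_fromBlocks_diag hσ, hσ.adj_one, h2, fromBlocks_neg, fromBlocks_multiply,
    fromBlocks_multiply]
  simp

theorem StarBlock.neg_mEq (G : ∀ n : ℕ, Matrix (Fin n) (Fin n) ℂ) (b : StarBlock) :
    MEq (some star) (-(b.toMat G).2) (b.neg.toMat G).2 := by
  have hσ := isRingInvolution_star
  cases b with
  | unim n hn c hc =>
    simp only [toMat, StarBlock.neg, neg_smul]
    exact MEq.refl (modeOK_some hσ) _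
  | hyp n hn c hc => exact hyperbolicH_neg hσ n c

theorem MEq.dsumMat_map {β γ : Type*} {μ : Option (ℂ → ℂ)} (hμ : ModeOK μ) {f : β → SqMat ℂ}
    {g : γ → SqMat ℂ} {φ : β → γ} (h : ∀ b, MEq μ (f b).2 (g (φ b)).2) (L : List β) :
    MEq μ (dsumMat (L.map f)).2 (dsumMat ((L.map φ).map g)).2 := by
  induction L with
  | nil => exact MEq.refl hμ _
  | cons b L ih =>
    exact ((MEq.dsumMat_cons hμ _ _).symm hμ).trans hμ (((h b).sum hμ ih).trans hμ
      (MEq.dsumMat_cons hμ _ _))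

theorem dsumMat_neg (f : StarBlock → SqMat ℂ) (L : List StarBlock) :
    MEq (some star) (-(dsumMat (L.map f)).2)
      (dsumMat (L.map fun b => (⟨(f b).1, -(f b).2⟩ : SqMat ℂ))).2 := by
  have hμ := modeOK_some isRingInvolution_star
  induction L with
  | nil =>
    have := isEmpty_dsumMat_nil (F := ℂ)
    exact MEq.of_isEmpty (m := Fin (dsumMat ([] : List (SqMat ℂ))).1)
      (n := Fin (dsumMat ([] : List (SqMat ℂ))).1) hμ _ _
  | cons b L ih =>
    refine ((MEq.dsumMat_cons hμ _ _).symm hμ).neg.trans hμ (MEq.trans hμ ?_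
      (MEq.dsumMat_cons hμ _ _))
    rw [fromBlocks_neg, neg_zero, neg_zero]
    exact (MEq.refl hμ _).sum hμ ih

theorem isUnit_of_fromBlocks {m n : Type*} [Fintype m] [Fintype n] [DecidableEq m]
    [DecidableEq n] {A : Matrix m m ℂ} {B : Matrix n n ℂ} (h : IsUnit (fromBlocks A 0 0 B)) :
    IsUnit A ∧ IsUnit B := by
  rw [Matrix.isUnit_iff_isUnit_det, Matrix.det_fromBlocks_zero₂₁, IsUnit.mul_iff] at h
  exact ⟨(Matrix.isUnit_iff_isUnit_det _).2 h.1, (Matrix.isUnit_iff_isUnit_det _).2 h.2⟩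

/-- Every nonsingular matrix has the same cosquare, up to similarity, as a block-direct sum of
canonical blocks. -/
theorem exists_starBlocks_data (hG : IsStarFamily G s β ε) {D : Multiset (ℕ × ℂ)} {m : Type}
    [Fintype m] [DecidableEq m] {A : Matrix m m ℂ} (hD : CosqJordan star A D) :
    ∃ Ks : List StarBlock, (Ks.map (StarBlock.data ε)).sum = D := by
  classical
  have hσ := isRingInvolution_star
  have hq : ∀ x ∈ D, 1 ≤ x.1 := by
    obtain ⟨-, C, -, h⟩ := hD
    exact h.1
  refine exists_list_sum_eq (StarBlock.data ε) (f := fun x : ℕ × ℂ => (x.1, (star x.2)⁻¹))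
    (fun x => by simp) D (hD.map_eq hσ) ?_ ?_
  · rintro ⟨n, c⟩ hx hc
    simp only [Prod.mk.injEq, true_and] at hc
    have h0 : c ≠ 0 := hD.ne_zero hx
    have h1 := norm_eq_one_of_star h0 hc
    obtain ⟨d, hd⟩ := IsAlgClosed.exists_pow_nat_eq (c * ε n) two_pos
    have h2 : ‖d‖ = 1 := by
      have := congrArg norm hd
      rw [norm_pow, norm_mul, h1, hG.norm_ε, mul_one] at this
      nlinarith [norm_nonneg d]
    refine .inl ⟨.unim n (hq _ hx) d h2, ?_⟩
    rw [StarBlock.data, hd, mul_assoc, hG.ε_sq, mul_one]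
  · rintro ⟨n, c⟩ hx hc
    have h0 : c ≠ 0 := hD.ne_zero hx
    rcases lt_trichotomy ‖c‖ 1 with h | h | h
    · refine ⟨.hyp n (hq _ hx) (star c)⁻¹ ?_, ?_⟩
      · rw [norm_inv, norm_star]
        exact (one_lt_inv₀ (norm_pos_iff.2 h0)).2 h
      · rw [StarBlock.data, star_inv₀, star_star, inv_inv]
        exact Multiset.cons_swap _ _ _
    · rw [star_eq_inv h, inv_inv] at hc
      exact (hc rfl).elim
    · exact ⟨.hyp n (hq _ hx) c h, rfl⟩

/-- A matrix has the cosquare of a sum of canonical blocks. By `exists_mEq_signed` it is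
`*`congruent to that sum, to its negative, or to a direct sum of smaller matrices. -/
theorem exists_starBlocks (hG : IsStarFamily G s β ε) {m : Type} [Fintype m]
    [DecidableEq m] (K : Matrix m m ℂ)
    (hK : IsUnit K) :
    ∃ Ks : List StarBlock, MEq (some star) K (dsumMat (Ks.map (StarBlock.toMat G))).2 := by
  have hσ := isRingInvolution_star
  have hμ := modeOK_some hσ
  induction hN : Fintype.card m using Nat.strong_induction_on generalizing m with
  | _ N ih =>
  obtain ⟨D, hD⟩ := exists_cosqJordan hσ hK
  obtain ⟨Ks, rfl⟩ := exists_starBlocks_data hG hD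
  have hB := cosqJordan_dsumMat hσ hG.cosqJordan Ks
  obtain ⟨p, q, B₁, B₂, h1, h2⟩ := exists_mEq_signed hD hB
  have h3 := h2.card_eq
  simp only [Fintype.card_sum, Fintype.card_fin, hN] at h3
  rcases Nat.eq_zero_or_pos p with rfl | hp
  · refine ⟨Ks, h2.trans hμ (MEq.trans hμ ?_ (h1.symm hμ))⟩
    exact (MEq.of_isEmpty hμ _ _).sum hμ (MEq.refl hμ _)
  rcases Nat.eq_zero_or_pos q with rfl | hq
  · refine ⟨Ks.map StarBlock.neg, h2.trans hμ ?_⟩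
    have h4 := (h1.symm hμ).neg.trans hμ ((dsumMat_neg _ Ks).trans hμ
      (MEq.dsumMat_map hμ (g := StarBlock.toMat G) (φ := StarBlock.neg)
        (fun b => StarBlock.neg_mEq G b) Ks))
    refine MEq.trans hμ ?_ h4
    rw [fromBlocks_neg, neg_zero, neg_zero]
    exact (MEq.refl hμ _).sum hμ (MEq.of_isEmpty hμ _ _)
  · have h5 := isUnit_of_fromBlocks ((h2.symm hμ).isUnit hμ hK)
    obtain ⟨L, hL⟩ := ih p (by omega) (-B₁) h5.1 (Fintype.card_fin p)
    obtain ⟨L', hL'⟩ := ih q (by omega) B₂ h5.2 (Fintype.card_fin q)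
    refine ⟨L ++ L', h2.trans hμ ((hL.sum hμ hL').trans hμ ?_)⟩
    rw [List.map_append]
    exact MEq.dsumMat_append hμ _ _

end StarExistence

/-! ### The signs in canonical forms for `*`congruence -/

section PosIndex

/-- `PosIndex M Y k` says that the kernel of `Y` is the direct sum of a `k`-dimensional subspace
(spanned by the columns of `P`), on which the real part of `v^* M v` is positive definite, and a
subspace (spanned by the columns of `Q`), on which it is nowhere positive. -/
def PosIndex {m : Type} [Fintype m] (M Y : Matrix m m ℂ) (k : ℕ) : Prop :=
  ∃ (ι κ : Type) (_ : Fintype ι) (_ : Fintype κ) (P : Matrix m ι ℂ) (Q : Matrix m κ ℂ),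
    Fintype.card ι = k ∧ Y * P = 0 ∧ Y * Q = 0 ∧
    (∀ v, Y *ᵥ v = 0 → ∃ a b, v = P *ᵥ a + Q *ᵥ b) ∧
    (∀ a, a ≠ 0 → 0 < (star (P *ᵥ a) ⬝ᵥ M *ᵥ (P *ᵥ a)).re) ∧
    (∀ b, (star (Q *ᵥ b) ⬝ᵥ M *ᵥ (Q *ᵥ b)).re ≤ 0) ∧ ∀ b, Q *ᵥ b = 0 → b = 0

variable {m n : Type} [Fintype m] [Fintype n] [DecidableEq m] [DecidableEq n]
  {M Y : Matrix m m ℂ} {k k' : ℕ}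

/-- A positive definite subspace meets a nowhere positive one in zero only, so that its dimension is
at most the codimension of the latter. -/
theorem PosIndex.le (h : PosIndex M Y k) (h' : PosIndex M Y k') : k ≤ k' := by
  obtain ⟨ι, κ, _, _, P, Q, rfl, hP, -, -, h1, -, -⟩ := h
  obtain ⟨ι', κ', _, _, P', Q', rfl, hP', hQ', h4, -, h5, h6⟩ := h'
  let f : (ι → ℂ) × (κ' → ℂ) →ₗ[ℂ] LinearMap.ker Y.mulVecLin :=
    LinearMap.codRestrict _ (P.mulVecLin.coprod Q'.mulVecLin) fun x => by
      simp [Matrix.mulVec_add, hP, hQ']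
  let g : (ι' → ℂ) × (κ' → ℂ) →ₗ[ℂ] LinearMap.ker Y.mulVecLin :=
    LinearMap.codRestrict _ (P'.mulVecLin.coprod Q'.mulVecLin) fun x => by
      simp [Matrix.mulVec_add, hP', hQ']
  have hf : Function.Injective f := by
    rw [← LinearMap.ker_eq_bot, LinearMap.ker_eq_bot']
    rintro ⟨a, b⟩ hab
    have h7 : P *ᵥ a + Q' *ᵥ b = 0 := congrArg Subtype.val hab
    have h8 : P *ᵥ a = Q' *ᵥ (-b) := by rw [Matrix.mulVec_neg, eq_neg_of_add_eq_zero_left h7]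
    have ha : a = 0 := by
      by_contra ha
      have h9 := h1 a ha
      rw [h8] at h9
      exact absurd (h5 (-b)) (not_le.2 h9)
    rw [ha, Matrix.mulVec_zero, zero_add] at h7
    rw [ha, h6 b h7]
    rfl
  have hg : Function.Surjective g := by
    rintro ⟨v, hv⟩
    obtain ⟨a, b, rfl⟩ := h4 v hv
    exact ⟨(a, b), rfl⟩
  have h7 := LinearMap.finrank_le_finrank_of_injective hf
  have h8 := LinearMap.finrank_le_finrank_of_surjective hg
  simp only [Module.finrank_prod, Module.finrank_fintype_fun_eq_card] at h7 h8
  omega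

theorem PosIndex.unique (h : PosIndex M Y k) (h' : PosIndex M Y k') : k = k' :=
  le_antisymm (h.le h') (h'.le h)

theorem PosIndex.of_mul_eq {M' Y' : Matrix n n ℂ} {S : Matrix m n ℂ} {S' : Matrix n m ℂ}
    (h1 : S * S' = 1) (h2 : S' * S = 1) (hM : M * S = S'.transpose.map star * M')
    (hY : Y * S = S * Y') (h : PosIndex M' Y' k) : PosIndex M Y k := by
  obtain ⟨ι, κ, _, _, P, Q, hk, hP, hQ, h3, h4, h5, h6⟩ := h
  have hform : ∀ w : n → ℂ, star (S *ᵥ w) ⬝ᵥ M *ᵥ (S *ᵥ w) = star w ⬝ᵥ M' *ᵥ w := by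
    intro w
    have h7 : star (S *ᵥ w) = star w ᵥ* S.transpose.map star := Matrix.star_mulVec S w
    rw [h7, Matrix.mulVec_mulVec, hM, ← Matrix.dotProduct_mulVec, Matrix.mulVec_mulVec,
      ← Matrix.mul_assoc, ← isRingInvolution_star.adj_mul, h2, isRingInvolution_star.adj_one,
      Matrix.one_mul]
  have hS : ∀ w : n → ℂ, S' *ᵥ (S *ᵥ w) = w := fun w => by
    rw [Matrix.mulVec_mulVec, h2, Matrix.one_mulVec]
  have hS' : ∀ w : m → ℂ, S *ᵥ (S' *ᵥ w) = w := fun w => by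
    rw [Matrix.mulVec_mulVec, h1, Matrix.one_mulVec]
  refine ⟨ι, κ, inferInstance, inferInstance, S * P, S * Q, hk, ?_, ?_, ?_, ?_, ?_, ?_⟩
  · rw [← Matrix.mul_assoc, hY, Matrix.mul_assoc, hP, Matrix.mul_zero]
  · rw [← Matrix.mul_assoc, hY, Matrix.mul_assoc, hQ, Matrix.mul_zero]
  · intro v hv
    have h7 : Y' *ᵥ (S' *ᵥ v) = 0 := by
      rw [← hS (Y' *ᵥ (S' *ᵥ v)), Matrix.mulVec_mulVec _ S Y', ← hY, ← Matrix.mulVec_mulVec, hS', hv,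
        Matrix.mulVec_zero]
    obtain ⟨a, b, hab⟩ := h3 _ h7
    refine ⟨a, b, ?_⟩
    rw [← hS' v, hab, Matrix.mulVec_add, Matrix.mulVec_mulVec, Matrix.mulVec_mulVec]
  · intro a ha
    rw [← Matrix.mulVec_mulVec, hform]
    exact h4 a ha
  · intro b
    rw [← Matrix.mulVec_mulVec, hform]
    exact h5 b
  · intro b hb
    refine h6 b ?_
    rw [← Matrix.mulVec_mulVec] at hb
    rw [← hS (Q *ᵥ b), hb, Matrix.mulVec_zero]

theorem PosIndex.sum {M' Y' : Matrix n n ℂ} (h : PosIndex M Y k) (h' : PosIndex M' Y' k') :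
    PosIndex (fromBlocks M 0 0 M') (fromBlocks Y 0 0 Y') (k + k') := by
  obtain ⟨ι, κ, _, _, P, Q, rfl, hP, hQ, h3, h4, h5, h6⟩ := h
  obtain ⟨ι', κ', _, _, P', Q', rfl, hP', hQ', h3', h4', h5', h6'⟩ := h'
  have hform : ∀ (v : m → ℂ) (w : n → ℂ),
      (star (Sum.elim v w) ⬝ᵥ fromBlocks M 0 0 M' *ᵥ Sum.elim v w).re =
        (star v ⬝ᵥ M *ᵥ v).re + (star w ⬝ᵥ M' *ᵥ w).re := by
    intro v w
    have : star (Sum.elim v w) = Sum.elim (star v) (star w) := by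
      ext (i | i) <;> rfl
    rw [this, Matrix.fromBlocks_mulVec]
    simp
  have hnonneg : ∀ a, 0 ≤ (star (P *ᵥ a) ⬝ᵥ M *ᵥ (P *ᵥ a)).re := fun a => by
    by_cases ha : a = 0
    · simp [ha]
    · exact (h4 a ha).le
  have hnonneg' : ∀ a, 0 ≤ (star (P' *ᵥ a) ⬝ᵥ M' *ᵥ (P' *ᵥ a)).re := fun a => by
    by_cases ha : a = 0
    · simp [ha]
    · exact (h4' a ha).le
  have hmul : ∀ {ι ι' : Type} [Fintype ι] [Fintype ι'] (P : Matrix m ι ℂ) (P' : Matrix n ι' ℂ)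
      (a : ι ⊕ ι' → ℂ), fromBlocks P 0 0 P' *ᵥ a =
        Sum.elim (P *ᵥ (a ∘ Sum.inl)) (P' *ᵥ (a ∘ Sum.inr)) := by
    intro ι ι' _ _ P P' a
    rw [Matrix.fromBlocks_mulVec]
    simp
  refine ⟨ι ⊕ ι', κ ⊕ κ', inferInstance, inferInstance, fromBlocks P 0 0 P', fromBlocks Q 0 0 Q',
    Fintype.card_sum, ?_, ?_, ?_, ?_, ?_, ?_⟩
  · simp [fromBlocks_multiply, hP, hP']
  · simp [fromBlocks_multiply, hQ, hQ']
  · intro v hv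
    rw [hmul] at hv
    obtain ⟨a, b, hab⟩ := h3 (v ∘ Sum.inl) (funext fun i => congrFun hv (.inl i))
    obtain ⟨a', b', hab'⟩ := h3' (v ∘ Sum.inr) (funext fun i => congrFun hv (.inr i))
    refine ⟨Sum.elim a a', Sum.elim b b', ?_⟩
    rw [hmul, hmul]
    ext (i | i)
    · exact congrFun hab i
    · exact congrFun hab' i
  · intro a ha
    rw [hmul, hform]
    by_cases ha1 : a ∘ Sum.inl = 0
    · have ha2 : a ∘ Sum.inr ≠ 0 := by
        intro ha2
        refine ha (funext fun i => ?_)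
        rcases i with i | i
        · exact congrFun ha1 i
        · exact congrFun ha2 i
      exact add_pos_of_nonneg_of_pos (hnonneg _) (h4' _ ha2)
    · exact add_pos_of_pos_of_nonneg (h4 _ ha1) (hnonneg' _)
  · intro b
    rw [hmul, hform]
    exact add_nonpos (h5 _) (h5' _)
  · intro b hb
    rw [hmul] at hb
    have h7 := h6 (b ∘ Sum.inl) (funext fun i => congrFun hb (.inl i))
    have h8 := h6' (b ∘ Sum.inr) (funext fun i => congrFun hb (.inr i))
    ext (i | i)
    · exact congrFun h7 i
    · exact congrFun h8 i

/-- If the form is nowhere positive on the kernel, then its positive index vanishes. -/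
theorem posIndex_zero (h : ∀ v, Y *ᵥ v = 0 → (star v ⬝ᵥ M *ᵥ v).re ≤ 0) : PosIndex M Y 0 := by
  let b := Module.finBasis ℂ (LinearMap.ker Y.mulVecLin)
  let Q : Matrix m (Fin (Module.finrank ℂ (LinearMap.ker Y.mulVecLin))) ℂ :=
    Matrix.of fun i j => (b j).1 i
  have hQ : ∀ c, Q *ᵥ c = ((∑ j, c j • b j : LinearMap.ker Y.mulVecLin) : m → ℂ) := by
    intro c
    ext i
    simp [Q, Matrix.mulVec, dotProduct, mul_comm]
  have hYQ : ∀ c, Y *ᵥ (Q *ᵥ c) = 0 := fun c => by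
    rw [hQ]
    exact (∑ j, c j • b j : LinearMap.ker Y.mulVecLin).2
  refine ⟨Fin 0, _, inferInstance, inferInstance, 0, Q, by simp, by simp, ?_, ?_, ?_, ?_, ?_⟩
  · ext i j
    have := congrFun (hYQ (Pi.single j 1)) i
    rwa [Matrix.mulVec_mulVec, Matrix.mulVec_single_one] at this
  · intro v hv
    refine ⟨0, b.repr ⟨v, hv⟩, ?_⟩
    rw [hQ, b.sum_repr]
    simp
  · intro a ha
    exact (ha (Subsingleton.elim _ _)).elim
  · intro c
    exact h _ (hYQ c)
  · intro c hc
    rw [hQ, ZeroMemClass.coe_eq_zero] at hc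
    exact funext fun j => Fintype.linearIndependent_iff.1 b.linearIndependent c hc j

end PosIndex

/-! ### Canonical forms of nonsingular matrices for `*`congruence: uniqueness -/

section SignIndex

variable {m n : Type} [Fintype m] [Fintype n] [DecidableEq m] [DecidableEq n]

/-- If the form on the kernel of `Y` is a positive multiple of the square of a coordinate, then its
positive index is one. -/
theorem posIndex_one {M Y : Matrix m m ℂ} (hY : Y = 0) (i₀ : m) {r : ℝ} (hr : 0 < r)
    (h : ∀ v, (star v ⬝ᵥ M *ᵥ v).re = r * ‖v i₀‖ ^ 2) : PosIndex M Y 1 := by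
  let P : Matrix m Unit ℂ := Matrix.of fun i _ => if i = i₀ then 1 else 0
  let Q : Matrix m {i // i ≠ i₀} ℂ := Matrix.of fun i j => if i = j.1 then 1 else 0
  have hP : ∀ a i, (P *ᵥ a) i = if i = i₀ then a () else 0 := by
    intro a i
    simp [P, Matrix.mulVec, dotProduct]
  have hQ : ∀ b i, (Q *ᵥ b) i = if h : i ≠ i₀ then b ⟨i, h⟩ else 0 := by
    intro b i
    simp only [Q, Matrix.mulVec, dotProduct, of_apply, ite_mul, one_mul, zero_mul]
    split_ifs with hi
    · rw [Finset.sum_eq_single ⟨i, hi⟩]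
      · rw [if_pos rfl]
      · intro j _ hj
        rw [if_neg]
        rintro rfl
        exact hj rfl
      · simp
    · refine Finset.sum_eq_zero fun j _ => if_neg ?_
      rintro rfl
      exact hi j.2
  refine ⟨Unit, {i // i ≠ i₀}, inferInstance, inferInstance, P, Q, by simp, by rw [hY, Matrix.zero_mul],
    by rw [hY, Matrix.zero_mul], ?_, ?_, ?_, ?_⟩
  · intro v _
    refine ⟨fun _ => v i₀, fun j => v j.1, funext fun i => ?_⟩
    rw [Pi.add_apply, hP, hQ]
    by_cases hi : i = i₀ <;> simp [hi]
  · intro a ha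
    rw [h, hP, if_pos rfl]
    have : a () ≠ 0 := fun h0 => ha (funext fun _ => h0)
    have := norm_pos_iff.2 this
    positivity
  · intro b
    rw [h, hQ, dif_neg (by simp)]
    simp
  · intro b hb
    funext j
    have := congrFun hb j.1
    rwa [hQ, dif_pos j.2] at this

/-- `SignIndex k θ κ A p` says that `p` is the positive index of the form with the matrix
`κ A (C - θ)^(k-1)` on the kernel of `(C - θ)^k`, where `C` is the cosquare of `A`. For a suitable
`κ` this counts the canonical blocks of size `k` that have a given coefficient. -/
def SignIndex (k : ℕ) (θ κ : ℂ) (A : Matrix m m ℂ) (p : ℕ) : Prop :=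
  ∃ C, A = A.transpose.map star * C ∧
    PosIndex (κ • (A * (C + (-θ) • 1) ^ (k - 1))) ((C + (-θ) • 1) ^ k) p

variable {A : Matrix m m ℂ} {B : Matrix n n ℂ} {k p p' : ℕ} {θ κ : ℂ}

theorem SignIndex.unique (hA : IsUnit A) (h : SignIndex k θ κ A p) (h' : SignIndex k θ κ A p') :
    p = p' := by
  obtain ⟨C, h1, h2⟩ := h
  obtain ⟨C', h1', h2'⟩ := h'
  have h3 : C = C' :=
    (isUnit_adj isRingInvolution_star hA).mul_left_cancel (h1.symm.trans h1')
  exact h2.unique (h3 ▸ h2')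

theorem SignIndex.of_mEq (h : MEq (some star) A B) (hB : SignIndex k θ κ B p) :
    SignIndex k θ κ A p := by
  obtain ⟨S, S', h1, h2, e⟩ := h
  obtain ⟨C, h3, h4⟩ := hB
  have hX : (S * C * S' + (-θ) • 1) * S = S * (C + (-θ) • 1) := by
    rw [Matrix.add_mul, Matrix.mul_add, Matrix.mul_assoc, h2, Matrix.mul_one]
    simp
  have hXk : ∀ k, (S * C * S' + (-θ) • 1) ^ k * S = S * (C + (-θ) • 1) ^ k := by
    intro k
    induction k with
    | zero => simp
    | succ k ih => rw [pow_succ, Matrix.mul_assoc, hX, ← Matrix.mul_assoc, ih, Matrix.mul_assoc,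
        ← pow_succ]
  refine ⟨S * C * S', cosq_mEq isRingInvolution_star h3 h1 h2 e, h4.of_mul_eq h1 h2 ?_ (hXk k)⟩
  simp only [tw] at e
  rw [smul_mul, Matrix.mul_assoc, hXk, ← Matrix.mul_assoc, e, Matrix.mul_smul, Matrix.mul_assoc]

theorem SignIndex.sum (h : SignIndex k θ κ A p) (h' : SignIndex k θ κ B p') :
    SignIndex k θ κ (fromBlocks A 0 0 B) (p + p') := by
  obtain ⟨C, h1, h2⟩ := h
  obtain ⟨C', h1', h2'⟩ := h'
  refine ⟨fromBlocks C 0 0 C', ?_, ?_⟩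
  · rw [adj_fromBlocks_diag isRingInvolution_star, fromBlocks_multiply]
    simp only [Matrix.mul_zero, Matrix.zero_mul, add_zero, zero_add, ← h1, ← h1']
  · have := h2.sum h2'
    rw [fromBlocks_shift, fromBlocks_pow, fromBlocks_pow, fromBlocks_multiply, fromBlocks_smul]
    simpa using this

theorem signIndex_empty [IsEmpty m] (A : Matrix m m ℂ) : SignIndex k θ κ A 0 :=
  ⟨1, Subsingleton.elim _ _, posIndex_zero fun v _ => by simp⟩

theorem HasJordan.isUnit {C : Matrix m m ℂ} {D : Multiset (ℕ × ℂ)} (h : HasJordan C D) :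
    (∀ x ∈ D, x.2 ≠ 0) → IsUnit C := by
  refine HasJordan.induction (P := fun C D => (∀ x ∈ D, x.2 ≠ 0) → IsUnit C) ?_ ?_ ?_ ?_ h
  · intro m n _ _ _ _ A B D h h' hD
    exact h.isUnit modeOK_none (h' hD)
  · intro _
    exact isUnit_of_isEmpty _
  · intro q a _ hD
    exact jordanJ_isUnit (hD _ (Multiset.mem_singleton_self _))
  · intro m n _ _ _ _ A B D D' h h' hD
    exact isUnit_fromBlocks (h fun x hx => hD x (Multiset.mem_add.2 (.inl hx)))
      (h' fun x hx => hD x (Multiset.mem_add.2 (.inr hx)))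

/-- If `θ` is not an eigenvalue of the cosquare, then the kernel in question is zero. -/
theorem signIndex_zero_of_ne {D : Multiset (ℕ × ℂ)} (h : CosqJordan star A D)
    (hD : ∀ x ∈ D, x.2 ≠ θ) : SignIndex k θ κ A 0 := by
  obtain ⟨-, C, h1, h2⟩ := h
  refine ⟨C, h1, posIndex_zero fun v hv => ?_⟩
  have h3 : IsUnit (C + (-θ) • 1) := (h2.shift (-θ)).isUnit fun x hx => by
    obtain ⟨y, hy, rfl⟩ := Multiset.mem_map.1 hx
    rw [← sub_eq_add_neg, sub_ne_zero]
    exact hD y hy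
  obtain ⟨Z, hZ⟩ := (h3.pow k).exists_left_inv
  have h4 : v = 0 := by
    rw [← Matrix.one_mulVec v, ← hZ, ← Matrix.mulVec_mulVec, hv, Matrix.mulVec_zero]
  simp [h4]

theorem jordanJ_zero_pow_mulVec (m k : ℕ) (v : Fin m → ℂ) (i : Fin m) :
    (jordanJ m (0 : ℂ) ^ k *ᵥ v) i = if h : i.val + k < m then v ⟨i.val + k, h⟩ else 0 := by
  rw [Matrix.mulVec, dotProduct]
  simp only [jordanJ_zero_pow_apply, ite_mul, one_mul, zero_mul]
  split_ifs with h
  · rw [Finset.sum_eq_single ⟨i.val + k, h⟩]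
    · rw [if_pos rfl]
    · intro j _ hj
      rw [if_neg]
      intro hij
      exact hj (Fin.ext hij.symm)
    · simp
  · exact Finset.sum_eq_zero fun j _ => if_neg (by omega)

theorem antidiag_mulVec (s : ℂ) (m : ℕ) (v : Fin m → ℂ) (i : Fin m) :
    (antidiag s m *ᵥ v) i = s ^ (m - 1 - i.val) * v i.rev := by
  rw [Matrix.mulVec, dotProduct, Finset.sum_eq_single i.rev]
  · simp only [antidiag, of_apply, Fin.val_rev]
    rw [if_pos (by omega)]
  · intro l _ hl
    simp only [antidiag, of_apply]
    rw [if_neg, zero_mul]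
    intro h
    exact hl (Fin.ext (by rw [Fin.val_rev]; omega))
  · simp

/-- The form attached to a block `a Γ_m` or `a Δ_m` depends only on two coordinates. -/
theorem exists_form_eq {m : ℕ} (hm : 0 < m) {A : Matrix (Fin m) (Fin m) ℂ} {s a b β : ℂ}
    (ha : a ≠ 0) (hb : b ≠ 0) (hβ : β ≠ 0) (h1 : A = a • (antidiag s m * (1 + β • jordanJ m 0)))
    (h2 : A.transpose.map star = b • (antidiag s m * (1 - β • jordanJ m 0))) :
    ∃ C, A = A.transpose.map star * C ∧ ∀ k, 1 ≤ k → ∀ v,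
      (C + (-(a / b)) • 1) ^ k *ᵥ v = 0 → jordanJ m (0 : ℂ) ^ k *ᵥ v = 0 ∧
      star v ⬝ᵥ (A * (C + (-(a / b)) • 1) ^ (k - 1)) *ᵥ v = a * (2 * (a / b) * β) ^ (k - 1) *
        (star (v ⟨m - 1, by omega⟩) * (jordanJ m (0 : ℂ) ^ (k - 1) *ᵥ v) ⟨0, hm⟩) := by
  obtain ⟨Y, hY, hc, h3, h4⟩ := cosq_of_nilpotent hb h1 h2
  refine ⟨_, h4, fun k hk v hv => ?_⟩
  obtain ⟨γ, hγ⟩ : ∃ γ, γ = 2 * (a / b) * β := ⟨_, rfl⟩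
  have hγ0 : γ ≠ 0 := by
    rw [hγ]
    exact mul_ne_zero (mul_ne_zero two_ne_zero (div_ne_zero ha hb)) hβ
  have hX : ∀ k, ((a / b) • 1 + ((2 * (a / b) * β) • Y) * jordanJ m 0 + (-(a / b)) • 1) ^ k =
      γ ^ k • (Y ^ k * jordanJ m 0 ^ k) := by
    intro k
    rw [← hγ, add_right_comm, ← add_smul, add_neg_cancel, zero_smul, zero_add, smul_mul, smul_pow,
      hc.mul_pow]
  rw [hX] at hv ⊢
  have hker : jordanJ m (0 : ℂ) ^ k *ᵥ v = 0 := by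
    obtain ⟨Z, hZ⟩ := (hY.pow k).exists_left_inv
    rw [Matrix.smul_mulVec, smul_eq_zero] at hv
    have h5 := hv.resolve_left (pow_ne_zero k hγ0)
    rw [← Matrix.one_mulVec (jordanJ m (0 : ℂ) ^ k *ᵥ v), ← hZ, ← Matrix.mulVec_mulVec,
      Matrix.mulVec_mulVec _ (Y ^ k), h5, Matrix.mulVec_zero]
  refine ⟨hker, ?_⟩
  obtain ⟨w, hw⟩ : ∃ w, w = jordanJ m (0 : ℂ) ^ (k - 1) *ᵥ v := ⟨_, rfl⟩
  have hNw : jordanJ m (0 : ℂ) *ᵥ w = 0 := by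
    rw [hw, Matrix.mulVec_mulVec, ← pow_succ', Nat.sub_add_cancel hk, hker]
  have hYw : Y *ᵥ w = w := by
    have h5 : (1 - β • jordanJ m 0) *ᵥ w = w := by
      rw [Matrix.sub_mulVec, Matrix.smul_mulVec, hNw, Matrix.one_mulVec, smul_zero, sub_zero]
    conv_lhs => rw [← h5]
    rw [Matrix.mulVec_mulVec, mul_eq_one_comm.1 h3, Matrix.one_mulVec]
  have hYkw : ∀ k, Y ^ k *ᵥ w = w := by
    intro k
    induction k with
    | zero => rw [pow_zero, Matrix.one_mulVec]
    | succ k ih => rw [pow_succ, ← Matrix.mulVec_mulVec, hYw, ih]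
  have hAw : A *ᵥ w = a • (antidiag s m *ᵥ w) := by
    rw [h1, Matrix.smul_mulVec, ← Matrix.mulVec_mulVec, Matrix.add_mulVec, Matrix.smul_mulVec, hNw,
      Matrix.one_mulVec, smul_zero, add_zero]
  rw [Matrix.mul_smul, Matrix.smul_mulVec, ← Matrix.mulVec_mulVec, ← Matrix.mulVec_mulVec, ← hw, hYkw,
    hAw, dotProduct_smul, dotProduct_smul, ← hγ, smul_eq_mul, smul_eq_mul, ← mul_assoc,
    mul_comm (γ ^ (k - 1))]
  congr 1
  rw [dotProduct, Finset.sum_eq_single ⟨m - 1, by omega⟩]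
  · rw [antidiag_mulVec, Pi.star_apply, Nat.sub_self, pow_zero, one_mul]
    congr 2
    exact Fin.ext (by rw [Fin.val_rev]; simp only; omega)
  · intro i _ hi
    have h5 : (i.rev).val ≠ 0 := by
      intro h
      refine hi (Fin.ext ?_)
      rw [Fin.val_rev] at h
      simp only
      omega
    have h6 := congrFun hNw ⟨i.rev.val - 1, by omega⟩
    rw [← pow_one (jordanJ m (0 : ℂ)), jordanJ_zero_pow_mulVec, dif_pos (by simp only; omega)] at h6
    have h7 : w i.rev = 0 := by
      rw [← h6.trans (Pi.zero_apply _)]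
      congr 1
      exact Fin.ext (by simp only; omega)
    rw [antidiag_mulVec, h7, mul_zero, mul_zero]
  · simp

end SignIndex

section StarUniqueness

variable {G : ∀ n : ℕ, Matrix (Fin n) (Fin n) ℂ} {s β : ℂ} {ε : ℕ → ℂ}

theorem norm_sq_mul_ε (hG : IsStarFamily G s β ε) {c : ℂ} (hc : ‖c‖ = 1) (n : ℕ) :
    ‖c ^ 2 * ε n‖ = 1 := by
  rw [norm_mul, norm_pow, hc, one_pow, one_mul, hG.norm_ε]

/-- The constant `κ` is chosen such that the form of `d • G n` on the kernel is a real multiple of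
the square of the absolute value of one coordinate. If `d ^ 2 = c ^ 2`, the factor is positive for
`d = c` and negative for `d = -c`. At other sizes the form vanishes. -/
theorem signIndex_unim (hG : IsStarFamily G s β ε) {m n : ℕ} (hm : 1 ≤ m) (hn : 1 ≤ n) {c d : ℂ}
    (hc : ‖c‖ = 1) (hd : ‖d‖ = 1) :
    SignIndex n (c ^ 2 * ε n) (star (c * (2 * (c ^ 2 * ε n) * β) ^ (n - 1))) (d • G m)
      (if m = n ∧ d = c then 1 else 0) := by
  have hc0 : c ≠ 0 := fun h => by simp [h] at hc
  have hd0 : d ≠ 0 := fun h => by simp [h] at hd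
  have hcos := hG.cosqJordan (.unim m hm d hd)
  by_cases hθ : d ^ 2 * ε m = c ^ 2 * ε n
  swap
  · rw [if_neg (by rintro ⟨rfl, rfl⟩; exact hθ rfl)]
    refine signIndex_zero_of_ne hcos fun x hx => ?_
    obtain rfl := Multiset.mem_singleton.1 hx
    exact hθ
  obtain ⟨C, h1, h2⟩ := exists_form_eq hm hd0
    (mul_ne_zero (star_ne_zero.2 hd0) (hG.ε_ne_zero m)) hG.β_ne_zero (by rw [hG.eq])
    (hG.adj_eq m hm d)
  rw [hG.div_eq hd, hθ] at h2
  obtain ⟨γ, hγ⟩ : ∃ γ, γ = (2 * (c ^ 2 * ε n) * β) ^ (n - 1) := ⟨_, rfl⟩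
  have hγ0 : γ ≠ 0 := by
    rw [hγ]
    exact pow_ne_zero _ (mul_ne_zero (mul_ne_zero two_ne_zero
      (mul_ne_zero (pow_ne_zero 2 hc0) (hG.ε_ne_zero n))) hG.β_ne_zero)
  rw [← hγ]
  have h3 : ∀ v, (C + (-(c ^ 2 * ε n)) • 1) ^ n *ᵥ v = 0 → jordanJ m (0 : ℂ) ^ n *ᵥ v = 0 ∧
      star v ⬝ᵥ (star (c * γ) • (d • G m * (C + (-(c ^ 2 * ε n)) • 1) ^ (n - 1))) *ᵥ v =
        star (c * γ) * (d * γ) * (star (v ⟨m - 1, by omega⟩) *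
          (jordanJ m (0 : ℂ) ^ (n - 1) *ᵥ v) ⟨0, hm⟩) := by
    intro v hv
    obtain ⟨h4, h5⟩ := h2 n hn v hv
    refine ⟨h4, ?_⟩
    rw [Matrix.smul_mulVec, dotProduct_smul, h5, ← hγ, smul_eq_mul]
    ring
  refine ⟨C, h1, ?_⟩
  by_cases hmn : m = n
  swap
  · -- the form vanishes on the kernel
    rw [if_neg fun h => hmn h.1]
    refine posIndex_zero fun v hv => ?_
    obtain ⟨h4, h5⟩ := h3 v hv
    rw [h5]
    have h6 : star (v ⟨m - 1, by omega⟩) * (jordanJ m (0 : ℂ) ^ (n - 1) *ᵥ v) ⟨0, hm⟩ = 0 := by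
      rcases lt_or_gt_of_ne hmn with h | h
      · rw [jordanJ_zero_pow_mulVec, dif_neg (by simp only; omega), mul_zero]
      · have h7 := congrFun h4 ⟨m - 1 - n, by omega⟩
        rw [jordanJ_zero_pow_mulVec, dif_pos (by simp only; omega), Pi.zero_apply] at h7
        have h8 : v ⟨m - 1, by omega⟩ = 0 := by
          rw [← h7]
          congr 1
          exact Fin.ext (by simp only; omega)
        rw [h8, star_zero, zero_mul]
    rw [h6, mul_zero, Complex.zero_re]
  subst hmn
  simp only [true_and]
  have hcd : d = c ∨ d = -c := by
    have := mul_right_cancel₀ (hG.ε_ne_zero m) hθ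
    exact sq_eq_sq_iff_eq_or_eq_neg.1 this
  -- at this size the kernel is the whole space, and the form is `± |v_m|²`, up to a positive factor
  have hN : ∀ v : Fin m → ℂ, (jordanJ m (0 : ℂ) ^ (m - 1) *ᵥ v) ⟨0, hm⟩ = v ⟨m - 1, by omega⟩ := by
    intro v
    rw [jordanJ_zero_pow_mulVec, dif_pos (by simp only; omega)]
    congr 1
    exact Fin.ext (by simp only; omega)
  have hsq : ∀ z : ℂ, star z * z = ((‖z‖ ^ 2 : ℝ) : ℂ) := fun z => by
    rw [Complex.ofReal_pow]
    exact Complex.conj_mul' z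
  have hpos : 0 < ‖c * γ‖ ^ 2 := by
    have := norm_pos_iff.2 (mul_ne_zero hc0 hγ0)
    positivity
  have hker : (C + (-(c ^ 2 * ε m)) • 1) ^ m = 0 := by
    obtain ⟨-, C', h4, h5⟩ := hcos
    have h6 : C = C' := (isUnit_adj isRingInvolution_star
      (hG.cosqJordan (.unim m hm d hd)).1).mul_left_cancel (h1.symm.trans h4)
    rw [h6]
    refine ((h5.shift (-(c ^ 2 * ε m))).pow_eq_zero_iff m).2 fun x hx => ?_
    obtain ⟨y, hy, rfl⟩ := Multiset.mem_map.1 hx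
    obtain rfl := Multiset.mem_singleton.1 hy
    exact ⟨by simp only; rw [hθ, add_neg_cancel], le_rfl⟩
  rcases hcd with rfl | rfl
  · rw [if_pos rfl]
    refine posIndex_one hker ⟨m - 1, by omega⟩ hpos fun v => ?_
    rw [(h3 v (by rw [hker, Matrix.zero_mulVec])).2, hN, hsq, hsq, ← Complex.ofReal_mul,
      Complex.ofReal_re]
  · rw [if_neg]
    swap
    · intro h
      exact hc0 (self_eq_neg.1 h.symm)
    refine posIndex_zero fun v hv => ?_
    rw [(h3 v hv).2, hN, neg_mul, mul_neg, hsq, hsq, neg_mul, ← Complex.ofReal_mul,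
      ← Complex.ofReal_neg, Complex.ofReal_re]
    have := sq_nonneg ‖v ⟨m - 1, by omega⟩‖
    nlinarith

open Classical in
theorem StarBlock.signIndex (hG : IsStarFamily G s β ε) {n : ℕ} (hn : 1 ≤ n) {c : ℂ}
    (hc : ‖c‖ = 1) (b : StarBlock) :
    SignIndex n (c ^ 2 * ε n) (star (c * (2 * (c ^ 2 * ε n) * β) ^ (n - 1))) (b.toMat G).2
      (if b = .unim n hn c hc then 1 else 0) := by
  cases b with
  | unim m hm d hd =>
    have := signIndex_unim hG hm hn hc hd
    simp only [StarBlock.unim.injEq]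
    exact this
  | hyp m hm d hd =>
    rw [if_neg (by simp)]
    refine signIndex_zero_of_ne (hG.cosqJordan (.hyp m hm d hd)) fun x hx h => ?_
    have h1 := norm_sq_mul_ε hG hc n
    rw [← h] at h1
    simp only [data, Multiset.insert_eq_cons, Multiset.mem_cons, Multiset.mem_singleton] at hx
    rcases hx with rfl | rfl
    · exact hd.ne' h1
    · rw [norm_inv, norm_star, inv_eq_one] at h1
      exact hd.ne' h1

open Classical in
/-- The sign index counts the summands `c • G n`. -/
theorem signIndex_dsumMat (hG : IsStarFamily G s β ε) {n : ℕ} (hn : 1 ≤ n) {c : ℂ}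
    (hc : ‖c‖ = 1) (L : List StarBlock) :
    SignIndex n (c ^ 2 * ε n) (star (c * (2 * (c ^ 2 * ε n) * β) ^ (n - 1)))
      (dsumMat (L.map (StarBlock.toMat G))).2 (L.count (.unim n hn c hc)) := by
  have hμ := modeOK_some isRingInvolution_star
  induction L with
  | nil =>
    have := isEmpty_dsumMat_nil (F := ℂ)
    exact signIndex_empty (m := Fin (dsumMat ([] : List (SqMat ℂ))).1) _
  | cons b L ih =>
    have h := (b.signIndex hG hn hc).sum ih
    rw [List.count_cons, add_comm]
    simp only [beq_iff_eq]
    exact h.of_mEq ((MEq.dsumMat_cons hμ _ _).symm hμ)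

open Classical in
/-- The eigenvalues of the cosquare outside the unit circle count the summands `H_{2n}(c)`. -/
theorem count_data (hG : IsStarFamily G s β ε) {n : ℕ} (hn : 1 ≤ n) {c : ℂ} (hc : 1 < ‖c‖)
    (L : List StarBlock) :
    (L.map (StarBlock.data ε)).sum.count (n, c) = L.count (.hyp n hn c hc) := by
  induction L with
  | nil => simp
  | cons b L ih =>
    rw [List.map_cons, List.sum_cons, Multiset.count_add, ih, List.count_cons, add_comm]
    simp only [beq_iff_eq]
    congr 1
    cases b with
    | unim m hm d hd =>
      rw [if_neg (by simp), StarBlock.data, Multiset.count_singleton, if_neg]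
      rintro h
      have := norm_sq_mul_ε hG hd m
      have h' : c = d ^ 2 * ε m := (Prod.ext_iff.1 h).2
      rw [← h'] at this
      exact hc.ne' this
    | hyp m hm d hd =>
      have h1 : ‖(star d)⁻¹‖ < 1 := by
        rw [norm_inv, norm_star]
        exact inv_lt_one_of_one_lt₀ hd
      have h2 : (n, c) ≠ (m, (star d)⁻¹) := by
        intro h
        have h' : c = (star d)⁻¹ := (Prod.ext_iff.1 h).2
        rw [← h'] at h1
        exact absurd h1 (not_lt.2 hc.le)
      rw [StarBlock.data, Multiset.insert_eq_cons, Multiset.count_cons, Multiset.count_singleton,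
        if_neg h2, zero_add]
      simp only [StarBlock.hyp.injEq, Prod.mk.injEq, eq_comm]

theorem starBlocks_mEq_iff (hG : IsStarFamily G s β ε) (Ks Ks' : List StarBlock) :
    MEq (some star) (dsumMat (Ks.map (StarBlock.toMat G))).2
      (dsumMat (Ks'.map (StarBlock.toMat G))).2 ↔ Ks.Perm Ks' := by
  classical
  have hσ := isRingInvolution_star
  have hμ := modeOK_some hσ
  refine ⟨fun h => List.perm_iff_count.2 fun b => ?_, fun h => MEq.dsumMat_perm hμ (h.map _)⟩
  have h1 := cosqJordan_dsumMat hσ hG.cosqJordan Ks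
  have h2 := cosqJordan_dsumMat hσ hG.cosqJordan Ks'
  cases b with
  | unim n hn c hc =>
    exact (signIndex_dsumMat hG hn hc Ks).unique h1.1 ((signIndex_dsumMat hG hn hc Ks').of_mEq h)
  | hyp n hn c hc =>
    rw [← count_data hG hn hc, ← count_data hG hn hc, h1.unique hσ (h2.of_mEq hσ h)]

end StarUniqueness

theorem theorem9 {t : ℕ} (k : Fin t) :
    -- (a), `*`congruence
    (∀ (F : Type*) [DivisionRing F] (σ : F → F), IsRingInvolution σ → ∀ A : Bangle F k,
      (∃ R : RegularizedForm F k, R.IsDecompForCongruence σ A) ∧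
      ∀ R R' : RegularizedForm F k,
        R.IsDecompForCongruence σ A → R'.IsDecompForCongruence σ A →
          R.regPart.IsCongruent σ R'.regPart ∧ R.sing.Perm R'.sing) ∧
    -- (a), similarity
    (∀ (F : Type*) [DivisionRing F] (A : Bangle F k),
      (∃ R : RegularizedForm F k, R.IsDecompForSimilarity A) ∧
      ∀ R R' : RegularizedForm F k,
        R.IsDecompForSimilarity A → R'.IsDecompForSimilarity A →
          R.regPart.IsSimilar R'.regPart ∧ R.sing.Perm R'.sing) ∧
    -- (b), congruence over `ℂ`
    (∀ (A : Bangle ℂ k) (R : RegularizedForm ℂ k), R.IsDecompForCongruence id A →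
      ∃ Ks : List CongBlock,
        R.regPart.IsCongruent id (Bangle.dsumList (Ks.map (CongBlock.toBangle k))) ∧
        A.IsCongruent id
          ((Bangle.dsumList (Ks.map (CongBlock.toBangle k))).dsum (singularPart ℂ R.sing)) ∧
        ∀ (Ks' : List CongBlock) (L' : List (SingularSummand k)),
          A.IsCongruent id
              ((Bangle.dsumList (Ks'.map (CongBlock.toBangle k))).dsum (singularPart ℂ L')) ↔
            Multiset.Rel CongBlock.Same (Ks : Multiset CongBlock) (Ks' : Multiset CongBlock) ∧
              R.sing.Perm L') ∧
    -- (b), `*`congruence over `ℂ` with complex conjugation, with either choice of `Γ` or `Δ`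
    (∀ G : (∀ n : ℕ, Matrix (Fin n) (Fin n) ℂ), G = Gam ∨ G = Del →
      ∀ (A : Bangle ℂ k) (R : RegularizedForm ℂ k), R.IsDecompForCongruence star A →
      ∃ Ks : List StarBlock,
        R.regPart.IsCongruent star (Bangle.dsumList (Ks.map (StarBlock.toBangle G k))) ∧
        A.IsCongruent star
          ((Bangle.dsumList (Ks.map (StarBlock.toBangle G k))).dsum (singularPart ℂ R.sing)) ∧
        ∀ (Ks' : List StarBlock) (L' : List (SingularSummand k)),
          A.IsCongruent star
              ((Bangle.dsumList (Ks'.map (StarBlock.toBangle G k))).dsum (singularPart ℂ L')) ↔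
            Ks.Perm Ks' ∧ R.sing.Perm L') ∧
    -- (c), similarity over `ℂ`
    (∀ (A : Bangle ℂ k) (R : RegularizedForm ℂ k), R.IsDecompForSimilarity A →
      ∃ Ks : List JordanBlock,
        R.regPart.IsSimilar (Bangle.dsumList (Ks.map (JordanBlock.toBangle k))) ∧
        A.IsSimilar
          ((Bangle.dsumList (Ks.map (JordanBlock.toBangle k))).dsum (singularPart ℂ R.sing)) ∧
        ∀ (Ks' : List JordanBlock) (L' : List (SingularSummand k)),
          A.IsSimilar
              ((Bangle.dsumList (Ks'.map (JordanBlock.toBangle k))).dsum (singularPart ℂ L')) ↔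
            Ks.Perm Ks' ∧ R.sing.Perm L') := by
  refine ⟨fun F _ σ hσ A => ?_, fun F _ A => ?_, fun A R hR => ?_, fun G hG A R hR => ?_,
    fun A R hR => ?_⟩
  · have hμ := modeOK_some hσ
    simp only [RegularizedForm.IsDecompForCongruence, Bangle.isCongruent_iff hσ]
    refine ⟨exists_regularizedForm hμ A, fun R R' h h' => ?_⟩
    obtain ⟨h1, h2⟩ := regularizedForm_unique hμ ((h.symm hμ).trans hμ h')
    exact ⟨(Bangle.ofBox_equivalent_iff hμ).2 h1, h2⟩
  · have hμ := modeOK_none (F := F)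
    simp only [RegularizedForm.IsDecompForSimilarity, Bangle.isSimilar_iff]
    refine ⟨exists_regularizedForm hμ A, fun R R' h h' => ?_⟩
    obtain ⟨h1, h2⟩ := regularizedForm_unique hμ ((h.symm hμ).trans hμ h')
    exact ⟨(Bangle.ofBox_equivalent_iff hμ).2 h1, h2⟩
  · have hσ := isRingInvolution_id (F := ℂ)
    have e : CongBlock.toBangle k = fun b => Bangle.ofBox k b.toMat.2 := by
      funext b; cases b <;> rfl
    simp only [RegularizedForm.IsDecompForCongruence, Bangle.isCongruent_iff hσ, e] at hR ⊢
    exact exists_canonical_form (modeOK_some hσ) CongBlock.toMat (fun b => b.cosqJordan.1) _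
      exists_congBlocks congBlocks_unique hR
  · have hσ := isRingInvolution_star
    obtain ⟨s, β, ε, hG⟩ := exists_isStarFamily hG
    have e : StarBlock.toBangle G k = fun b => Bangle.ofBox k (b.toMat G).2 := by
      funext b; cases b <;> rfl
    simp only [RegularizedForm.IsDecompForCongruence, Bangle.isCongruent_iff hσ, e] at hR ⊢
    exact exists_canonical_form (modeOK_some hσ) (StarBlock.toMat G) (fun b => (hG.cosqJordan b).1) _
      (fun _ K hK => exists_starBlocks hG K hK) (starBlocks_mEq_iff hG) hR
  · have e : JordanBlock.toBangle k = fun b => Bangle.ofBox k b.toMat.2 := rfl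
    simp only [RegularizedForm.IsDecompForSimilarity, Bangle.isSimilar_iff, e] at hR ⊢
    exact exists_canonical_form modeOK_none JordanBlock.toMat jordanBlock_isUnit _
      exists_jordanBlocks jordanBlocks_mEq_iff hR
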